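/- **Setting.** Let $n\ge 0$ entities move in $\mathbb R^1$ during $[t_0,t_\tau]$ along piecewise linear trajectories, each with $\tau$ edges and with its vertices at the common times $t_0<\dots<t_\tau$; write $\sigma(t)$ for the position of entity $\sigma$ at time $t$. Two different trajectories meet only in finitely many points. Take $\varepsilon=0$: a *trajectoid* on a time interval is a map $\mathcal T$ from times to entities that jumps between entities only when they are at the same position, so that $\mathcal T(t)$, regarded as a position, is continuous in $t$. A *central trajectory* on $[a,b]$ is a trajectoid on $[a,b]$ that minimizes $\int_a^b\max_\psi|\mathcal T(t)-\psi(t)|\,dt$. Its *break points* are the times in $(a,b)$ around which it is not constant as a map to the entities (its value at the time itself being ignored). The *ideal trajectory* $\mathcal I(t)$ is the average of the highest and the lowest position at time $t$. An *elementary interval* is a maximal subinterval of some $[t_i,t_{i+1}]$ on which $\mathcal I$ is a single line segment. **Clipped arrangement.** Let $n$ pairwise distinct non-vertical lines be given, none of them parallel to the $x$-axis $\mathcal I$. Split each line at $\mathcal I$ into two closed half-lines. Whenever two half-lines on the same side of $\mathcal I$, both increasing or both decreasing, meet in a point $v$, remove from the steeper one the part beyond $v$ (seen from $\mathcal I$).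 The result is the clipped arrangement $\mathcal A'$; its vertices are the points lying on two different clipped half-lines, its edges are the components of its union minus the vertices, its faces are the components of the complement of its union. The *zone* of $\mathcal I$ consists of the faces that meet $\mathcal I$ and the edges (with end points) bounding them; its *complexity* is the number of these edges. For an elementary interval, $\mathcal A'$ is formed from the $n$ full lines carrying $t\mapsto\sigma(t)-\mathcal I(t)$ on this interval. The arrangement $\mathcal A^*$ in the strip $[t_0,t_\tau]\times\mathbb R$ is the concatenation of these arrangements, each restricted to the vertical slab over its elementary interval, where points on slab boundaries count as vertices; the *global zone* is the zone of $\mathcal I$ (the $x$-axis) in $\mathcal A^*$. **Theorem.** 1. For $n$ lines as above, the zone of the $x$-axis in $\mathcal A'$ has complexity at most $8n$. If $a<b$ and $\mathcal T$ is a trajectoid on $[a,b]$ for these lines that minimizes $\int_a^b|\mathcal T(t)|\,dt$, then the graph of $\mathcal T$ over $[a,b]$ is contained in this zone, and $\mathcal T$ has at most $8n$ vertices (its break points together with $a$ and $b$). 2. Let $[a,b]$ be an elementary interval during which no entity moves parallel to $\mathcal I$. The zone of $\mathcal I$ in its arrangement $\mathcal A'$ has complexity at most $8n$. If $\mathcal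 T$ is a central trajectory on $[a,b]$, then $(t,\mathcal T(t)-\mathcal I(t))$ lies in this zone for all $t\in[a,b]$, and $\mathcal T$ has at most $8n$ vertices. 3. If no entity moves parallel to $\mathcal I$ during any elementary interval, then the global zone has complexity at most $24\tau n^2+48\tau n$. 4. There is an absolute constant $C$ such that, for $\tau\ge1$, every central trajectory on $[t_0,t_\tau]$ has at most $C\tau n^2$ vertices (its break points together with $t_0,\dots,t_\tau$); that is, its complexity is $O(\tau n^2)$. -/

import Mathlib

open Set Filter Topology

noncomputable section

namespace CentralTrajectory

/-! ### Trajectoids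

`pos σ t` is the position in `ℝ` of the entity `σ : Fin n` at time `t`. -/

/-- `σ` and `ψ` are `ε`-connected at time `t`: there is a sequence of entities from `σ` to `ψ` in
which consecutive entities are at distance at most `ε` at time `t`. -/
def EpsConnected {n : ℕ} (pos : Fin n → ℝ → ℝ) (ε t : ℝ) (σ ψ : Fin n) : Prop :=
  Relation.ReflTransGen (fun ρ ρ' => |pos ρ t - pos ρ' t| ≤ ε) σ ψ

/-- A trajectoid on the time interval `[a, b]`: a map from times to entities which, at any time
`t`, jumps only between `ε`-connected entities. The entities that take part in a jump at `t` are
`T t` and all `σ` that `T` uses at times arbitrarily close to `t`. For `ε = 0` this says that the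
position `t ↦ pos (T t) t` is continuous on `[a, b]`. -/
def IsTrajectoid {n : ℕ} (pos : Fin n → ℝ → ℝ) (ε a b : ℝ) (T : ℝ → Fin n) : Prop :=
  ∀ t ∈ Icc a b, ∀ σ : Fin n,
    (∃ᶠ s in 𝓝[Icc a b] t, T s = σ) → EpsConnected pos ε t (T t) σ

/-- `D(T, t)`: the distance from the entity `T t` to the entity farthest from it at time `t`. -/
def farthest {n : ℕ} (pos : Fin n → ℝ → ℝ) (T : ℝ → Fin n) (t : ℝ) : ℝ :=
  ⨆ ψ : Fin n, |pos (T t) t - pos ψ t|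

/-- `T` is a central trajectory on `[a, b]`: a trajectoid that minimizes `∫ D(T, t) dt`. -/
def IsCentral {n : ℕ} (pos : Fin n → ℝ → ℝ) (ε a b : ℝ) (T : ℝ → Fin n) : Prop :=
  IsTrajectoid pos ε a b T ∧ ∀ S : ℝ → Fin n, IsTrajectoid pos ε a b S →
    ∫ t in a..b, farthest pos T t ≤ ∫ t in a..b, farthest pos S t

/-- `T` is a trajectoid on `[a, b]` that minimizes `∫ |T(t)| dt`, the area between `T` and the
`x`-axis. -/
def IsAreaMinimal {n : ℕ} (pos : Fin n → ℝ → ℝ) (ε a b : ℝ) (T : ℝ → Fin n) : Prop :=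
  IsTrajectoid pos ε a b T ∧ ∀ S : ℝ → Fin n, IsTrajectoid pos ε a b S →
    ∫ t in a..b, |pos (T t) t| ≤ ∫ t in a..b, |pos (S t) t|

/-- The break points of `T` inside `(a, b)`: the times around which `T` is not constant. The value
of `T` at the single time `t` itself is irrelevant. -/
def breakTimes {n : ℕ} (T : ℝ → Fin n) (a b : ℝ) : Set ℝ :=
  {t ∈ Ioo a b | ¬ ∃ σ : Fin n, ∀ᶠ s in 𝓝[≠] t, T s = σ}

/-! ### Arrangements and zones in the plane

The first coordinate is time, the second one is the position. An arrangement inside a domain `W` is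
given by its support `S` (the union of its curves) and its set `V` of vertices. -/

/-- The faces: the connected components of `W` minus the support. -/
def faces (W S : Set (ℝ × ℝ)) : Set (Set (ℝ × ℝ)) :=
  {F | ∃ p ∈ W \ S, F = connectedComponentIn (W \ S) p}

/-- The (relatively open) edges: the connected components of the support minus the vertices. -/
def edges (S V : Set (ℝ × ℝ)) : Set (Set (ℝ × ℝ)) :=
  {e | ∃ p ∈ S \ V, e = connectedComponentIn (S \ V) p}

/-- The `x`-axis (where the ideal trajectory lies). -/
def xAxis : Set (ℝ × ℝ) := {p | p.2 = 0}

/-- The faces that are intersected by the `x`-axis. -/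
def zoneFaces (W S : Set (ℝ × ℝ)) : Set (Set (ℝ × ℝ)) :=
  {F ∈ faces W S | (F ∩ xAxis).Nonempty}

/-- The edges that bound a face intersected by the `x`-axis. -/
def zoneEdges (W S V : Set (ℝ × ℝ)) : Set (Set (ℝ × ℝ)) :=
  {e ∈ edges S V | ∃ F ∈ zoneFaces W S, e ⊆ closure F}

/-- The zone of the `x`-axis: the faces that it intersects, together with the edges bounding them
(with their end points). -/
def zone (W S V : Set (ℝ × ℝ)) : Set (ℝ × ℝ) :=
  ⋃₀ zoneFaces W S ∪ ⋃ e ∈ zoneEdges W S V, closure e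

/-! ### The clipped arrangement of half-lines -/

/-- `n` non-vertical lines `y = slope i * x + offset i`. -/
structure LineFamily (n : ℕ) where
  slope : Fin n → ℝ
  offset : Fin n → ℝ

namespace LineFamily

variable {n : ℕ}

/-- The height of line `i` at `x`; as a function of time, the position of an entity. -/
def eval (L : LineFamily n) (i : Fin n) (x : ℝ) : ℝ := L.slope i * x + L.offset i

/-- The lines are pairwise distinct. -/
def Distinct (L : LineFamily n) : Prop :=
  ∀ i j : Fin n, L.slope i = L.slope j → L.offset i = L.offset j → i = j

/-- No line is parallel to the `x`-axis. -/
def NoHorizontal (L : LineFamily n) : Prop := ∀ i : Fin n, L.slope i ≠ 0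

/-- The positive (`s = true`) or negative (`s = false`) closed half-line into which the `x`-axis
splits line `i`. -/
def halfLine (L : LineFamily n) (s : Bool) (i : Fin n) : Set (ℝ × ℝ) :=
  {p | p.2 = L.eval i p.1 ∧ if s then 0 ≤ p.2 else p.2 ≤ 0}

/-- The half-line after clipping. For two half-lines on the same side of the `x`-axis, both
increasing or both decreasing, that meet in `v`, the part of the steeper one beyond `v` is removed.
A half-line starts at the `x`-axis, so `p` lies beyond `v` iff `p` is farther from the axis. -/
def clipped (L : LineFamily n) (s : Bool) (i : Fin n) : Set (ℝ × ℝ) :=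
  {p ∈ L.halfLine s i | ∀ j : Fin n, 0 < L.slope i * L.slope j → |L.slope j| < |L.slope i| →
    ∀ v ∈ L.halfLine s i ∩ L.halfLine s j, |p.2| ≤ |v.2|}

/-- The union of all clipped half-lines. -/
def support (L : LineFamily n) : Set (ℝ × ℝ) := ⋃ s : Bool, ⋃ i : Fin n, L.clipped s i

/-- The vertices of the clipped arrangement: the points on two different clipped half-lines. These
include the end points, as the two halves of a line share the point on the axis, and a half-line
that was clipped ends on another clipped half-line. -/
def vertices (L : LineFamily n) : Set (ℝ × ℝ) :=
  {p | ∃ k l : Bool × Fin n, k ≠ l ∧ p ∈ L.clipped k.1 k.2 ∧ p ∈ L.clipped l.1 l.2}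

/-- The edges in the zone of the `x`-axis in the clipped arrangement. -/
def clippedZoneEdges (L : LineFamily n) : Set (Set (ℝ × ℝ)) :=
  zoneEdges univ L.support L.vertices

/-- The zone of the `x`-axis in the clipped arrangement. -/
def clippedZone (L : LineFamily n) : Set (ℝ × ℝ) := zone univ L.support L.vertices

end LineFamily

/-! ### Piecewise linear trajectories -/

/-- `n` entities moving in `ℝ` during `[t_0, t_τ]` along piecewise linear trajectories, each with
`τ` edges and with its vertices at the common times `t_0 < … < t_τ`. -/
structure Entities (n τ : ℕ) where
  time : Fin (τ + 1) → ℝ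
  time_strictMono : StrictMono time
  pos : Fin n → ℝ → ℝ
  linear : ∀ (σ : Fin n) (i : Fin τ), ∃ α β : ℝ,
    ∀ t ∈ Icc (time i.castSucc) (time i.succ), pos σ t = α * t + β

namespace Entities

variable {n τ : ℕ}

/-- The first time `t_0`. -/
def first (X : Entities n τ) : ℝ := X.time 0

/-- The last time `t_τ`. -/
def last (X : Entities n τ) : ℝ := X.time (Fin.last τ)

/-- Trajectories of two different entities meet in isolated points only. -/
def Generic (X : Entities n τ) : Prop :=
  ∀ σ ψ : Fin n, σ ≠ ψ → {t ∈ Icc X.first X.last | X.pos σ t = X.pos ψ t}.Finite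

/-- The ideal trajectory: the average of the highest and the lowest entity. -/
def ideal (X : Entities n τ) (t : ℝ) : ℝ := ((⨆ σ, X.pos σ t) + ⨅ σ, X.pos σ t) / 2

/-- `[a, b]` is a nondegenerate interval inside some `[t_i, t_{i+1}]` on which the ideal trajectory
is a single line segment. -/
def IdealStraight (X : Entities n τ) (i : Fin τ) (a b : ℝ) : Prop :=
  a < b ∧ X.time i.castSucc ≤ a ∧ b ≤ X.time i.succ ∧
    ∃ α β : ℝ, ∀ t ∈ Icc a b, X.ideal t = α * t + β

/-- `[a, b]` is an elementary interval: a maximal subinterval of some `[t_i, t_{i+1}]` on which the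
ideal trajectory is a single line segment. -/
def IsElementary (X : Entities n τ) (a b : ℝ) : Prop :=
  ∃ i : Fin τ, X.IdealStraight i a b ∧
    ∀ a' b' : ℝ, a' ≤ a → b ≤ b' → X.IdealStraight i a' b' → a' = a ∧ b' = b

/-- The lines along which the entities move relative to the ideal trajectory during the elementary
interval `[a, b]`: line `σ` runs through `(a, σ(a) - I(a))` and `(b, σ(b) - I(b))`, where `I` is the
ideal trajectory, so that `I` becomes the `x`-axis. -/
def relLines (X : Entities n τ) (a b : ℝ) : LineFamily n where
  slope σ := ((X.pos σ b - X.ideal b) - (X.pos σ a - X.ideal a)) / (b - a)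
  offset σ := (X.pos σ a - X.ideal a) -
    ((X.pos σ b - X.ideal b) - (X.pos σ a - X.ideal a)) / (b - a) * a

/-- During no elementary interval does an entity move parallel to the ideal trajectory. -/
def NeverParallel (X : Entities n τ) : Prop :=
  ∀ a b : ℝ, X.IsElementary a b → (X.relLines a b).NoHorizontal

/-- The vertical strip of all points whose time lies in `[t_0, t_τ]`. -/
def strip (X : Entities n τ) : Set (ℝ × ℝ) := {p | p.1 ∈ Icc X.first X.last}

/-- The support of the concatenation of the clipped arrangements, each one restricted to the
vertical slab over its elementary interval. Positions are relative to the ideal trajectory. -/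
def globalSupport (X : Entities n τ) : Set (ℝ × ℝ) :=
  {p | ∃ a b : ℝ, X.IsElementary a b ∧ p.1 ∈ Icc a b ∧ p ∈ (X.relLines a b).support}

/-- The vertices of the concatenated arrangement: those of the clipped arrangements in their slabs,
and the points where its curves meet the boundaries of the slabs. -/
def globalVertices (X : Entities n τ) : Set (ℝ × ℝ) :=
  {p | ∃ a b : ℝ, X.IsElementary a b ∧ p.1 ∈ Icc a b ∧ p ∈ (X.relLines a b).vertices} ∪
    {p ∈ X.globalSupport | ∃ a b : ℝ, X.IsElementary a b ∧ (p.1 = a ∨ p.1 = b)}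

/-- The edges in the global zone, the zone of the ideal trajectory in the concatenated
arrangement. -/
def globalZoneEdges (X : Entities n τ) : Set (Set (ℝ × ℝ)) :=
  zoneEdges X.strip X.globalSupport X.globalVertices

end Entities

end CentralTrajectory

end

/-!
# The zone of the ideal trajectory and the complexity of central trajectories

By the reflections `LineFamily.neg` and `LineFamily.rev` it suffices to look at rising half-lines
above the axis. Rising half-lines never cross after clipping: line `i` is *alive* at a time `t` if
it is on or above the axis there and no rising line that left the axis earlier is below it
(`LineFamily.RiseAlive`); falling half-lines are the mirror image.

*What the zone misses.* If a rising line `i` leaves the axis before a falling line `j` reaches it,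
then everything above both is cut off from the axis. The union of these *wedges* is open, and its
boundary consists of clipped half-lines (`LineFamily.mem_wedge_of_mem_closure`), so a connected set
that meets the axis and avoids the half-lines avoids the wedges
(`LineFamily.notMem_wedge_of_isPreconnected`). Conversely, a point that is above no wedge and on no
half-line sees the axis along a segment (`LineFamily.exists_segment`). Hence the upper part of the
zone consists of the points above no wedge.

*Counting zone edges.* An edge on a rising half-line that is above no wedge is charged according to
its left end: to its own line if it is the first edge there, to the rising half-line that is clipped
there, or to the falling half-line that crosses there. In the last case no second edge charges the
same line, since the part of the first edge just after the crossing would be above a wedge. Summing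
over the four reflections gives `6 n` edges (`LineFamily.encard_clippedZoneEdges_le`).

*Area-minimal trajectoids.* Replacing a trajectoid by its minimum with a path of nonnegative height
along the lines gives a trajectoid, so an area-minimal one is nowhere above such a path which it
does not surpass at the ends (`LineFamily.le_of_isAreaMinimal`). The upper boundary of a wedge is
such a path, so area-minimal trajectoids stay in the zone. The same principle bounds the breaks
above the axis: a turn from line `i` to line `k` is charged to one of the two lines, and a turn from
a rising to a falling line is charged to the event that ends the piece on the falling line. As a
line meets the axis only once, this gives at most `7 n + 2` breaks; together with the bound `n ^ 2`
on the number of crossings, there are at most `8 n` vertices.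

*Central trajectories.* The distance from an entity to the farthest one is its distance to the ideal
trajectory plus half of the extent of all entities, and the latter does not depend on the choice of
the entity. So a central trajectory is area-minimal relative to the ideal trajectory
(`Entities.IdealStraight.isAreaMinimal`).

*The global zone.* The ideal trajectory bends only where a line enters the upper or the lower
envelope, which happens once for each line in each `[t_i, t_{i+1}]`; so there are at most
`τ (n + 1)` elementary intervals. In the concatenation of the arrangements, a face may go around a
wedge through the sides of a slab. But an edge that is above a wedge and bounds such a face cannot
lie both in a sector to the right of a crossing inside the slab and in a sector to the left of one
(`LineFamily.notMem_sectors_of_isPreconnected`), and edges that avoid one of the two kinds of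
sectors can be charged to lines again. This gives at most `20 n` edges in each slab.

*The whole time span.* A trajectoid breaks only where two entities meet, which gives at most
`τ n ^ 2` breaks.
-/

namespace CentralTrajectory

/-! ### Counting along a relation -/

/-- If every element of `X` is charged to some element of `P`, and no element of `P` is charged
twice, then `X` has at most as many elements as `P`. -/
theorem encard_le_of_charge {α β : Type*} {X : Set α} {P : Set β} (R : α → β → Prop)
    (hex : ∀ x ∈ X, ∃ c ∈ P, R x c)
    (hinj : ∀ x ∈ X, ∀ y ∈ X, ∀ c, R x c → R y c → x = y) : X.encard ≤ P.encard := by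
  rcases X.eq_empty_or_nonempty with rfl | ⟨x₀, hx₀⟩
  · simp
  have : Nonempty β := ⟨(hex x₀ hx₀).choose⟩
  choose! f hfP hfR using hex
  have hinj' : InjOn f X := fun x hx y hy h =>
    hinj x hx y hy (f x) (hfR x hx) (h ▸ hfR y hy)
  rw [← hinj'.encard_image]
  exact encard_le_encard (image_subset_iff.2 hfP)

namespace LineFamily

variable {n : ℕ} {L : LineFamily n} {i j k m : Fin n} {s t u v w x y : ℝ}

/-! ### Lines and their crossings with the axis -/

/-- The time at which line `i` crosses the `x`-axis. -/
noncomputable def root (L : LineFamily n) (i : Fin n) : ℝ := -L.offset i / L.slope i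

theorem eval_eq_slope_mul (h : L.slope i ≠ 0) (t : ℝ) :
    L.eval i t = L.slope i * (t - L.root i) := by
  unfold eval root; field_simp; ring

theorem eval_root (h : L.slope i ≠ 0) : L.eval i (L.root i) = 0 := by
  rw [eval_eq_slope_mul h, sub_self, mul_zero]

theorem eval_nonneg_iff_of_rising (h : 0 < L.slope i) : 0 ≤ L.eval i t ↔ L.root i ≤ t := by
  rw [eval_eq_slope_mul h.ne', mul_nonneg_iff_of_pos_left h, sub_nonneg]

theorem eval_pos_iff_of_rising (h : 0 < L.slope i) : 0 < L.eval i t ↔ L.root i < t := by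
  rw [eval_eq_slope_mul h.ne', mul_pos_iff_of_pos_left h, sub_pos]

theorem eval_nonneg_iff_of_falling (h : L.slope i < 0) : 0 ≤ L.eval i t ↔ t ≤ L.root i := by
  rw [eval_eq_slope_mul h.ne]
  constructor <;> intro h' <;> nlinarith

theorem eval_pos_iff_of_falling (h : L.slope i < 0) : 0 < L.eval i t ↔ t < L.root i := by
  rw [eval_eq_slope_mul h.ne]
  constructor <;> intro h' <;> nlinarith

theorem eval_eq_zero_iff (h : L.slope i ≠ 0) : L.eval i t = 0 ↔ t = L.root i := by
  rw [eval_eq_slope_mul h, mul_eq_zero, sub_eq_zero]; simp [h]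

theorem eval_lt_eval_of_rising (h : 0 < L.slope i) (htu : t < u) : L.eval i t < L.eval i u := by
  unfold eval; nlinarith

theorem eval_lt_eval_of_falling (h : L.slope i < 0) (htu : t < u) : L.eval i u < L.eval i t := by
  unfold eval; nlinarith

theorem eval_sub (L : LineFamily n) (i : Fin n) (t u : ℝ) :
    L.eval i t - L.eval i u = L.slope i * (t - u) := by
  unfold eval; ring

@[fun_prop]
theorem continuous_eval (L : LineFamily n) (i : Fin n) : Continuous (L.eval i) := by
  unfold eval; fun_prop

theorem Distinct.eq_of_eval (hd : L.Distinct) (hs : L.slope i = L.slope k)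
    (h : L.eval i t = L.eval k t) : i = k :=
  hd i k hs (by unfold eval at h; rw [hs] at h; linarith)

theorem Distinct.eq_of_eval_eval (hd : L.Distinct) (htu : t ≠ u)
    (ht : L.eval i t = L.eval k t) (hu : L.eval i u = L.eval k u) : i = k := by
  refine hd.eq_of_eval ?_ ht
  have h1 := L.eval_sub i t u
  have h2 := L.eval_sub k t u
  rw [ht, hu, h2] at h1
  exact (mul_right_cancel₀ (sub_ne_zero.2 htu) h1).symm

theorem eval_le_eval_of_mem_Icc (ht : L.eval i t ≤ L.eval k t) (hv : L.eval i v ≤ L.eval k v)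
    (htu : t ≤ u) (huv : u ≤ v) : L.eval i u ≤ L.eval k u := by
  have h1 := L.eval_sub i u t
  have h2 := L.eval_sub k u t
  have h3 := L.eval_sub i v u
  have h4 := L.eval_sub k v u
  by_contra! h
  rcases le_total (L.slope i) (L.slope k) with hs | hs <;> nlinarith

theorem eval_lt_eval_of_slope_lt (h : L.eval i t = L.eval k t) (hs : L.slope i < L.slope k)
    (htu : t < u) : L.eval i u < L.eval k u := by
  have h1 := L.eval_sub i u t
  have h2 := L.eval_sub k u t
  nlinarith

theorem eval_lt_eval_of_slope_gt (h : L.eval i t = L.eval k t) (hs : L.slope k < L.slope i)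
    (hut : u < t) : L.eval i u < L.eval k u := by
  have h1 := L.eval_sub i u t
  have h2 := L.eval_sub k u t
  nlinarith

/-- Of two rising lines through a point above the axis, the less steep one starts earlier. -/
theorem root_le_root_of_slope_le (hi : 0 < L.slope i) (hik : L.slope i ≤ L.slope k)
    (h : L.eval i t = L.eval k t) (h0 : 0 ≤ L.eval i t) : L.root i ≤ L.root k := by
  have hk : 0 < L.slope k := hi.trans_le hik
  have h1 := h0
  rw [eval_nonneg_iff_of_rising hi] at h1
  rw [← eval_nonneg_iff_of_rising hi]
  have h2 := L.eval_sub i t (L.root k)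
  have h3 := L.eval_sub k t (L.root k)
  rw [eval_root hk.ne'] at h3
  have h4 : L.root k ≤ t := by rw [← eval_nonneg_iff_of_rising hk]; linarith
  nlinarith

/-- Before a rising and a falling line meet on or above the axis, the rising one has left the
axis, and the falling one has not yet reached it. -/
theorem root_le_root_of_meet (hi : 0 < L.slope i) (hj : L.slope j < 0)
    (h : L.eval i t = L.eval j t) (h0 : 0 ≤ L.eval i t) : L.root i ≤ L.root j :=
  ((eval_nonneg_iff_of_rising hi).1 h0).trans ((eval_nonneg_iff_of_falling hj).1 (h ▸ h0))

/-! ### Reflections -/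

/-- The reflection of the lines in the `x`-axis. -/
def neg (L : LineFamily n) : LineFamily n where
  slope i := -L.slope i
  offset i := -L.offset i

/-- The reversal of time. -/
def rev (L : LineFamily n) : LineFamily n where
  slope i := -L.slope i
  offset := L.offset

@[simp] theorem slope_neg (L : LineFamily n) (i : Fin n) : L.neg.slope i = -L.slope i := rfl
@[simp] theorem slope_rev (L : LineFamily n) (i : Fin n) : L.rev.slope i = -L.slope i := rfl

@[simp] theorem neg_neg (L : LineFamily n) : L.neg.neg = L := by
  cases L; simp [neg]

@[simp] theorem rev_rev (L : LineFamily n) : L.rev.rev = L := by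
  cases L; simp [rev]

@[simp] theorem eval_neg (L : LineFamily n) (i : Fin n) (t : ℝ) :
    L.neg.eval i t = -L.eval i t := by simp [neg, eval]; ring

@[simp] theorem eval_rev (L : LineFamily n) (i : Fin n) (t : ℝ) :
    L.rev.eval i t = L.eval i (-t) := by simp [rev, eval]

@[simp] theorem root_rev (L : LineFamily n) (i : Fin n) : L.rev.root i = -L.root i := by
  simp [rev, root, div_neg]

theorem Distinct.neg (h : L.Distinct) : L.neg.Distinct := fun i j h1 h2 =>
  h i j (neg_injective h1) (neg_injective h2)

theorem Distinct.rev (h : L.Distinct) : L.rev.Distinct := fun i j h1 h2 =>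
  h i j (neg_injective h1) h2

theorem NoHorizontal.neg (h : L.NoHorizontal) : L.neg.NoHorizontal := fun i =>
  neg_ne_zero.2 (h i)

theorem NoHorizontal.rev (h : L.NoHorizontal) : L.rev.NoHorizontal := fun i =>
  neg_ne_zero.2 (h i)

end LineFamily

/-- The reflection of the plane in the `x`-axis. -/
def flipPos : (ℝ × ℝ) ≃ₜ (ℝ × ℝ) := (Homeomorph.refl ℝ).prodCongr (Homeomorph.neg ℝ)

/-- The reversal of time in the plane. -/
def flipTime : (ℝ × ℝ) ≃ₜ (ℝ × ℝ) := (Homeomorph.neg ℝ).prodCongr (Homeomorph.refl ℝ)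

@[simp] theorem flipPos_apply (p : ℝ × ℝ) : flipPos p = (p.1, -p.2) := rfl
@[simp] theorem flipTime_apply (p : ℝ × ℝ) : flipTime p = (-p.1, p.2) := rfl

theorem image_flipPos (A : Set (ℝ × ℝ)) : flipPos '' A = {p | (p.1, -p.2) ∈ A} := by
  ext p
  constructor
  · rintro ⟨q, hq, rfl⟩; simpa using hq
  · intro hp; exact ⟨_, hp, by simp⟩

theorem image_flipTime (A : Set (ℝ × ℝ)) : flipTime '' A = {p | (-p.1, p.2) ∈ A} := by
  ext p
  constructor
  · rintro ⟨q, hq, rfl⟩; simpa using hq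
  · intro hp; exact ⟨_, hp, by simp⟩

namespace LineFamily

variable {n : ℕ} {L : LineFamily n} {i j k m : Fin n} {s t u v w x y : ℝ}

theorem mem_clipped_neg (L : LineFamily n) (s : Bool) (i : Fin n) (p : ℝ × ℝ) :
    p ∈ L.neg.clipped s i ↔ (p.1, -p.2) ∈ L.clipped (!s) i := by
  have key : ∀ (j : Fin n) (q : ℝ × ℝ), q ∈ L.neg.halfLine s j ↔
      (q.1, -q.2) ∈ L.halfLine (!s) j := by
    intro j q
    simp only [halfLine, mem_ofPred_eq, eval_neg]
    cases s <;> simp [neg_eq_iff_eq_neg]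
  simp only [clipped, mem_ofPred_eq, key, slope_neg, neg_mul_neg, abs_neg, mem_inter_iff,
    Prod.forall]
  refine and_congr_right fun _ => forall_congr' fun j => forall_congr' fun _ =>
    forall_congr' fun _ => forall_congr' fun a => ?_
  constructor
  · intro h b; have := h (-b); rwa [_root_.neg_neg, abs_neg] at this
  · intro h b; have := h (-b); rwa [abs_neg] at this

theorem mem_clipped_rev (L : LineFamily n) (s : Bool) (i : Fin n) (p : ℝ × ℝ) :
    p ∈ L.rev.clipped s i ↔ (-p.1, p.2) ∈ L.clipped s i := by
  have key : ∀ (j : Fin n) (q : ℝ × ℝ), q ∈ L.rev.halfLine s j ↔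
      (-q.1, q.2) ∈ L.halfLine s j := by
    intro j q
    simp only [halfLine, mem_ofPred_eq, eval_rev]
  simp only [clipped, mem_ofPred_eq, key, slope_rev, neg_mul_neg, abs_neg, mem_inter_iff,
    Prod.forall]
  refine and_congr_right fun _ => forall_congr' fun j => forall_congr' fun _ =>
    forall_congr' fun _ => ?_
  constructor
  · intro h a b; have := h (-a) b; rwa [_root_.neg_neg] at this
  · intro h a b; exact h (-a) b

theorem support_neg (L : LineFamily n) : L.neg.support = flipPos '' L.support := by
  rw [image_flipPos]
  ext p
  simp only [support, mem_iUnion, mem_clipped_neg, mem_ofPred_eq]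
  constructor
  · rintro ⟨s, i, h⟩; exact ⟨!s, i, h⟩
  · rintro ⟨s, i, h⟩; exact ⟨!s, i, by simpa using h⟩

theorem support_rev (L : LineFamily n) : L.rev.support = flipTime '' L.support := by
  rw [image_flipTime]
  ext p
  simp only [support, mem_iUnion, mem_clipped_rev, mem_ofPred_eq]

theorem vertices_neg (L : LineFamily n) : L.neg.vertices = flipPos '' L.vertices := by
  rw [image_flipPos]
  ext p
  simp only [vertices, mem_clipped_neg, mem_ofPred_eq]
  constructor
  · rintro ⟨⟨a, i⟩, ⟨b, j⟩, hne, h⟩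
    exact ⟨(!a, i), (!b, j), by simpa using hne, h⟩
  · rintro ⟨⟨a, i⟩, ⟨b, j⟩, hne, h⟩
    exact ⟨(!a, i), (!b, j), by simpa using hne, by simpa using h⟩

theorem vertices_rev (L : LineFamily n) : L.rev.vertices = flipTime '' L.vertices := by
  rw [image_flipTime]
  ext p
  simp only [vertices, mem_clipped_rev, mem_ofPred_eq]

/-! ### Clipped half-lines above the axis -/

/-- Line `i` rises, at time `t` it is on or above the axis, and its upper half-line has not been
clipped before `t`: no rising line that left the axis earlier is below it. -/
def RiseAlive (L : LineFamily n) (i : Fin n) (t : ℝ) : Prop :=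
  0 < L.slope i ∧ 0 ≤ L.eval i t ∧
    ∀ k, 0 < L.slope k → L.root k ≤ L.root i → L.eval i t ≤ L.eval k t

/-- The mirror image of `RiseAlive` for falling lines, whose upper half-lines start at the axis
and run back in time. -/
def FallAlive (L : LineFamily n) (j : Fin n) (t : ℝ) : Prop :=
  L.slope j < 0 ∧ 0 ≤ L.eval j t ∧
    ∀ m, L.slope m < 0 → L.root j ≤ L.root m → L.eval j t ≤ L.eval m t

theorem riseAlive_rev : L.rev.RiseAlive i t ↔ L.FallAlive i (-t) := by
  simp [RiseAlive, FallAlive]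

theorem fallAlive_rev : L.rev.FallAlive i t ↔ L.RiseAlive i (-t) := by
  simp [RiseAlive, FallAlive]

theorem mem_clipped_true_of_rising (hi : 0 < L.slope i) {p : ℝ × ℝ} :
    p ∈ L.clipped true i ↔ p.2 = L.eval i p.1 ∧ L.RiseAlive i p.1 := by
  simp only [clipped, halfLine, mem_ofPred_eq, if_true, RiseAlive, hi, true_and, mem_inter_iff,
    mul_pos_iff_of_pos_left]
  constructor
  · rintro ⟨⟨h1, h2⟩, h3⟩
    refine ⟨h1, h1 ▸ h2, fun k hk hki => ?_⟩
    rw [h1] at h2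
    have hri := (eval_nonneg_iff_of_rising hi).1 h2
    have hk0 : L.eval i (L.root i) ≤ L.eval k (L.root i) := by
      rw [eval_root hi.ne']; exact (eval_nonneg_iff_of_rising hk).2 hki
    rcases le_or_gt (L.slope i) (L.slope k) with hs | hs
    · have e1 := L.eval_sub i p.1 (L.root i)
      have e2 := L.eval_sub k p.1 (L.root i)
      nlinarith
    · -- the crossing point of the two lines, where line `i` is clipped
      obtain ⟨v, hv⟩ : ∃ v, L.eval i v = L.eval k v :=
        ⟨(L.offset k - L.offset i) / (L.slope i - L.slope k), by
          have : L.slope i - L.slope k ≠ 0 := by linarith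
          unfold eval; field_simp; ring⟩
      have hrv : L.root i ≤ v := by
        by_contra! hlt
        exact absurd (eval_lt_eval_of_slope_lt hv.symm hs hlt) (not_lt.2 hk0)
      have hv0 : 0 ≤ L.eval i v := (eval_nonneg_iff_of_rising hi).2 hrv
      have := h3 k hk (by rw [abs_of_pos hk, abs_of_pos hi]; exact hs) (v, L.eval i v)
        ⟨⟨rfl, hv0⟩, hv, hv0⟩
      rw [h1, abs_of_nonneg h2, abs_of_nonneg hv0] at this
      have hpv : p.1 ≤ v := by
        by_contra! hlt
        exact absurd (eval_lt_eval_of_rising hi hlt) (not_lt.2 this)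
      exact eval_le_eval_of_mem_Icc hk0 hv.le hri hpv
  · rintro ⟨h1, h2, h3⟩
    refine ⟨⟨h1, h1 ▸ h2⟩, fun k hk hs v hv => ?_⟩
    obtain ⟨⟨hvi, hv0⟩, hvk, -⟩ := hv
    rw [abs_of_pos hk, abs_of_pos hi] at hs
    rw [h1, abs_of_nonneg h2, abs_of_nonneg hv0, hvi]
    have hik : L.eval k v.1 = L.eval i v.1 := by rw [← hvi, ← hvk]
    have := h3 k hk (root_le_root_of_slope_le hk hs.le hik (by rw [← hvk]; exact hv0))
    by_contra! hlt
    have hlt' : v.1 < p.1 := by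
      by_contra! hle
      rcases hle.lt_or_eq with h | h
      · exact absurd (eval_lt_eval_of_rising hi h) (not_lt.2 hlt.le)
      · rw [h] at hlt; exact lt_irrefl _ hlt
    exact absurd (eval_lt_eval_of_slope_lt hik hs hlt') (not_lt.2 this)

theorem mem_clipped_true_of_falling (hi : L.slope i < 0) {p : ℝ × ℝ} :
    p ∈ L.clipped true i ↔ p.2 = L.eval i p.1 ∧ L.FallAlive i p.1 := by
  have := mem_clipped_rev L.rev true i p
  rw [rev_rev] at this
  rw [this, mem_clipped_true_of_rising (by simpa using hi), riseAlive_rev]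
  simp

theorem mem_halfLine_of_mem_clipped {s : Bool} {p : ℝ × ℝ} (h : p ∈ L.clipped s i) :
    p.2 = L.eval i p.1 ∧ if s then 0 ≤ p.2 else p.2 ≤ 0 := h.1

theorem eq_true_of_mem_clipped {s : Bool} {p : ℝ × ℝ} (h : p ∈ L.clipped s i) (h0 : 0 < p.2) :
    s = true := by
  have := (mem_halfLine_of_mem_clipped h).2
  cases s
  · simp at this; linarith
  · rfl

theorem RiseAlive.mem_clipped (h : L.RiseAlive i t) : (t, L.eval i t) ∈ L.clipped true i :=
  (mem_clipped_true_of_rising h.1).2 ⟨rfl, h⟩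

theorem FallAlive.mem_clipped (h : L.FallAlive i t) : (t, L.eval i t) ∈ L.clipped true i :=
  (mem_clipped_true_of_falling h.1).2 ⟨rfl, h⟩

theorem mem_support_of_mem_clipped {s : Bool} {p : ℝ × ℝ} (h : p ∈ L.clipped s i) :
    p ∈ L.support := mem_iUnion₂.2 ⟨s, i, h⟩

theorem RiseAlive.mem_support (h : L.RiseAlive i t) : (t, L.eval i t) ∈ L.support :=
  mem_support_of_mem_clipped h.mem_clipped

theorem FallAlive.mem_support (h : L.FallAlive i t) : (t, L.eval i t) ∈ L.support :=
  mem_support_of_mem_clipped h.mem_clipped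

theorem mem_support_of_pos (hn : L.NoHorizontal) {p : ℝ × ℝ} (hp : p ∈ L.support) (h0 : 0 < p.2) :
    ∃ i, p.2 = L.eval i p.1 ∧ (L.RiseAlive i p.1 ∨ L.FallAlive i p.1) := by
  obtain ⟨s, i, h⟩ := mem_iUnion₂.1 hp
  obtain rfl := eq_true_of_mem_clipped h h0
  rcases (hn i).lt_or_gt with hi | hi
  · rw [mem_clipped_true_of_falling hi] at h; exact ⟨i, h.1, .inr h.2⟩
  · rw [mem_clipped_true_of_rising hi] at h; exact ⟨i, h.1, .inl h.2⟩

theorem isClosed_clipped (L : LineFamily n) (s : Bool) (i : Fin n) :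
    IsClosed (L.clipped s i) := by
  have h1 : IsClosed (L.halfLine s i) := by
    refine IsClosed.and (isClosed_eq (by fun_prop) ((L.continuous_eval i).comp continuous_fst)) ?_
    cases s
    · simpa using isClosed_le continuous_snd continuous_const
    · simpa using isClosed_le continuous_const continuous_snd
  refine IsClosed.and h1 ?_
  simp only [ofPred_forall]
  exact isClosed_iInter fun j => isClosed_iInter fun _ => isClosed_iInter fun _ =>
    isClosed_iInter fun v => isClosed_iInter fun _ => isClosed_le (by fun_prop) (by fun_prop)

theorem RiseAlive.of_le (h : L.RiseAlive i t) (hu : L.root i ≤ u) (hut : u ≤ t) :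
    L.RiseAlive i u := by
  refine ⟨h.1, (eval_nonneg_iff_of_rising h.1).2 hu, fun k hk hki => ?_⟩
  refine eval_le_eval_of_mem_Icc (t := L.root i) ?_ (h.2.2 k hk hki) hu hut
  rw [eval_root h.1.ne']; exact (eval_nonneg_iff_of_rising hk).2 hki

theorem FallAlive.of_ge (h : L.FallAlive i t) (hu : u ≤ L.root i) (hut : t ≤ u) :
    L.FallAlive i u := by
  have h' : L.rev.RiseAlive i (-t) := by rw [riseAlive_rev]; simpa using h
  have := h'.of_le (u := -u) (by simpa using hu) (by simpa using hut)
  rw [riseAlive_rev] at this; simpa using this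

/-- A rising half-line that meets a rising line which left the axis no later passes through a
point of another clipped half-line there; so the place where a half-line is clipped is a vertex. -/
theorem RiseAlive.exists_other (hd : L.Distinct) (h : L.RiseAlive i t) (h0 : 0 < L.eval i t)
    (hk : 0 < L.slope k) (hki : L.root k ≤ L.root i) (hkt : L.eval k t = L.eval i t)
    (hne : k ≠ i) : ∃ k', k' ≠ i ∧ L.RiseAlive k' t ∧ L.eval k' t = L.eval i t := by
  classical
  -- the least steep rising line through the point is never clipped before it
  obtain ⟨k', hk', hmin⟩ := (Finset.univ.filter fun m => 0 < L.slope m ∧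
    L.eval m t = L.eval i t).exists_min_image L.slope ⟨i, by simp [h.1]⟩
  simp only [Finset.mem_filter, Finset.mem_univ, true_and] at hk' hmin
  have hrk : L.root k' ≤ L.root i := root_le_root_of_slope_le hk'.1 (hmin i ⟨h.1, rfl⟩) hk'.2
    (hk'.2 ▸ h0.le)
  refine ⟨k', ?_, ⟨hk'.1, hk'.2 ▸ h0.le, fun m hm hmk => ?_⟩, hk'.2⟩
  · rintro rfl
    have hs := hmin k ⟨hk, hkt⟩
    have hr := root_le_root_of_slope_le h.1 hs hkt.symm h0.le
    have hr' : L.root k = L.root k' := le_antisymm hki hr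
    have hrt : L.root k' < t := (eval_pos_iff_of_rising h.1).1 h0
    exact hne (hd.eq_of_eval_eval hrt.ne (by
      rw [eval_root h.1.ne', ← hr', eval_root hk.ne']) hkt)
  · rw [hk'.2]; exact h.2.2 m hm (hmk.trans hrk)

theorem mem_vertices_of_pos (hn : L.NoHorizontal) {p : ℝ × ℝ} (hi : p ∈ L.clipped true i)
    (h0 : 0 < p.2) : p ∈ L.vertices ↔
      ∃ k, k ≠ i ∧ p.2 = L.eval k p.1 ∧ (L.RiseAlive k p.1 ∨ L.FallAlive k p.1) := by
  constructor
  · rintro ⟨⟨a, k⟩, ⟨b, l⟩, hne, hk, hl⟩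
    obtain rfl : a = true := eq_true_of_mem_clipped hk h0
    obtain rfl : b = true := eq_true_of_mem_clipped hl h0
    have : ∃ m, m ≠ i ∧ p ∈ L.clipped true m := by
      by_cases hki : k = i
      · exact ⟨l, fun hli => hne (by simp [hki, hli]), hl⟩
      · exact ⟨k, hki, hk⟩
    obtain ⟨m, hm, hpm⟩ := this
    rcases (hn m).lt_or_gt with h | h
    · rw [mem_clipped_true_of_falling h] at hpm; exact ⟨m, hm, hpm.1, .inr hpm.2⟩
    · rw [mem_clipped_true_of_rising h] at hpm; exact ⟨m, hm, hpm.1, .inl hpm.2⟩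
  · rintro ⟨k, hk, h1, h2⟩
    refine ⟨(true, i), (true, k), by simpa using hk.symm, hi, ?_⟩
    rcases h2 with h | h
    · exact (mem_clipped_true_of_rising h.1).2 ⟨h1, h⟩
    · exact (mem_clipped_true_of_falling h.1).2 ⟨h1, h⟩

theorem ne_zero_of_notMem_vertices {p : ℝ × ℝ} (hp : p ∈ L.support) (hv : p ∉ L.vertices) :
    p.2 ≠ 0 := by
  intro h0
  obtain ⟨s, i, hm⟩ := mem_iUnion₂.1 hp
  apply hv
  -- a point of the axis lies on both half-lines of its line
  refine ⟨(true, i), (false, i), by simp, ?_, ?_⟩ <;>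
  · have hl := mem_halfLine_of_mem_clipped hm
    refine ⟨⟨hl.1, by simp [h0]⟩, fun j _ _ v _ => ?_⟩
    rw [h0, abs_zero]; exact abs_nonneg _

/-- At a point of a clipped half-line that is not a vertex, all lines that could clip it are
strictly above. -/
theorem RiseAlive.lt_of_notMem_vertices (hd : L.Distinct) (hn : L.NoHorizontal)
    (h : L.RiseAlive i t) (h0 : 0 < L.eval i t) (hv : (t, L.eval i t) ∉ L.vertices)
    (hk : 0 < L.slope k) (hki : L.root k ≤ L.root i) (hne : k ≠ i) :
    L.eval i t < L.eval k t := by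
  refine (h.2.2 k hk hki).lt_of_ne fun he => hv ?_
  obtain ⟨k', h1, h2, h3⟩ := h.exists_other hd h0 hk hki he.symm hne
  exact (mem_vertices_of_pos hn h.mem_clipped h0).2 ⟨k', h1, h3.symm, .inl h2⟩

theorem finite_vertices (hd : L.Distinct) (hn : L.NoHorizontal) : L.vertices.Finite := by
  classical
  -- two half-lines of one line share the point on the axis, two lines have one common point
  refine (Set.finite_range fun q : Fin n × Fin n => if q.1 = q.2 then (L.root q.1, (0 : ℝ)) else
    (-(L.offset q.1 - L.offset q.2) / (L.slope q.1 - L.slope q.2),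
      L.eval q.1 (-(L.offset q.1 - L.offset q.2) / (L.slope q.1 - L.slope q.2)))).subset ?_
  rintro ⟨t, y⟩ ⟨⟨a, i⟩, ⟨b, k⟩, hne, hi, hk⟩
  have h1 := mem_halfLine_of_mem_clipped hi
  have h2 := mem_halfLine_of_mem_clipped hk
  simp only at h1 h2
  refine ⟨(i, k), ?_⟩
  by_cases hik : i = k
  · subst hik
    have hy : y = 0 := by
      have hab : a ≠ b := fun h => hne (by rw [h])
      cases a <;> cases b <;> simp at h1 h2 hab <;> linarith
    have : t = L.root i := (eval_eq_zero_iff (hn i)).1 (by rw [← h1.1, hy])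
    simp [hy, this]
  · have hs : L.slope i - L.slope k ≠ 0 := fun h =>
      hik (hd.eq_of_eval (sub_eq_zero.1 h) (t := t) (by rw [← h1.1, ← h2.1]))
    have ht : -(L.offset i - L.offset k) / (L.slope i - L.slope k) = t := by
      rw [div_eq_iff hs]
      have := h1.1.symm.trans h2.1
      unfold eval at this; linarith
    simp only [if_neg hik, ht, ← h1.1]

end LineFamily

end CentralTrajectory

namespace CentralTrajectory

namespace LineFamily

variable {n : ℕ} {L : LineFamily n} {i j k m : Fin n} {s t u v w x y : ℝ}

/-! ### Regions enclosed by clipped half-lines -/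

/-- The points above some wedge `max (i, j)`, where line `i` rises, line `j` falls, and `i` leaves
the axis before `j` reaches it. These points are cut off from the axis. -/
def wedge (L : LineFamily n) : Set (ℝ × ℝ) :=
  {p | ∃ i j, 0 < L.slope i ∧ L.slope j < 0 ∧ L.root i ≤ L.root j ∧
    L.eval i p.1 < p.2 ∧ L.eval j p.1 < p.2}

/-- The region to the right of a crossing at time `u` of a rising half-line `i` and a falling
half-line `j`, between `j` and the chain that starts along `i` and, where a half-line of the chain
is clipped, goes on along the one that clips it. -/
def rightSector (L : LineFamily n) (i j : Fin n) (u : ℝ) : Set (ℝ × ℝ) :=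
  {p | u < p.1 ∧ L.eval j p.1 < p.2 ∧
    ∀ k, 0 < L.slope k → L.root k ≤ L.root i → p.2 < L.eval k p.1}

/-- The mirror image of `rightSector`. -/
def leftSector (L : LineFamily n) (i j : Fin n) (u : ℝ) : Set (ℝ × ℝ) :=
  {p | p.1 < u ∧ L.eval i p.1 < p.2 ∧
    ∀ m, L.slope m < 0 → L.root j ≤ L.root m → p.2 < L.eval m p.1}

theorem isOpen_below (L : LineFamily n) (k : Fin n) : IsOpen {p : ℝ × ℝ | p.2 < L.eval k p.1} :=
  isOpen_lt continuous_snd ((L.continuous_eval k).comp continuous_fst)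

theorem isOpen_above (L : LineFamily n) (k : Fin n) : IsOpen {p : ℝ × ℝ | L.eval k p.1 < p.2} :=
  isOpen_lt ((L.continuous_eval k).comp continuous_fst) continuous_snd

theorem isClosed_below (L : LineFamily n) (k : Fin n) :
    IsClosed {p : ℝ × ℝ | p.2 ≤ L.eval k p.1} :=
  isClosed_le continuous_snd ((L.continuous_eval k).comp continuous_fst)

theorem isClosed_above (L : LineFamily n) (k : Fin n) :
    IsClosed {p : ℝ × ℝ | L.eval k p.1 ≤ p.2} :=
  isClosed_le ((L.continuous_eval k).comp continuous_fst) continuous_snd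

theorem wedge_eq_iUnion (L : LineFamily n) : L.wedge = ⋃ q : {q : Fin n × Fin n //
    0 < L.slope q.1 ∧ L.slope q.2 < 0 ∧ L.root q.1 ≤ L.root q.2},
    {p : ℝ × ℝ | L.eval q.1.1 p.1 < p.2} ∩ {p | L.eval q.1.2 p.1 < p.2} := by
  ext p
  simp only [wedge, mem_ofPred_eq, mem_iUnion, mem_inter_iff]
  constructor
  · rintro ⟨i, j, h1, h2, h3, h4⟩; exact ⟨⟨(i, j), h1, h2, h3⟩, h4⟩
  · rintro ⟨⟨q, h1, h2, h3⟩, h4⟩; exact ⟨q.1, q.2, h1, h2, h3, h4⟩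

theorem isOpen_wedge (L : LineFamily n) : IsOpen L.wedge := by
  rw [wedge_eq_iUnion]
  exact isOpen_iUnion fun q => (L.isOpen_above _).inter (L.isOpen_above _)

theorem isOpen_rightSector (L : LineFamily n) (i j : Fin n) (u : ℝ) :
    IsOpen (L.rightSector i j u) := by
  have h : IsOpen {p : ℝ × ℝ | ∀ k, 0 < L.slope k → L.root k ≤ L.root i → p.2 < L.eval k p.1} := by
    simp only [ofPred_forall]
    exact isOpen_iInter_of_finite fun k => isOpen_iInter_of_finite fun _ =>
      isOpen_iInter_of_finite fun _ => L.isOpen_below k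
  exact (isOpen_lt continuous_const continuous_fst).inter ((L.isOpen_above j).inter h)

theorem wedge_rev (L : LineFamily n) : L.rev.wedge = flipTime '' L.wedge := by
  rw [image_flipTime]
  ext p
  simp only [wedge, mem_ofPred_eq, slope_rev, eval_rev, root_rev, Left.neg_pos_iff,
    Left.neg_neg_iff, neg_le_neg_iff]
  constructor
  · rintro ⟨i, j, h1, h2, h3, h4, h5⟩; exact ⟨j, i, h2, h1, h3, h5, h4⟩
  · rintro ⟨i, j, h1, h2, h3, h4, h5⟩; exact ⟨j, i, h2, h1, h3, h5, h4⟩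

theorem leftSector_rev (L : LineFamily n) (i j : Fin n) (u : ℝ) :
    L.rev.leftSector i j u = flipTime '' L.rightSector j i (-u) := by
  rw [image_flipTime]
  ext p
  simp only [leftSector, rightSector, mem_ofPred_eq, slope_rev, eval_rev, root_rev,
    Left.neg_neg_iff, neg_le_neg_iff, neg_lt_neg_iff]

theorem leftSector_eq (L : LineFamily n) (i j : Fin n) (u : ℝ) :
    L.leftSector i j u = flipTime '' L.rev.rightSector j i (-u) := by
  rw [← leftSector_rev, rev_rev]

theorem isOpen_leftSector (L : LineFamily n) (i j : Fin n) (u : ℝ) :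
    IsOpen (L.leftSector i j u) := by
  rw [leftSector_eq]
  exact flipTime.isOpenMap _ (isOpen_rightSector _ _ _ _)

theorem pos_of_mem_wedge {p : ℝ × ℝ} (h : p ∈ L.wedge) : 0 < p.2 := by
  obtain ⟨i, j, hi, hj, hij, h1, h2⟩ := h
  by_contra! h0
  have h3 : p.1 < L.root i := by
    by_contra! h; exact absurd ((eval_nonneg_iff_of_rising hi).2 h) (by linarith)
  have h4 : L.root j < p.1 := by
    by_contra! h; exact absurd ((eval_nonneg_iff_of_falling hj).2 h) (by linarith)
  linarith

/-- The boundary of the union of the wedges consists of clipped half-lines. -/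
theorem mem_wedge_of_mem_closure {p : ℝ × ℝ} (h : p ∈ closure L.wedge) (hp : p ∉ L.support) :
    p ∈ L.wedge := by
  rw [wedge_eq_iUnion, closure_iUnion_of_finite, mem_iUnion] at h
  obtain ⟨⟨⟨i, j⟩, hi, hj, hij⟩, h⟩ := h
  have hi' : L.eval i p.1 ≤ p.2 := closure_minimal
    (fun q hq => (show L.eval i q.1 ≤ q.2 from hq.1.le)) (L.isClosed_above i) h
  have hj' : L.eval j p.1 ≤ p.2 := closure_minimal
    (fun q hq => (show L.eval j q.1 ≤ q.2 from hq.2.le)) (L.isClosed_above j) h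
  simp only at hi hj hij
  have hR : L.eval i p.1 = p.2 → 0 ≤ p.2 → ∃ k, 0 < L.slope k ∧ L.root k ≤ L.root i ∧
      L.eval k p.1 < p.2 := by
    intro he h0
    by_contra! hcon
    exact hp (by
      have : L.RiseAlive i p.1 := ⟨hi, he ▸ h0, fun k hk hki => he ▸ hcon k hk hki⟩
      simpa [he] using this.mem_support)
  have hF : L.eval j p.1 = p.2 → 0 ≤ p.2 → ∃ k, L.slope k < 0 ∧ L.root j ≤ L.root k ∧
      L.eval k p.1 < p.2 := by
    intro he h0
    by_contra! hcon
    exact hp (by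
      have : L.FallAlive j p.1 := ⟨hj, he ▸ h0, fun k hk hki => he ▸ hcon k hk hki⟩
      simpa [he] using this.mem_support)
  have h0 : 0 ≤ p.2 := by
    rcases le_total (L.root i) p.1 with h | h
    · exact ((eval_nonneg_iff_of_rising hi).2 h).trans hi'
    · exact ((eval_nonneg_iff_of_falling hj).2 (h.trans hij)).trans hj'
  rcases hi'.lt_or_eq with hi1 | hi1
  · rcases hj'.lt_or_eq with hj1 | hj1
    · exact ⟨i, j, hi, hj, hij, hi1, hj1⟩
    · obtain ⟨k, h1, h2, h3⟩ := hF hj1 h0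
      exact ⟨i, k, hi, h1, hij.trans h2, hi1, h3⟩
  · obtain ⟨k, h1, h2, h3⟩ := hR hi1 h0
    rcases hj'.lt_or_eq with hj1 | hj1
    · exact ⟨k, j, h1, hj, h2.trans hij, h3, hj1⟩
    · obtain ⟨l, h4, h5, h6⟩ := hF hj1 h0
      exact ⟨k, l, h1, h4, (h2.trans hij).trans h5, h3, h6⟩

theorem le_of_mem_closure_rightSector {p : ℝ × ℝ} (h : p ∈ closure (L.rightSector i j u)) :
    u ≤ p.1 ∧ L.eval j p.1 ≤ p.2 ∧
      ∀ k, 0 < L.slope k → L.root k ≤ L.root i → p.2 ≤ L.eval k p.1 := by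
  refine ⟨?_, ?_, fun k hk hki => ?_⟩
  · exact closure_minimal (fun q hq => (show u ≤ q.1 from hq.1.le))
      (isClosed_le continuous_const continuous_fst) h
  · exact closure_minimal (fun q hq => (show L.eval j q.1 ≤ q.2 from hq.2.1.le))
      (L.isClosed_above j) h
  · exact closure_minimal (fun q hq => (show q.2 ≤ L.eval k q.1 from (hq.2.2 k hk hki).le))
      (L.isClosed_below k) h

/-- The boundary of a right sector consists of clipped half-lines. -/
theorem mem_rightSector_of_mem_closure (hi : L.RiseAlive i u) (hj : L.FallAlive j u)
    (hij : L.eval i u = L.eval j u) {p : ℝ × ℝ} (h0 : 0 ≤ p.2)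
    (h : p ∈ closure (L.rightSector i j u)) (hp : p ∉ L.support) : p ∈ L.rightSector i j u := by
  obtain ⟨h1, h2, h3⟩ := le_of_mem_closure_rightSector h
  have hj' : L.eval j p.1 < p.2 := by
    refine h2.lt_of_ne fun he => hp ?_
    have : L.FallAlive j p.1 := hj.of_ge ((eval_nonneg_iff_of_falling hj.1).1 (he ▸ h0)) h1
    simpa [he] using this.mem_support
  have hk' : ∀ k, 0 < L.slope k → L.root k ≤ L.root i → p.2 < L.eval k p.1 := by
    intro k hk hki
    refine (h3 k hk hki).lt_of_ne fun he => hp ?_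
    have : L.RiseAlive k p.1 :=
      ⟨hk, he ▸ h0, fun l hl hlk => he ▸ h3 l hl (hlk.trans hki)⟩
    simpa [← he] using this.mem_support
  refine ⟨h1.lt_of_ne ?_, hj', hk'⟩
  rintro rfl
  have := hk' i hi.1 le_rfl
  linarith

theorem le_of_mem_closure_leftSector {p : ℝ × ℝ} (h : p ∈ closure (L.leftSector i j u)) :
    p.1 ≤ u :=
  closure_minimal (fun q hq => (show q.1 ≤ u from hq.1.le))
      (isClosed_le continuous_fst continuous_const) h

theorem mem_leftSector_of_mem_closure (hi : L.RiseAlive i u) (hj : L.FallAlive j u)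
    (hij : L.eval i u = L.eval j u) {p : ℝ × ℝ} (h0 : 0 ≤ p.2)
    (h : p ∈ closure (L.leftSector i j u)) (hp : p ∉ L.support) : p ∈ L.leftSector i j u := by
  rw [leftSector_eq, ← flipTime.image_closure] at h
  obtain ⟨q, hq, rfl⟩ := h
  rw [leftSector_eq]
  refine mem_image_of_mem _ (mem_rightSector_of_mem_closure ?_ ?_ ?_ h0 hq ?_)
  · rw [riseAlive_rev]; simpa using hj
  · rw [fallAlive_rev]; simpa using hi
  · simpa using hij.symm
  · rw [support_rev]
    rintro ⟨r, hr, hrq⟩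
    apply hp
    rw [← hrq]; simpa using hr

/-- A connected set that meets the axis and avoids the clipped half-lines cannot enter a wedge. -/
theorem notMem_wedge_of_isPreconnected {F : Set (ℝ × ℝ)} (hF : IsPreconnected F)
    (hFS : Disjoint F L.support) (hax : (F ∩ xAxis).Nonempty) {p : ℝ × ℝ} (hp : p ∈ closure F) :
    p ∉ L.wedge := by
  intro hw
  obtain ⟨q, hq, hq'⟩ := mem_closure_iff.1 hp _ L.isOpen_wedge hw
  have hsub : F ⊆ L.wedge := hF.subset_of_closure_inter_subset L.isOpen_wedge ⟨q, hq', hq⟩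
    fun z hz => mem_wedge_of_mem_closure hz.1 (disjoint_left.1 hFS hz.2)
  obtain ⟨z, hz, hz0⟩ := hax
  have := pos_of_mem_wedge (hsub hz)
  exact this.ne' hz0

/-- A connected set that avoids the clipped half-lines inside the slab over `[a, b]` can leave the
part of a wedge inside a right and a left sector neither through the axis nor through the sides
of the slab. -/
theorem notMem_sectors_of_isPreconnected {F : Set (ℝ × ℝ)} {a b : ℝ} (hF : IsPreconnected F)
    (hFS : ∀ p ∈ F, p.1 ∈ Icc a b → p ∉ L.support) (hax : (F ∩ xAxis).Nonempty) {p : ℝ × ℝ}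
    (hp : p ∈ closure F) (hw : p ∈ L.wedge)
    {i j : Fin n} {u : ℝ} (hu : a < u) (hi : L.RiseAlive i u) (hj : L.FallAlive j u)
    (hij : L.eval i u = L.eval j u) (hpr : p ∈ L.rightSector i j u)
    {k m : Fin n} {v : ℝ} (hv : v < b) (hk : L.RiseAlive k v) (hm : L.FallAlive m v)
    (hkm : L.eval k v = L.eval m v) : p ∉ L.leftSector k m v := by
  intro hpl
  set R := L.wedge ∩ (L.rightSector i j u ∩ L.leftSector k m v) with hR
  have hRo : IsOpen R :=
    L.isOpen_wedge.inter ((L.isOpen_rightSector i j u).inter (L.isOpen_leftSector k m v))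
  obtain ⟨q, hq, hq'⟩ := mem_closure_iff.1 hp _ hRo ⟨hw, hpr, hpl⟩
  have hsub : F ⊆ R := by
    refine hF.subset_of_closure_inter_subset hRo ⟨q, hq', hq⟩ fun z hz => ?_
    have h1 : z ∈ closure L.wedge := closure_mono inter_subset_left hz.1
    have h2 : z ∈ closure (L.rightSector i j u) :=
      closure_mono (inter_subset_right.trans inter_subset_left) hz.1
    have h3 : z ∈ closure (L.leftSector k m v) :=
      closure_mono (inter_subset_right.trans inter_subset_right) hz.1
    have hzS := hFS z hz.2 ⟨hu.le.trans (le_of_mem_closure_rightSector h2).1,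
      (le_of_mem_closure_leftSector h3).trans hv.le⟩
    have h1' := mem_wedge_of_mem_closure h1 hzS
    have h0 := (pos_of_mem_wedge h1').le
    exact ⟨h1', mem_rightSector_of_mem_closure hi hj hij h0 h2 hzS,
      mem_leftSector_of_mem_closure hk hm hkm h0 h3 hzS⟩
  obtain ⟨z, hz, hz0⟩ := hax
  have := pos_of_mem_wedge (hsub hz).1
  exact this.ne' hz0

/-! ### Local structure away from the vertices -/

theorem RiseAlive.eventually_mem_support_iff (hd : L.Distinct) (hn : L.NoHorizontal)
    (h : L.RiseAlive i t) (h0 : 0 < L.eval i t) (hv : (t, L.eval i t) ∉ L.vertices) :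
    ∀ᶠ q in 𝓝 (t, L.eval i t), q ∈ L.support ↔ q.2 = L.eval i q.1 := by
  have e0 : ∀ᶠ q : ℝ × ℝ in 𝓝 (t, L.eval i t), 0 < q.2 :=
    (isOpen_lt continuous_const continuous_snd).mem_nhds h0
  have e1 : ∀ᶠ q : ℝ × ℝ in 𝓝 (t, L.eval i t), ∀ k, k ≠ i → q ∉ L.clipped true k := by
    rw [eventually_all]
    intro k
    by_cases hk : k = i
    · simp [hk]
    · have : (t, L.eval i t) ∉ L.clipped true k := fun hm =>
        hv ⟨(true, k), (true, i), by simpa using hk, hm, h.mem_clipped⟩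
      filter_upwards [(L.isClosed_clipped true k).isOpen_compl.mem_nhds this] with q hq _
      exact hq
  have e2 : ∀ᶠ q : ℝ × ℝ in 𝓝 (t, L.eval i t), ∀ k, 0 < L.slope k → L.root k ≤ L.root i →
      k ≠ i → L.eval i q.1 < L.eval k q.1 := by
    rw [eventually_all]
    intro k
    by_cases hk : 0 < L.slope k ∧ L.root k ≤ L.root i ∧ k ≠ i
    · have := h.lt_of_notMem_vertices hd hn h0 hv hk.1 hk.2.1 hk.2.2
      filter_upwards [(isOpen_lt ((L.continuous_eval i).comp continuous_fst)
        ((L.continuous_eval k).comp continuous_fst)).mem_nhds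
          (show (t, L.eval i t) ∈ {q : ℝ × ℝ | L.eval i q.1 < L.eval k q.1} from this)]
        with q hq _ _ _ using hq
    · exact Eventually.of_forall fun q h1 h2 h3 => (hk ⟨h1, h2, h3⟩).elim
  filter_upwards [e0, e1, e2] with q hq0 hq1 hq2
  constructor
  · intro hq
    obtain ⟨s, k, hk⟩ := mem_iUnion₂.1 hq
    obtain rfl := eq_true_of_mem_clipped hk hq0
    by_cases hki : k = i
    · subst hki; exact (mem_halfLine_of_mem_clipped hk).1
    · exact (hq1 k hki hk).elim
  · intro hq
    have : L.RiseAlive i q.1 := ⟨h.1, hq ▸ hq0.le, fun k hk hki => by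
      by_cases hne : k = i
      · rw [hne]
      · exact (hq2 k hk hki hne).le⟩
    simpa [← hq] using this.mem_support

/-- Close to a point of the support that is not a vertex, the support is a line. -/
theorem exists_eventually_mem_support_iff (hd : L.Distinct) (hn : L.NoHorizontal) {p : ℝ × ℝ}
    (hp : p ∈ L.support) (hv : p ∉ L.vertices) :
    ∃ i, ∀ᶠ q in 𝓝 p, q ∈ L.support ↔ q.2 = L.eval i q.1 := by
  have rise : ∀ {L : LineFamily n}, L.Distinct → L.NoHorizontal → ∀ {p : ℝ × ℝ},
      p ∉ L.vertices → ∀ {i : Fin n}, 0 < L.slope i → p ∈ L.clipped true i → 0 < p.2 →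
      ∀ᶠ q in 𝓝 p, q ∈ L.support ↔ q.2 = L.eval i q.1 := by
    rintro L hd hn ⟨t, y⟩ hv i hi hm h0
    obtain ⟨h1, h2⟩ := (mem_clipped_true_of_rising hi).1 hm
    simp only at h1 h2 h0
    subst h1
    exact h2.eventually_mem_support_iff hd hn h0 hv
  have upper : ∀ {L : LineFamily n}, L.Distinct → L.NoHorizontal → ∀ {p : ℝ × ℝ},
      p ∉ L.vertices → ∀ {i : Fin n}, p ∈ L.clipped true i → 0 < p.2 →
      ∀ᶠ q in 𝓝 p, q ∈ L.support ↔ q.2 = L.eval i q.1 := by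
    intro L hd hn p hv i hm h0
    rcases (hn i).lt_or_gt with hi | hi
    · have := rise hd.rev hn.rev (p := flipTime p) (i := i)
        (by rw [vertices_rev]; simpa using hv) (by simpa using hi)
        (by rw [mem_clipped_rev]; simpa using hm) (by simpa using h0)
      have h2 := (flipTime.continuous.tendsto p).eventually this
      filter_upwards [h2] with q hq
      rw [support_rev] at hq
      simpa using hq
    · exact rise hd hn hv hi hm h0
  obtain ⟨s, i, hm⟩ := mem_iUnion₂.1 hp
  refine ⟨i, ?_⟩
  rcases (ne_zero_of_notMem_vertices hp hv).lt_or_gt with h0 | h0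
  · have hs : s = false := by
      have := (mem_halfLine_of_mem_clipped hm).2
      cases s
      · rfl
      · simp at this; linarith
    subst hs
    have := upper hd.neg hn.neg (p := flipPos p) (i := i)
      (by rw [vertices_neg]; simpa using hv)
      (by rw [mem_clipped_neg]; simpa using hm) (by simpa using h0)
    have h2 := (flipPos.continuous.tendsto p).eventually this
    filter_upwards [h2] with q hq
    rw [support_neg] at hq
    simpa using hq
  · obtain rfl := eq_true_of_mem_clipped hm h0
    exact upper hd hn hv hm h0

theorem convex_above (L : LineFamily n) (i : Fin n) :
    Convex ℝ {q : ℝ × ℝ | L.eval i q.1 < q.2} := by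
  intro p hp q hq a b ha hb hab
  simp only [mem_ofPred_eq, eval, Prod.fst_add, Prod.snd_add, Prod.smul_fst, Prod.smul_snd,
    smul_eq_mul] at *
  rcases ha.eq_or_lt with rfl | ha
  · obtain rfl : b = 1 := by linarith
    linarith
  · have : L.offset i = (a + b) * L.offset i := by rw [hab, one_mul]
    nlinarith

theorem convex_below (L : LineFamily n) (i : Fin n) :
    Convex ℝ {q : ℝ × ℝ | q.2 < L.eval i q.1} := by
  intro p hp q hq a b ha hb hab
  simp only [mem_ofPred_eq, eval, Prod.fst_add, Prod.snd_add, Prod.smul_fst, Prod.smul_snd,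
    smul_eq_mul] at *
  rcases ha.eq_or_lt with rfl | ha
  · obtain rfl : b = 1 := by linarith
    linarith
  · have : L.offset i = (a + b) * L.offset i := by rw [hab, one_mul]
    nlinarith

/-- A point of the line has, in every neighborhood, points above and below the line. -/
theorem mem_closure_above_and_below {N : Set (ℝ × ℝ)} (hN : IsOpen N) {q : ℝ × ℝ} (hq : q ∈ N)
    (hqi : q.2 = L.eval i q.1) :
    q ∈ closure (N ∩ {q | L.eval i q.1 < q.2}) ∧ q ∈ closure (N ∩ {q | q.2 < L.eval i q.1}) := by
  constructor
  · have hc : ContinuousWithinAt (fun δ : ℝ => (q.1, q.2 + δ)) (Ioi 0) 0 := by fun_prop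
    have h0 : (fun δ : ℝ => (q.1, q.2 + δ)) 0 = q := by simp
    rw [mem_closure_iff_frequently]
    have ht : Tendsto (fun δ : ℝ => (q.1, q.2 + δ)) (𝓝[>] 0) (𝓝 q) := by
      simpa [ContinuousWithinAt] using hc
    refine ht.frequently (Eventually.frequently ?_)
    filter_upwards [ht.eventually (hN.mem_nhds hq), self_mem_nhdsWithin] with δ h1 h2
    exact ⟨h1, by have : 0 < δ := h2; simp only [mem_ofPred_eq]; linarith⟩
  · have hc : ContinuousWithinAt (fun δ : ℝ => (q.1, q.2 - δ)) (Ioi 0) 0 := by fun_prop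
    rw [mem_closure_iff_frequently]
    have ht : Tendsto (fun δ : ℝ => (q.1, q.2 - δ)) (𝓝[>] 0) (𝓝 q) := by
      simpa [ContinuousWithinAt] using hc
    refine ht.frequently (Eventually.frequently ?_)
    filter_upwards [ht.eventually (hN.mem_nhds hq), self_mem_nhdsWithin] with δ h1 h2
    exact ⟨h1, by have : 0 < δ := h2; simp only [mem_ofPred_eq]; linarith⟩

/-- A face whose closure meets an edge is bounded by the whole edge. -/
theorem edge_subset_closure_face (hd : L.Distinct) (hn : L.NoHorizontal) {e F : Set (ℝ × ℝ)}
    (he : e ∈ edges L.support L.vertices) (hF : F ∈ faces univ L.support)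
    (hne : (e ∩ closure F).Nonempty) : e ⊆ closure F := by
  obtain ⟨p, hp, rfl⟩ := he
  obtain ⟨r, hr, rfl⟩ := hF
  set e := connectedComponentIn (L.support \ L.vertices) p
  set F := connectedComponentIn (univ \ L.support) r
  have hloc : ∀ z ∈ e, z ∈ closure F → ∃ N : Set (ℝ × ℝ), IsOpen N ∧ z ∈ N ∧
      e ∩ N ⊆ closure F := by
    intro z hz hzF
    have hzS := connectedComponentIn_subset _ _ hz
    obtain ⟨i, hi⟩ := exists_eventually_mem_support_iff hd hn hzS.1 hzS.2
    obtain ⟨ε, hε, hball⟩ := Metric.eventually_nhds_iff_ball.1 hi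
    refine ⟨Metric.ball z ε, Metric.isOpen_ball, Metric.mem_ball_self hε, ?_⟩
    obtain ⟨q, hqN, hqF⟩ := mem_closure_iff.1 hzF _ Metric.isOpen_ball (Metric.mem_ball_self hε)
    have hqS : q ∉ L.support := (connectedComponentIn_subset _ _ hqF).2
    have hfar : ∀ A : Set (ℝ × ℝ), Convex ℝ A → q ∈ A →
        (∀ x ∈ Metric.ball z ε ∩ A, x.2 ≠ L.eval i x.1) → Metric.ball z ε ∩ A ⊆ F := by
      intro A hA hqA hAi
      have h1 : IsPreconnected (Metric.ball z ε ∩ A) :=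
        ((convex_ball z ε).inter hA).isPreconnected
      have h2 := h1.subset_connectedComponentIn (F := univ \ L.support) (x := q) ⟨hqN, hqA⟩
        fun x hx => ⟨mem_univ _, fun hxS => hAi x hx ((hball x hx.1).1 hxS)⟩
      rwa [← connectedComponentIn_eq hqF] at h2
    rintro x ⟨hx, hxN⟩
    have hxi := (hball x hxN).1 (connectedComponentIn_subset _ _ hx).1
    have hcl := mem_closure_above_and_below Metric.isOpen_ball hxN hxi
    rcases lt_trichotomy q.2 (L.eval i q.1) with h | h | h
    · exact closure_mono (hfar _ (L.convex_below i) h fun x hx => hx.2.ne) hcl.2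
    · exact (hqS ((hball q hqN).2 h)).elim
    · exact closure_mono (hfar _ (L.convex_above i) h fun x hx => hx.2.ne') hcl.1
  choose! N hNo hzN hN using hloc
  -- the union of these neighborhoods is open and meets `e` exactly in the closure of the face
  have hU : IsOpen (⋃ z ∈ e ∩ closure F, N z) :=
    isOpen_biUnion fun z hz => hNo z hz.1 hz.2
  have hpre : IsPreconnected e := isPreconnected_connectedComponentIn
  obtain ⟨z, hz⟩ := hne
  by_contra hcon
  obtain ⟨x, hx, hxF⟩ := not_subset.1 hcon
  obtain ⟨c, hc, hc1, hc2⟩ := hpre _ (closure F)ᶜ hU isClosed_closure.isOpen_compl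
    (fun y hy => by
      by_cases h : y ∈ closure F
      · exact .inl (mem_biUnion (show y ∈ e ∩ closure F from ⟨hy, h⟩) (hzN y hy h))
      · exact .inr h)
    ⟨z, hz.1, mem_biUnion hz (hzN z hz.1 hz.2)⟩ ⟨x, hx, hxF⟩
  obtain ⟨y, hy, hcy⟩ := mem_iUnion₂.1 hc1
  exact hc2 (hN y hy.1 hy.2 ⟨hc, hcy⟩)

end LineFamily

end CentralTrajectory

namespace CentralTrajectory

namespace LineFamily

variable {n : ℕ} {L : LineFamily n} {i j k m : Fin n} {s t u v w x y : ℝ}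
  {I J : Set ℝ} {e e' : Set (ℝ × ℝ)}

/-! ### Edges over an interval, and their end points -/

/-- The edges of the clipped arrangement restricted to the times in `J`. -/
def edgesOver (L : LineFamily n) (J : Set ℝ) : Set (Set (ℝ × ℝ)) :=
  {e | ∃ p ∈ (L.support \ L.vertices) ∩ {p | p.1 ∈ J},
    e = connectedComponentIn ((L.support \ L.vertices) ∩ {p | p.1 ∈ J}) p}

/-- An edge over `J` that bounds a connected set which meets the axis and, as far as the times in
`I` are concerned, avoids the support. The set may leave the slab over `I`: in a concatenation of
arrangements, faces extend over several slabs. -/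
def IsZoneEdge (L : LineFamily n) (I J : Set ℝ) (e : Set (ℝ × ℝ)) : Prop :=
  e ∈ L.edgesOver J ∧ ∃ F : Set (ℝ × ℝ), IsPreconnected F ∧
    (∀ p ∈ F, p.1 ∈ I → p ∉ L.support) ∧ (F ∩ xAxis).Nonempty ∧ e ⊆ closure F

/-- At time `t`, the edge `e` runs along the clipped upper half-line of the rising line `i`. -/
def OnRise (L : LineFamily n) (e : Set (ℝ × ℝ)) (i : Fin n) (t : ℝ) : Prop :=
  L.RiseAlive i t ∧ 0 < L.eval i t ∧ (t, L.eval i t) ∈ e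

/-- The last vertex before `t` on the upper half-line of line `i`, at a time in `J` and above the
axis, is the one at time `u`. -/
def LeftVertex (L : LineFamily n) (J : Set ℝ) (i : Fin n) (t u : ℝ) : Prop :=
  u ∈ J ∧ u < t ∧ 0 < L.eval i u ∧ (u, L.eval i u) ∈ L.vertices ∧
    ∀ w ∈ Ioo u t, (w, L.eval i w) ∉ L.vertices

/-- The first vertex after `t` on the clipped upper half-line of the rising line `i`, at a time in
`J`, is the one at time `u`. -/
def RightVertex (L : LineFamily n) (J : Set ℝ) (i : Fin n) (t u : ℝ) : Prop :=
  u ∈ J ∧ t < u ∧ L.RiseAlive i u ∧ (u, L.eval i u) ∈ L.vertices ∧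
    ∀ w ∈ Ioo t u, (w, L.eval i w) ∉ L.vertices

theorem RiseAlive.pos_of_lt (h : L.RiseAlive i t) (htu : t < u) : 0 < L.eval i u :=
  h.2.1.trans_lt (eval_lt_eval_of_rising h.1 htu)

theorem RiseAlive.of_pos_of_le (h : L.RiseAlive i t) (h0 : 0 < L.eval i u) (hut : u ≤ t) :
    L.RiseAlive i u := h.of_le ((eval_pos_iff_of_rising h.1).1 h0).le hut

theorem OnRise.mem (h : L.OnRise e i t) (he : e ∈ L.edgesOver J) :
    t ∈ J ∧ (t, L.eval i t) ∉ L.vertices := by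
  obtain ⟨p, hp, rfl⟩ := he
  have := connectedComponentIn_subset _ _ h.2.2
  exact ⟨this.2, this.1.2⟩

theorem OnRise.segment (hJ : J.OrdConnected) (he : e ∈ L.edgesOver J) (h : L.OnRise e i t)
    (hu : L.RiseAlive i u) (huJ : u ∈ J) (htu : t ≤ u)
    (hv : ∀ w ∈ Ioc t u, (w, L.eval i w) ∉ L.vertices) :
    ∀ w ∈ Icc t u, (w, L.eval i w) ∈ e := by
  have hm := h.mem he
  obtain ⟨p, hp, rfl⟩ := he
  have hpre : IsPreconnected ((fun w => (w, L.eval i w)) '' Icc t u) :=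
    isPreconnected_Icc.image _ (by fun_prop)
  have := hpre.subset_connectedComponentIn
    (F := (L.support \ L.vertices) ∩ {p | p.1 ∈ J}) (mem_image_of_mem _ ⟨le_rfl, htu⟩) (by
    rintro _ ⟨w, hw, rfl⟩
    refine ⟨⟨(hu.of_pos_of_le ?_ hw.2).mem_support, ?_⟩, hJ.out hm.1 huJ hw⟩
    · rcases hw.1.eq_or_lt with rfl | hlt
      · exact h.2.1
      · exact h.1.pos_of_lt hlt
    · rcases hw.1.eq_or_lt with rfl | hlt
      · exact hm.2
      · exact hv w ⟨hlt, hw.2⟩)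
  rw [← connectedComponentIn_eq h.2.2] at this
  exact fun w hw => this (mem_image_of_mem _ hw)

theorem eq_of_mem_edgesOver (he : e ∈ L.edgesOver J) (he' : e' ∈ L.edgesOver J) {p : ℝ × ℝ}
    (hp : p ∈ e) (hp' : p ∈ e') : e = e' := by
  obtain ⟨q, hq, rfl⟩ := he
  obtain ⟨q', hq', rfl⟩ := he'
  rw [connectedComponentIn_eq hp, connectedComponentIn_eq hp']

theorem OnRise.eq_of_le (hJ : J.OrdConnected) (he : e ∈ L.edgesOver J) (he' : e' ∈ L.edgesOver J)
    (h : L.OnRise e i t) (h' : L.OnRise e' i u) (htu : t ≤ u)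
    (hv : ∀ w ∈ Ioo t u, (w, L.eval i w) ∉ L.vertices) : e = e' := by
  have hm := h'.mem he'
  refine eq_of_mem_edgesOver he he' (h.segment hJ he h'.1 hm.1 htu (fun w hw => ?_) u
    ⟨htu, le_rfl⟩) h'.2.2
  rcases hw.2.eq_or_lt with rfl | hlt
  · exact hm.2
  · exact hv w ⟨hw.1, hlt⟩

theorem finite_vertexTimes (hd : L.Distinct) (hn : L.NoHorizontal) (i : Fin n) :
    {u | (u, L.eval i u) ∈ L.vertices}.Finite :=
  (finite_vertices hd hn).preimage fun _ _ _ _ h => congrArg Prod.fst h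

theorem exists_leftVertex (hd : L.Distinct) (hn : L.NoHorizontal) (hJ : J.OrdConnected)
    (ht : t ∈ J) (hi : 0 < L.slope i) :
    (∀ u ∈ J, u < t → 0 < L.eval i u → (u, L.eval i u) ∉ L.vertices) ∨
      ∃ u, L.LeftVertex J i t u := by
  by_cases hne : {u | (u ∈ J ∧ u < t ∧ 0 < L.eval i u) ∧ (u, L.eval i u) ∈ L.vertices}.Nonempty
  · right
    obtain ⟨u, ⟨⟨h1, h2, h3⟩, h4⟩, hmax⟩ := Set.exists_max_image _ id
      ((finite_vertexTimes hd hn i).subset fun u hu => hu.2) hne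
    refine ⟨u, h1, h2, h3, h4, fun w hw hwv => ?_⟩
    have := hmax w ⟨⟨hJ.out h1 ht ⟨hw.1.le, hw.2.le⟩, hw.2,
      h3.trans (eval_lt_eval_of_rising hi hw.1)⟩, hwv⟩
    exact absurd hw.1 (not_lt.2 this)
  · left
    intro u h1 h2 h3 h4
    exact hne ⟨u, ⟨h1, h2, h3⟩, h4⟩

theorem exists_rightVertex (hd : L.Distinct) (hn : L.NoHorizontal) (hJ : J.OrdConnected)
    (ht : t ∈ J) (h0 : 0 < L.eval i t) :
    (∀ u ∈ J, t < u → L.RiseAlive i u → (u, L.eval i u) ∉ L.vertices) ∨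
      ∃ u, L.RightVertex J i t u := by
  by_cases hne : {u | (u ∈ J ∧ t < u ∧ L.RiseAlive i u) ∧ (u, L.eval i u) ∈ L.vertices}.Nonempty
  · right
    obtain ⟨u, ⟨⟨h1, h2, h3⟩, h4⟩, hmin⟩ := Set.exists_min_image _ id
      ((finite_vertexTimes hd hn i).subset fun u hu => hu.2) hne
    refine ⟨u, h1, h2, h3, h4, fun w hw hwv => ?_⟩
    have := hmin w ⟨⟨hJ.out ht h1 ⟨hw.1.le, hw.2.le⟩, hw.1,
      h3.of_pos_of_le (h0.trans (eval_lt_eval_of_rising h3.1 hw.1)) hw.2.le⟩, hwv⟩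
    exact absurd hw.2 (not_lt.2 this)
  · left
    intro u h1 h2 h3 h4
    exact hne ⟨u, ⟨h1, h2, h3⟩, h4⟩

theorem OnRise.eq_of_leftVertex (hJ : J.OrdConnected) (he : e ∈ L.edgesOver J)
    (he' : e' ∈ L.edgesOver J) (h : L.OnRise e i t) (h' : L.OnRise e' i s)
    (hu : L.LeftVertex J i t u) (hu' : L.LeftVertex J i s u) : e = e' := by
  rcases le_total t s with hts | hts
  · exact h.eq_of_le hJ he he' h' hts fun w hw => hu'.2.2.2.2 w ⟨hu.2.1.trans hw.1, hw.2⟩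
  · exact (h'.eq_of_le hJ he' he h hts fun w hw =>
      hu.2.2.2.2 w ⟨hu'.2.1.trans hw.1, hw.2⟩).symm

theorem OnRise.eq_of_rightVertex (hJ : J.OrdConnected) (he : e ∈ L.edgesOver J)
    (he' : e' ∈ L.edgesOver J) (h : L.OnRise e i t) (h' : L.OnRise e' i s)
    (hu : L.RightVertex J i t u) (hu' : L.RightVertex J i s u) : e = e' := by
  rcases le_total t s with hts | hts
  · exact h.eq_of_le hJ he he' h' hts fun w hw => hu.2.2.2.2 w ⟨hw.1, hw.2.trans hu'.2.1⟩
  · exact (h'.eq_of_le hJ he' he h hts fun w hw =>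
      hu'.2.2.2.2 w ⟨hw.1, hw.2.trans hu.2.1⟩).symm

/-- Of several rising half-lines through one point, at most one survives beyond it. -/
theorem RiseAlive.eq_of_meet_of_lt (hd : L.Distinct) (h : L.RiseAlive i t) (h' : L.RiseAlive k s)
    (hut : u < t) (hus : u < s) (he : L.eval i u = L.eval k u) (h0 : 0 ≤ L.eval i u) : i = k := by
  rcases lt_trichotomy (L.slope i) (L.slope k) with hs | hs | hs
  · have := h'.2.2 i h.1 (root_le_root_of_slope_le h.1 hs.le he h0)
    exact absurd (eval_lt_eval_of_slope_lt he hs hus) (not_lt.2 this)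
  · exact hd.eq_of_eval hs he
  · have := h.2.2 k h'.1 (root_le_root_of_slope_le h'.1 hs.le he.symm (he ▸ h0))
    exact absurd (eval_lt_eval_of_slope_lt he.symm hs hut) (not_lt.2 this)

/-- A rising half-line ends where it meets a less steep one. -/
theorem RiseAlive.le_of_meet (h : L.RiseAlive k v) (hi : 0 < L.slope i)
    (hs : L.slope i < L.slope k) (he : L.eval i u = L.eval k u) (h0 : 0 ≤ L.eval i u) : v ≤ u := by
  by_contra! hlt
  have := h.2.2 i hi (root_le_root_of_slope_le hi hs.le he h0)
  exact absurd (eval_lt_eval_of_slope_lt he hs hlt) (not_lt.2 this)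

/-! ### Charging the zone edges on rising half-lines above the axis

An edge is charged according to the vertex at one of its ends. -/

/-- The lines of positive slope. -/
def rising (L : LineFamily n) : Set (Fin n) := {i | 0 < L.slope i}

/-- The lines of negative slope. -/
def falling (L : LineFamily n) : Set (Fin n) := {i | L.slope i < 0}

/-- Edges without a vertex before them are the first ones on their half-lines. -/
theorem encard_first_le (hJ : J.OrdConnected) :
    {e ∈ L.edgesOver J | ∃ i t, L.OnRise e i t ∧
      ∀ u ∈ J, u < t → 0 < L.eval i u → (u, L.eval i u) ∉ L.vertices}.encard ≤
    L.rising.encard := by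
  refine encard_le_of_charge (fun e i => ∃ t, L.OnRise e i t ∧
      ∀ u ∈ J, u < t → 0 < L.eval i u → (u, L.eval i u) ∉ L.vertices) ?_ ?_
  · rintro e ⟨_, i, t, h⟩; exact ⟨i, h.1.1.1, t, h⟩
  · rintro e ⟨he, _⟩ e' ⟨he', _⟩ i ⟨t, h, hv⟩ ⟨s, h', hv'⟩
    have ht := (h.mem he).1
    have hs := (h'.mem he').1
    rcases le_total t s with hts | hts
    · exact h.eq_of_le hJ he he' h' hts fun w hw =>
        hv' w (hJ.out ht hs ⟨hw.1.le, hw.2.le⟩) hw.2 (h.1.pos_of_lt hw.1)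
    · exact (h'.eq_of_le hJ he' he h hts fun w hw =>
        hv w (hJ.out hs ht ⟨hw.1.le, hw.2.le⟩) hw.2 (h'.1.pos_of_lt hw.1)).symm

/-- An edge that starts at a rising half-line `k` which ends there is charged to `k`. -/
theorem encard_leftMerge_le (hd : L.Distinct) (hJ : J.OrdConnected) :
    {e ∈ L.edgesOver J | ∃ k i t u, L.OnRise e i t ∧ L.LeftVertex J i t u ∧ k ≠ i ∧
      L.RiseAlive k u ∧ L.eval k u = L.eval i u}.encard ≤ L.rising.encard := by
  have key : ∀ {i i' k : Fin n} {t u u' : ℝ}, L.RiseAlive i t → u < t → k ≠ i →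
      L.RiseAlive k u → L.RiseAlive k u' → L.eval k u = L.eval i u → u' ≤ u := by
    intro i i' k t u u' hi hut hki hk hk' he
    have hs : L.slope i < L.slope k := by
      rcases lt_trichotomy (L.slope i) (L.slope k) with hs | hs | hs
      · exact hs
      · exact (hki (hd.eq_of_eval hs he.symm).symm).elim
      · exact absurd (hi.le_of_meet hk.1 hs he hk.2.1) (not_le.2 hut)
    exact hk'.le_of_meet hi.1 hs he.symm (he ▸ hk.2.1)
  refine encard_le_of_charge (fun e k => ∃ i t u, L.OnRise e i t ∧ L.LeftVertex J i t u ∧ k ≠ i ∧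
      L.RiseAlive k u ∧ L.eval k u = L.eval i u) ?_ ?_
  · rintro e ⟨_, k, i, t, u, h⟩; exact ⟨k, h.2.2.2.1.1, i, t, u, h⟩
  · rintro e ⟨he, _⟩ e' ⟨he', _⟩ k ⟨i, t, u, h, hu, hki, hk, heq⟩
      ⟨i', t', u', h', hu', hki', hk', heq'⟩
    obtain rfl : u = u' := le_antisymm
      (key (i' := i) h'.1 hu'.2.1 hki' hk' hk heq') (key (i' := i) h.1 hu.2.1 hki hk hk' heq)
    obtain rfl := h.1.eq_of_meet_of_lt hd h'.1 hu.2.1 hu'.2.1 (heq.symm.trans heq') hu.2.2.1.le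
    exact h.eq_of_leftVertex hJ he he' h' hu hu'

/-- An edge that starts at a crossing with a falling half-line `j` and is not above a wedge is
charged to `j`: the parts of the rising half-lines just above `j` are above the wedge formed by `j`
and the rising half-line that crosses `j` next. -/
theorem encard_leftCross_notMem_wedge_le (hd : L.Distinct) (hJ : J.OrdConnected) :
    {e ∈ L.edgesOver J | (∀ i t, L.OnRise e i t → (t, L.eval i t) ∉ L.wedge) ∧
      ∃ j i t u, L.OnRise e i t ∧ L.LeftVertex J i t u ∧
      L.FallAlive j u ∧ L.eval j u = L.eval i u}.encard ≤ L.falling.encard := by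
  have key : ∀ {e : Set (ℝ × ℝ)} {i i' j : Fin n} {t u u' : ℝ}, e ∈ L.edgesOver J →
      (∀ i t, L.OnRise e i t → (t, L.eval i t) ∉ L.wedge) → L.OnRise e i t →
      L.LeftVertex J i t u → L.FallAlive j u → L.FallAlive j u' → L.eval j u = L.eval i u →
      0 < L.slope i' → L.eval j u' = L.eval i' u' → u < u' → False := by
    intro e i i' j t u u' he hw h hu hj hj' heq hi' heq' huu
    -- a time just after `u`, at which line `i'` is still below line `j`
    obtain ⟨s, hus, hst⟩ : ∃ s, u < s ∧ s < min t u' := exists_between (lt_min hu.2.1 huu)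
    have hs : L.RiseAlive i s := h.1.of_pos_of_le
      (hu.2.2.1.trans (eval_lt_eval_of_rising h.1.1 hus)) (hst.le.trans (min_le_left _ _))
    have hsJ : s ∈ J := hJ.out hu.1 (h.mem he).1 ⟨hus.le, hst.le.trans (min_le_left _ _)⟩
    have hs0 : 0 < L.eval i s := hu.2.2.1.trans (eval_lt_eval_of_rising h.1.1 hus)
    have hse : L.OnRise e i s := by
      refine ⟨hs, hs0, ?_⟩
      have hv : ∀ w ∈ Icc s t, (w, L.eval i w) ∉ L.vertices := fun w hw => by
        rcases hw.2.eq_or_lt with rfl | hlt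
        · exact (h.mem he).2
        · exact hu.2.2.2.2 w ⟨hus.trans_le hw.1, hlt⟩
      have hst' : s ≤ t := hst.le.trans (min_le_left _ _)
      set e' := connectedComponentIn ((L.support \ L.vertices) ∩ {p | p.1 ∈ J}) (s, L.eval i s)
      have hmem : (s, L.eval i s) ∈ (L.support \ L.vertices) ∩ {p | p.1 ∈ J} :=
        ⟨⟨hs.mem_support, hv s ⟨le_rfl, hst'⟩⟩, hsJ⟩
      have he' : e' ∈ L.edgesOver J := ⟨_, hmem, rfl⟩
      have hse' : (s, L.eval i s) ∈ e' := mem_connectedComponentIn hmem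
      have : e' = e := OnRise.eq_of_le hJ he' he ⟨hs, hs0, hse'⟩ h hst'
        fun w hw => hv w ⟨hw.1.le, hw.2.le⟩
      rwa [← this]
    refine hw i s hse ⟨i', j, hi', hj.1, root_le_root_of_meet hi' hj.1 heq'.symm
      (heq' ▸ hj'.2.1), ?_, ?_⟩
    · have h1 := eval_lt_eval_of_falling hj.1 hus
      have h2 := eval_lt_eval_of_rising h.1.1 hus
      have h3 := eval_lt_eval_of_falling hj.1 (hst.trans_le (min_le_right _ _))
      have h4 := eval_lt_eval_of_rising hi' (hst.trans_le (min_le_right _ _))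
      simp only; linarith
    · have h1 := eval_lt_eval_of_falling hj.1 hus
      have h2 := eval_lt_eval_of_rising h.1.1 hus
      simp only; linarith
  refine encard_le_of_charge (fun e j => ∃ i t u, L.OnRise e i t ∧ L.LeftVertex J i t u ∧
      L.FallAlive j u ∧ L.eval j u = L.eval i u) ?_ ?_
  · rintro e ⟨_, _, j, i, t, u, h⟩; exact ⟨j, h.2.2.1.1, i, t, u, h⟩
  · rintro e ⟨he, hw, _⟩ e' ⟨he', hw', _⟩ j ⟨i, t, u, h, hu, hj, heq⟩
      ⟨i', t', u', h', hu', hj', heq'⟩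
    rcases lt_trichotomy u u' with huu | rfl | huu
    · exact (key he hw h hu hj hj' heq h'.1.1 heq' huu).elim
    · obtain rfl := h.1.eq_of_meet_of_lt hd h'.1 hu.2.1 hu'.2.1 (heq.symm.trans heq') hu.2.2.1.le
      exact h.eq_of_leftVertex hJ he he' h' hu hu'
    · exact (key he' hw' h' hu' hj' hj heq' h.1.1 heq huu).elim

/-- The point of line `i` at time `t` lies in no right sector of a crossing at a time in `J`. -/
def AvoidsRightSectors (L : LineFamily n) (J : Set ℝ) (i : Fin n) (t : ℝ) : Prop :=
  ∀ k m v, v ∈ J → L.RiseAlive k v → L.FallAlive m v → L.eval k v = L.eval m v →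
    (t, L.eval i t) ∉ L.rightSector k m v

/-- The point of line `i` at time `t` lies in no left sector of a crossing at a time in `J`. -/
def AvoidsLeftSectors (L : LineFamily n) (J : Set ℝ) (i : Fin n) (t : ℝ) : Prop :=
  ∀ k m v, v ∈ J → L.RiseAlive k v → L.FallAlive m v → L.eval k v = L.eval m v →
    (t, L.eval i t) ∉ L.leftSector k m v

/-- An edge that starts at a crossing with a falling half-line `j` and is not in a right sector is
charged to `j`: beyond the first crossing on `j`, everything above `j` is in a right sector. -/
theorem encard_leftCross_avoids_le (hd : L.Distinct) (hn : L.NoHorizontal) (hJ : J.OrdConnected) :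
    {e ∈ L.edgesOver J | ∃ j i t u, L.OnRise e i t ∧ L.LeftVertex J i t u ∧
      L.FallAlive j u ∧ L.eval j u = L.eval i u ∧ L.AvoidsRightSectors J i t}.encard ≤
      L.falling.encard := by
  have key : ∀ {e' : Set (ℝ × ℝ)} {i i' j : Fin n} {t t' u u' : ℝ}, e' ∈ L.edgesOver J →
      L.OnRise e' i' t' → L.RiseAlive i t → L.LeftVertex J i t u → L.LeftVertex J i' t' u' →
      L.FallAlive j u → L.FallAlive j u' →
      L.eval j u = L.eval i u → L.eval j u' = L.eval i' u' →
      L.AvoidsRightSectors J i' t' → u < u' → False := by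
    intro e' i i' j t t' u u' he' h' h hu hu' hj hj' heq heq' hav huu
    have hiu := h.of_pos_of_le hu.2.2.1 hu.2.1.le
    -- line `i'` is below line `i` at time `u`
    have hlt : L.eval i' u < L.eval i u := by
      have h1 := eval_lt_eval_of_falling hj.1 huu
      have h2 := eval_lt_eval_of_rising h'.1.1 huu
      linarith
    have hroot : L.root i < L.root i' := by
      by_contra! hle
      exact absurd (hiu.2.2 i' h'.1.1 hle) (not_le.2 hlt)
    refine hav i j u hu.1 hiu hj heq.symm ⟨huu.trans hu'.2.1, ?_, fun k hk hki => ?_⟩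
    · have h1 := eval_lt_eval_of_falling hj.1 hu'.2.1
      have h2 := eval_lt_eval_of_rising h'.1.1 hu'.2.1
      simp only; linarith
    · refine h'.1.lt_of_notMem_vertices hd hn h'.2.1 (h'.mem he').2 hk (hki.trans hroot.le) ?_
      rintro rfl
      exact absurd hki (not_le.2 hroot)
  refine encard_le_of_charge (fun e j => ∃ i t u, L.OnRise e i t ∧ L.LeftVertex J i t u ∧
      L.FallAlive j u ∧ L.eval j u = L.eval i u ∧ L.AvoidsRightSectors J i t) ?_ ?_
  · rintro e ⟨_, j, i, t, u, h⟩; exact ⟨j, h.2.2.1.1, i, t, u, h⟩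
  · rintro e ⟨he, _⟩ e' ⟨he', _⟩ j ⟨i, t, u, h, hu, hj, heq, hav⟩
      ⟨i', t', u', h', hu', hj', heq', hav'⟩
    rcases lt_trichotomy u u' with huu | rfl | huu
    · exact (key he' h' h.1 hu hu' hj hj' heq heq' hav' huu).elim
    · obtain rfl := h.1.eq_of_meet_of_lt hd h'.1 hu.2.1 hu'.2.1 (heq.symm.trans heq') hu.2.2.1.le
      exact h.eq_of_leftVertex hJ he he' h' hu hu'
    · exact (key he h h'.1 hu' hu hj' hj heq' heq hav huu).elim

/-- Edges without a vertex after them are the last ones on their half-lines. -/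
theorem encard_last_le (hJ : J.OrdConnected) :
    {e ∈ L.edgesOver J | ∃ i t, L.OnRise e i t ∧
      ∀ u ∈ J, t < u → L.RiseAlive i u → (u, L.eval i u) ∉ L.vertices}.encard ≤
    L.rising.encard := by
  refine encard_le_of_charge (fun e i => ∃ t, L.OnRise e i t ∧
      ∀ u ∈ J, t < u → L.RiseAlive i u → (u, L.eval i u) ∉ L.vertices) ?_ ?_
  · rintro e ⟨_, i, t, h⟩; exact ⟨i, h.1.1.1, t, h⟩
  · rintro e ⟨he, _⟩ e' ⟨he', _⟩ i ⟨t, h, hv⟩ ⟨s, h', hv'⟩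
    have ht := (h.mem he).1
    have hs := (h'.mem he').1
    rcases le_total t s with hts | hts
    · exact h.eq_of_le hJ he he' h' hts fun w hw => hv w (hJ.out ht hs ⟨hw.1.le, hw.2.le⟩) hw.1
        (h'.1.of_pos_of_le (h.1.pos_of_lt hw.1) hw.2.le)
    · exact (h'.eq_of_le hJ he' he h hts fun w hw => hv' w (hJ.out hs ht ⟨hw.1.le, hw.2.le⟩) hw.1
        (h.1.of_pos_of_le (h'.1.pos_of_lt hw.1) hw.2.le)).symm

/-- An edge at whose right end its own half-line is clipped is charged to that half-line. -/
theorem encard_clippedEnd_le (hJ : J.OrdConnected) :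
    {e ∈ L.edgesOver J | ∃ i t u, L.OnRise e i t ∧ L.RightVertex J i t u ∧
      ∃ k, 0 < L.slope k ∧ L.slope k < L.slope i ∧ L.eval k u = L.eval i u}.encard ≤
      L.rising.encard := by
  refine encard_le_of_charge (fun e i => ∃ t u, L.OnRise e i t ∧ L.RightVertex J i t u ∧
      ∃ k, 0 < L.slope k ∧ L.slope k < L.slope i ∧ L.eval k u = L.eval i u) ?_ ?_
  · rintro e ⟨_, i, t, u, h⟩; exact ⟨i, h.1.1.1, t, u, h⟩
  · rintro e ⟨he, _⟩ e' ⟨he', _⟩ i ⟨t, u, h, hu, k, hk, hs, heq⟩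
      ⟨t', u', h', hu', k', hk', hs', heq'⟩
    obtain rfl : u = u' := le_antisymm
      (hu.2.2.1.le_of_meet hk' hs' heq' (heq' ▸ hu'.2.2.1.2.1))
      (hu'.2.2.1.le_of_meet hk hs heq (heq ▸ hu.2.2.1.2.1))
    exact h.eq_of_rightVertex hJ he he' h' hu hu'

/-- An edge that at its right end meets a rising half-line `k` which is clipped there, is charged
to `k`. -/
theorem encard_rightMerge_le (hd : L.Distinct) (hJ : J.OrdConnected) :
    {e ∈ L.edgesOver J | ∃ k i t u, L.OnRise e i t ∧ L.RightVertex J i t u ∧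
      (∀ l, 0 < L.slope l → L.eval l u = L.eval i u → L.slope i ≤ L.slope l) ∧ k ≠ i ∧
      L.RiseAlive k u ∧ L.eval k u = L.eval i u}.encard ≤ L.rising.encard := by
  have key : ∀ {i k : Fin n} {u u' : ℝ}, L.RiseAlive i u → k ≠ i → L.RiseAlive k u →
      L.RiseAlive k u' → L.eval k u = L.eval i u → L.slope i ≤ L.slope k → u' ≤ u := by
    intro i k u u' hi hki hk hk' heq hs
    refine hk'.le_of_meet hi.1 (hs.lt_of_ne fun h => hki (hd.eq_of_eval h heq.symm).symm) heq.symm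
      hi.2.1
  refine encard_le_of_charge (fun e k => ∃ i t u, L.OnRise e i t ∧ L.RightVertex J i t u ∧
      (∀ l, 0 < L.slope l → L.eval l u = L.eval i u → L.slope i ≤ L.slope l) ∧ k ≠ i ∧
      L.RiseAlive k u ∧ L.eval k u = L.eval i u) ?_ ?_
  · rintro e ⟨_, k, i, t, u, h⟩; exact ⟨k, h.2.2.2.2.1.1, i, t, u, h⟩
  · rintro e ⟨he, _⟩ e' ⟨he', _⟩ k ⟨i, t, u, h, hu, hmin, hki, hk, heq⟩
      ⟨i', t', u', h', hu', hmin', hki', hk', heq'⟩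
    obtain rfl : u = u' := le_antisymm
      (key hu'.2.2.1 hki' hk' hk heq' (hmin' k hk.1 heq'))
      (key hu.2.2.1 hki hk hk' heq (hmin k hk.1 heq))
    have hii : L.eval i' u = L.eval i u := heq'.symm.trans heq
    obtain rfl : i = i' := hd.eq_of_eval
      (le_antisymm (hmin i' h'.1.1 hii) (hmin' i h.1.1 hii.symm)) hii.symm
    exact h.eq_of_rightVertex hJ he he' h' hu hu'

/-- An edge that ends at a crossing with a falling half-line `j` and is not in a left sector is
charged to `j`. -/
theorem encard_rightCross_avoids_le (hd : L.Distinct) (hJ : J.OrdConnected) :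
    {e ∈ L.edgesOver J | ∃ j i t u, L.OnRise e i t ∧ L.RightVertex J i t u ∧
      (∀ l, 0 < L.slope l → L.eval l u = L.eval i u → L.slope i ≤ L.slope l) ∧
      L.FallAlive j u ∧ L.eval j u = L.eval i u ∧ L.AvoidsLeftSectors J i t}.encard ≤
      L.falling.encard := by
  have key : ∀ {i i' j : Fin n} {t t' u u' : ℝ}, L.RiseAlive i t →
      L.RightVertex J i t u → L.RightVertex J i' t' u' → L.FallAlive j u → L.FallAlive j u' →
      L.eval j u = L.eval i u → L.eval j u' = L.eval i' u' →
      L.AvoidsLeftSectors J i t → u < u' → False := by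
    intro i i' j t t' u u' h hu hu' hj hj' heq heq' hav huu
    have hi := hu.2.2.1
    have hi' := hu'.2.2.1
    have hlt : L.eval i' u < L.eval i u := by
      have h1 := eval_lt_eval_of_falling hj.1 huu
      have h2 := eval_lt_eval_of_rising hi'.1 huu
      linarith
    refine hav i' j u' hu'.1 hi' hj' heq'.symm ⟨hu.2.1.trans huu, ?_, fun k hk hkj => ?_⟩
    · by_contra! hle
      simp only at hle
      -- otherwise line `i'` would clip line `i` before time `u`
      obtain ⟨c, hc, hce⟩ : ∃ c ∈ Icc t u, L.eval i' c - L.eval i c = 0 := by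
        have hcont : ContinuousOn (fun c => L.eval i' c - L.eval i c) (Icc t u) := by fun_prop
        exact intermediate_value_Icc' hu.2.1.le hcont ⟨by linarith, by linarith⟩
      have hce' : L.eval i' c = L.eval i c := by linarith
      have hc0 : 0 ≤ L.eval i c := by
        rcases hc.1.eq_or_lt with rfl | h1
        · exact h.2.1
        · exact (h.pos_of_lt h1).le
      have hcu : c < u := hc.2.lt_of_ne (by rintro rfl; linarith)
      have hs : L.slope i' < L.slope i := by
        by_contra! hs
        have h1 := L.eval_sub i u c
        have h2 := L.eval_sub i' u c
        nlinarith
      exact absurd (hi.le_of_meet hi'.1 hs hce' (hce' ▸ hc0)) (not_le.2 hcu)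
    · have h1 := hj.2.2 k hk hkj
      have h2 := eval_lt_eval_of_falling hk hu.2.1
      have h3 := eval_lt_eval_of_rising h.1 hu.2.1
      simp only; linarith
  refine encard_le_of_charge (fun e j => ∃ i t u, L.OnRise e i t ∧ L.RightVertex J i t u ∧
      (∀ l, 0 < L.slope l → L.eval l u = L.eval i u → L.slope i ≤ L.slope l) ∧
      L.FallAlive j u ∧ L.eval j u = L.eval i u ∧ L.AvoidsLeftSectors J i t) ?_ ?_
  · rintro e ⟨_, j, i, t, u, h⟩; exact ⟨j, h.2.2.2.1.1, i, t, u, h⟩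
  · rintro e ⟨he, _⟩ e' ⟨he', _⟩ j ⟨i, t, u, h, hu, hmin, hj, heq, hav⟩
      ⟨i', t', u', h', hu', hmin', hj', heq', hav'⟩
    rcases lt_trichotomy u u' with huu | rfl | huu
    · exact (key h.1 hu hu' hj hj' heq heq' hav huu).elim
    · have hii : L.eval i' u = L.eval i u := heq'.symm.trans heq
      obtain rfl : i = i' := hd.eq_of_eval
        (le_antisymm (hmin i' h'.1.1 hii) (hmin' i h.1.1 hii.symm)) hii.symm
      exact h.eq_of_rightVertex hJ he he' h' hu hu'
    · exact (key h'.1 hu' hu hj' hj heq' heq hav' huu).elim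

/-- Each edge on a rising half-line that is above no wedge is charged according to its left end. -/
theorem encard_notMem_wedge_le (hd : L.Distinct) (hn : L.NoHorizontal) (hJ : J.OrdConnected) :
    {e ∈ L.edgesOver J | (∀ i t, L.OnRise e i t → (t, L.eval i t) ∉ L.wedge) ∧
      ∃ i t, L.OnRise e i t}.encard ≤
      L.rising.encard + L.rising.encard + L.falling.encard := by
  refine le_trans (encard_le_encard fun e he => ?_) <| (encard_union_le _ _).trans <| add_le_add
    ((encard_union_le _ _).trans <| add_le_add (encard_first_le (L := L) hJ)
      (encard_leftMerge_le hd hJ)) (encard_leftCross_notMem_wedge_le hd hJ)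
  obtain ⟨he, hw, i, t, h⟩ := he
  rcases exists_leftVertex hd hn hJ (h.mem he).1 h.1.1 with hv | ⟨u, hu⟩
  · exact .inl (.inl ⟨he, i, t, h, hv⟩)
  · have hiu := h.1.of_pos_of_le hu.2.2.1 hu.2.1.le
    obtain ⟨k, hk, hke, hk' | hk'⟩ :=
      (mem_vertices_of_pos hn hiu.mem_clipped hu.2.2.1).1 hu.2.2.2.1
    · exact .inl (.inr ⟨he, k, i, t, u, h, hu, hk, hk', hke.symm⟩)
    · exact .inr ⟨he, hw, k, i, t, u, h, hu, hk', hke.symm⟩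

/-- Edges that avoid right sectors are charged according to their left ends, edges that avoid left
sectors according to their right ends. -/
theorem encard_avoids_le (hd : L.Distinct) (hn : L.NoHorizontal) (hJ : J.OrdConnected) :
    {e ∈ L.edgesOver J | ∃ i t, L.OnRise e i t ∧
      (L.AvoidsRightSectors J i t ∨ L.AvoidsLeftSectors J i t)}.encard ≤
      (L.rising.encard + L.rising.encard + L.falling.encard) +
      (L.rising.encard + L.rising.encard + L.rising.encard + L.falling.encard) := by
  refine le_trans (encard_le_encard fun e he => ?_) <| (encard_union_le _ _).trans <| add_le_add
    ((encard_union_le _ _).trans <| add_le_add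
      ((encard_union_le _ _).trans <| add_le_add (encard_first_le (L := L) hJ)
        (encard_leftMerge_le hd hJ))
      (encard_leftCross_avoids_le hd hn hJ))
    ((encard_union_le _ _).trans <| add_le_add
      ((encard_union_le _ _).trans <| add_le_add
        ((encard_union_le _ _).trans <| add_le_add (encard_last_le (L := L) hJ)
          (encard_clippedEnd_le (L := L) hJ))
        (encard_rightMerge_le hd hJ))
      (encard_rightCross_avoids_le hd hJ))
  obtain ⟨he, i, t, h, hav | hav⟩ := he
  · left
    rcases exists_leftVertex hd hn hJ (h.mem he).1 h.1.1 with hv | ⟨u, hu⟩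
    · exact .inl (.inl ⟨he, i, t, h, hv⟩)
    · have hiu := h.1.of_pos_of_le hu.2.2.1 hu.2.1.le
      obtain ⟨k, hk, hke, hk' | hk'⟩ :=
        (mem_vertices_of_pos hn hiu.mem_clipped hu.2.2.1).1 hu.2.2.2.1
      · exact .inl (.inr ⟨he, k, i, t, u, h, hu, hk, hk', hke.symm⟩)
      · exact .inr ⟨he, k, i, t, u, h, hu, hk', hke.symm, hav⟩
  · right
    rcases exists_rightVertex hd hn hJ (h.mem he).1 h.2.1 with hv | ⟨u, hu⟩
    · exact .inl (.inl (.inl ⟨he, i, t, h, hv⟩))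
    · by_cases hmin : ∀ l, 0 < L.slope l → L.eval l u = L.eval i u → L.slope i ≤ L.slope l
      · obtain ⟨k, hk, hke, hk' | hk'⟩ := (mem_vertices_of_pos hn hu.2.2.1.mem_clipped
          (h.1.pos_of_lt hu.2.1)).1 hu.2.2.2.1
        · exact .inl (.inr ⟨he, k, i, t, u, h, hu, hmin, hk, hk', hke.symm⟩)
        · exact .inr ⟨he, k, i, t, u, h, hu, hmin, hk', hke.symm, hav⟩
      · push Not at hmin
        obtain ⟨k, hk, hke, hks⟩ := hmin
        exact .inl (.inl (.inr ⟨he, i, t, u, h, hu, k, hk, hks, hke⟩))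

theorem encard_isZoneEdge_onRise_le (hd : L.Distinct) (hn : L.NoHorizontal) :
    {e | L.IsZoneEdge univ univ e ∧ ∃ i t, L.OnRise e i t}.encard ≤
      2 * L.rising.encard + L.falling.encard := by
  rw [two_mul]
  refine le_trans (encard_le_encard ?_) (encard_notMem_wedge_le hd hn ordConnected_univ)
  rintro e ⟨⟨he, F, hF, hFS, hax, heF⟩, h⟩
  exact ⟨he, fun i t hit => notMem_wedge_of_isPreconnected hF
    (disjoint_left.2 fun p hp => hFS p hp (mem_univ _)) hax (heF hit.2.2), h⟩

theorem encard_isZoneEdge_slab_onRise_le (hd : L.Distinct) (hn : L.NoHorizontal) (a b : ℝ) :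
    {e | L.IsZoneEdge (Icc a b) (Ioo a b) e ∧ ∃ i t, L.OnRise e i t}.encard ≤
      7 * L.rising.encard + 3 * L.falling.encard := by
  refine le_trans (encard_le_encard ?_) <| (encard_union_le _ _).trans <| (add_le_add
    (encard_notMem_wedge_le hd hn (J := Ioo a b) ordConnected_Ioo)
    (encard_avoids_le hd hn (J := Ioo a b) ordConnected_Ioo)).trans (le_of_eq (by ring))
  rintro e ⟨⟨he, F, hF, hFS, hax, heF⟩, h⟩
  by_cases hav : ∃ i t, L.OnRise e i t ∧
      (L.AvoidsRightSectors (Ioo a b) i t ∨ L.AvoidsLeftSectors (Ioo a b) i t)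
  · exact .inr ⟨he, hav⟩
  · refine .inl ⟨he, fun i t hit hw => hav ⟨i, t, hit, ?_⟩, h⟩
    by_contra! hcon
    obtain ⟨h1, h2⟩ := hcon
    simp only [AvoidsRightSectors, AvoidsLeftSectors, not_forall, not_not] at h1 h2
    obtain ⟨k, m, v, hv, hk, hm, hkm, hr⟩ := h1
    obtain ⟨k', m', v', hv', hk', hm', hkm', hl⟩ := h2
    exact notMem_sectors_of_isPreconnected hF hFS hax (heF hit.2.2) hw hv.1 hk hm hkm hr
      hv'.2 hk' hm' hkm' hl

/-! ### All zone edges, by symmetry -/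

theorem IsZoneEdge.image (φ : (ℝ × ℝ) ≃ₜ (ℝ × ℝ)) (hφ : φ '' xAxis ⊆ xAxis) {L' : LineFamily n}
    {I' J' : Set ℝ} (hS : L'.support = φ '' L.support) (hV : L'.vertices = φ '' L.vertices)
    (hI : ∀ p, (φ p).1 ∈ I' → p.1 ∈ I)
    (hJ : ∀ p, (φ p).1 ∈ J' ↔ p.1 ∈ J) (h : L.IsZoneEdge I J e) :
    L'.IsZoneEdge I' J' (φ '' e) := by
  obtain ⟨⟨p, hp, rfl⟩, F, hF, hFS, ⟨z, hz, hz0⟩, heF⟩ := h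
  have himg : φ '' ((L.support \ L.vertices) ∩ {p | p.1 ∈ J}) =
      (L'.support \ L'.vertices) ∩ {p | p.1 ∈ J'} := by
    rw [hS, hV, image_inter φ.injective, image_sdiff φ.injective]
    congr 1
    ext q
    obtain ⟨q, rfl⟩ := φ.surjective q
    rw [φ.injective.mem_set_image]
    exact (hJ q).symm
  refine ⟨⟨φ p, himg ▸ mem_image_of_mem φ hp, ?_⟩, φ '' F, hF.image _ φ.continuous.continuousOn,
    ?_, ⟨φ z, mem_image_of_mem φ hz, hφ (mem_image_of_mem φ hz0)⟩, ?_⟩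
  · rw [φ.image_connectedComponentIn hp, himg]
  · rintro _ ⟨q, hq, rfl⟩ hqI
    rw [hS, φ.injective.mem_set_image]
    exact hFS q hq (hI q hqI)
  · rw [← φ.image_closure]; exact image_mono heF

theorem IsZoneEdge.flipPos (h : L.IsZoneEdge I J e) : L.neg.IsZoneEdge I J (flipPos '' e) :=
  h.image CentralTrajectory.flipPos
    (by rintro _ ⟨p, hp, rfl⟩; have : p.2 = 0 := hp; simp [xAxis, this])
    L.support_neg L.vertices_neg (fun _ h => h) fun _ => Iff.rfl

theorem IsZoneEdge.flipTime (h : L.IsZoneEdge I J e) :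
    L.rev.IsZoneEdge (Neg.neg ⁻¹' I) (Neg.neg ⁻¹' J) (flipTime '' e) :=
  h.image CentralTrajectory.flipTime
    (by rintro _ ⟨p, hp, rfl⟩; have : p.2 = 0 := hp; simp [xAxis, this])
    L.support_rev L.vertices_rev (fun p h => by simpa using h) fun p => by simp

@[simp] theorem flipPos_flipPos (e : Set (ℝ × ℝ)) : CentralTrajectory.flipPos ''
    (CentralTrajectory.flipPos '' e) = e := by
  simp [image_image]

@[simp] theorem flipTime_flipTime (e : Set (ℝ × ℝ)) : CentralTrajectory.flipTime ''
    (CentralTrajectory.flipTime '' e) = e := by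
  simp [image_image]

/-- Every zone edge is, after a reflection, on a rising half-line above the axis. -/
theorem encard_isZoneEdge_le (hn : L.NoHorizontal) (I J : Set ℝ) :
    {e | L.IsZoneEdge I J e}.encard ≤
      ({e | L.IsZoneEdge I J e ∧ ∃ i t, L.OnRise e i t}.encard +
      {e | L.rev.IsZoneEdge (Neg.neg ⁻¹' I) (Neg.neg ⁻¹' J) e ∧
        ∃ i t, L.rev.OnRise e i t}.encard) +
      ({e | L.neg.IsZoneEdge I J e ∧ ∃ i t, L.neg.OnRise e i t}.encard +
      {e | L.neg.rev.IsZoneEdge (Neg.neg ⁻¹' I) (Neg.neg ⁻¹' J) e ∧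
        ∃ i t, L.neg.rev.OnRise e i t}.encard) := by
  have upper : ∀ L : LineFamily n, L.NoHorizontal →
      {e | L.IsZoneEdge I J e ∧ ∃ p ∈ e, 0 < p.2}.encard ≤
      {e | L.IsZoneEdge I J e ∧ ∃ i t, L.OnRise e i t}.encard +
      {e | L.rev.IsZoneEdge (Neg.neg ⁻¹' I) (Neg.neg ⁻¹' J) e ∧
        ∃ i t, L.rev.OnRise e i t}.encard := by
    intro L hn
    rw [← (image_injective.2 CentralTrajectory.flipTime.injective).encard_image
      {e | L.rev.IsZoneEdge (Neg.neg ⁻¹' I) (Neg.neg ⁻¹' J) e ∧ ∃ i t, L.rev.OnRise e i t}]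
    refine (encard_le_encard ?_).trans (encard_union_le _ _)
    rintro e ⟨he, p, hp, h0⟩
    have hpS : p ∈ L.support := by
      obtain ⟨⟨q, hq, rfl⟩, -⟩ := he
      exact (connectedComponentIn_subset _ _ hp).1.1
    obtain ⟨i, h1, h2 | h2⟩ := mem_support_of_pos hn hpS h0
    · exact .inl ⟨he, i, p.1, h2, h1 ▸ h0, by rwa [← h1]⟩
    · refine .inr ⟨CentralTrajectory.flipTime '' e, ⟨he.flipTime, i, -p.1, ?_, ?_, ?_⟩, by simp⟩
      · rw [riseAlive_rev]; simpa using h2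
      · simpa [← h1] using h0
      · exact ⟨p, hp, by simp [← h1]⟩
  refine le_trans ?_ (add_le_add (upper L hn) (upper L.neg hn.neg))
  rw [← (image_injective.2 CentralTrajectory.flipPos.injective).encard_image
    {e | L.neg.IsZoneEdge I J e ∧ ∃ p ∈ e, 0 < p.2}]
  refine (encard_le_encard ?_).trans (encard_union_le _ _)
  intro e he
  obtain ⟨p, hp, hpv⟩ : ∃ p ∈ e, p ∈ L.support \ L.vertices := by
    obtain ⟨⟨q, hq, rfl⟩, -⟩ := id he
    exact ⟨q, mem_connectedComponentIn hq, hq.1⟩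
  rcases (ne_zero_of_notMem_vertices hpv.1 hpv.2).lt_or_gt with h0 | h0
  · exact .inr ⟨CentralTrajectory.flipPos '' e, ⟨he.flipPos, CentralTrajectory.flipPos p,
      mem_image_of_mem _ hp, by simpa using h0⟩, by simp⟩
  · exact .inl ⟨he, p, hp, h0⟩

theorem rising_neg (L : LineFamily n) : L.neg.rising = L.falling := by
  ext; simp [rising, falling]

theorem falling_neg (L : LineFamily n) : L.neg.falling = L.rising := by
  ext; simp [rising, falling]

theorem rising_rev (L : LineFamily n) : L.rev.rising = L.falling := by
  ext; simp [rising, falling]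

theorem falling_rev (L : LineFamily n) : L.rev.falling = L.rising := by
  ext; simp [rising, falling]

theorem encard_rising_add_falling_le (L : LineFamily n) :
    L.rising.encard + L.falling.encard ≤ n := by
  rw [← encard_union_eq]
  · refine (encard_le_encard (subset_univ _)).trans ?_
    rw [encard_univ]; simp
  · rw [disjoint_left]
    intro i h1 h2
    exact lt_asymm (a := L.slope i) (b := 0) h2 h1

/-- The zone of the axis has at most `6 n` edges. -/
theorem encard_clippedZoneEdges_le (hd : L.Distinct) (hn : L.NoHorizontal) :
    L.clippedZoneEdges.encard ≤ 6 * n := by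
  have hsub : L.clippedZoneEdges ⊆ {e | L.IsZoneEdge univ univ e} := by
    rintro e ⟨⟨p, hp, rfl⟩, F, ⟨⟨q, hq, rfl⟩, hax⟩, heF⟩
    refine ⟨⟨p, ⟨hp, mem_univ _⟩, by simp⟩, _, isPreconnected_connectedComponentIn,
      fun r hr _ => (connectedComponentIn_subset _ _ hr).2, hax, heF⟩
  refine (encard_le_encard hsub).trans <| (encard_isZoneEdge_le hn univ univ).trans ?_
  simp only [preimage_univ]
  refine (add_le_add (add_le_add (encard_isZoneEdge_onRise_le hd hn)
    (encard_isZoneEdge_onRise_le hd.rev hn.rev)) (add_le_add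
    (encard_isZoneEdge_onRise_le hd.neg hn.neg)
    (encard_isZoneEdge_onRise_le hd.neg.rev hn.neg.rev))).trans ?_
  rw [rising_rev, falling_rev, rising_rev, falling_rev, rising_neg, falling_neg]
  calc _ = 6 * (L.rising.encard + L.falling.encard) := by ring
    _ ≤ 6 * n := mul_le_mul_right (encard_rising_add_falling_le L) _

/-- In a slab, at most `20 n` edges bound faces that reach the axis inside or outside the slab. -/
theorem encard_isZoneEdge_slab_le (hd : L.Distinct) (hn : L.NoHorizontal) (a b : ℝ) :
    {e | L.IsZoneEdge (Icc a b) (Ioo a b) e}.encard ≤ 20 * n := by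
  have h := encard_isZoneEdge_le hn (Icc a b) (Ioo a b)
  rw [show (Neg.neg ⁻¹' Icc a b : Set ℝ) = Icc (-b) (-a) by simp,
    show (Neg.neg ⁻¹' Ioo a b : Set ℝ) = Ioo (-b) (-a) by simp] at h
  refine h.trans <| (add_le_add (add_le_add (encard_isZoneEdge_slab_onRise_le hd hn a b)
    (encard_isZoneEdge_slab_onRise_le hd.rev hn.rev _ _)) (add_le_add
    (encard_isZoneEdge_slab_onRise_le hd.neg hn.neg a b)
    (encard_isZoneEdge_slab_onRise_le hd.neg.rev hn.neg.rev _ _))).trans ?_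
  rw [rising_rev, falling_rev, rising_rev, falling_rev, rising_neg, falling_neg]
  calc _ = 20 * (L.rising.encard + L.falling.encard) := by ring
    _ ≤ 20 * n := mul_le_mul_right (encard_rising_add_falling_le L) _

end LineFamily

end CentralTrajectory

namespace CentralTrajectory

/-! ### Trajectoids without gap -/

section Trajectoid

variable {n : ℕ} {pos : Fin n → ℝ → ℝ} {a b t : ℝ} {T : ℝ → Fin n}

theorem epsConnected_zero_iff {σ ψ : Fin n} :
    EpsConnected pos 0 t σ ψ ↔ pos σ t = pos ψ t := by
  constructor
  · intro h
    induction h with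
    | refl => rfl
    | tail _ h ih => rw [ih]; exact sub_eq_zero.1 (abs_nonpos_iff.1 h)
  · intro h
    exact Relation.ReflTransGen.single (by simp [h])

theorem IsTrajectoid.continuousOn (hpos : ∀ σ, ContinuousOn (pos σ) (Icc a b))
    (hT : IsTrajectoid pos 0 a b T) : ContinuousOn (fun t => pos (T t) t) (Icc a b) := by
  intro t ht U hU
  have : ∀ σ, ∀ᶠ s in 𝓝[Icc a b] t, T s = σ → pos σ s ∈ U := by
    intro σ
    by_cases hf : ∃ᶠ s in 𝓝[Icc a b] t, T s = σ
    · have hσ := epsConnected_zero_iff.1 (hT t ht σ hf)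
      simp only [hσ] at hU
      filter_upwards [hpos σ t ht hU] with s hs _ using hs
    · rw [not_frequently] at hf
      filter_upwards [hf] with s hs h using (hs h).elim
  have h := eventually_all.2 this
  exact mem_map.2 (h.mono fun s hs => hs (T s) rfl)

theorem isTrajectoid_of_continuousOn (hpos : ∀ σ, ContinuousOn (pos σ) (Icc a b))
    (hT : ContinuousOn (fun t => pos (T t) t) (Icc a b)) : IsTrajectoid pos 0 a b T := by
  intro t ht σ hf
  rw [epsConnected_zero_iff]
  have : (𝓝[Icc a b] t ⊓ 𝓟 {s | T s = σ}).NeBot := frequently_mem_iff_neBot.1 hf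
  refine tendsto_nhds_unique ((hT t ht).tendsto.mono_left
    (inf_le_left (b := 𝓟 {s | T s = σ}))) ?_
  refine ((hpos σ t ht).tendsto.mono_left (inf_le_left (b := 𝓟 {s | T s = σ}))).congr' ?_
  filter_upwards [mem_inf_of_right (mem_principal_self _)] with s hs
  have hs' : T s = σ := hs
  rw [hs']

theorem IsTrajectoid.eventually_eq (hT : IsTrajectoid pos 0 a b T) (ht : t ∈ Ioo a b)
    (hne : ∀ σ ψ, pos σ t = pos ψ t → σ = ψ) : ∀ᶠ s in 𝓝 t, T s = T t := by
  rw [← nhdsWithin_eq_nhds.2 (Icc_mem_nhds ht.1 ht.2)]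
  have : ∀ σ, ∀ᶠ s in 𝓝[Icc a b] t, T s = σ → σ = T t := by
    intro σ
    by_cases hf : ∃ᶠ s in 𝓝[Icc a b] t, T s = σ
    · have hσ := epsConnected_zero_iff.1 (hT t ⟨ht.1.le, ht.2.le⟩ σ hf)
      exact Eventually.of_forall fun _ _ => (hne _ _ hσ).symm
    · rw [not_frequently] at hf
      filter_upwards [hf] with s hs h using (hs h).elim
  filter_upwards [eventually_all.2 this] with s hs using hs (T s) rfl

/-- A trajectoid changes its entity only where two entities meet. -/
theorem IsTrajectoid.exists_meet (hT : IsTrajectoid pos 0 a b T) (ht : t ∈ breakTimes T a b) :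
    ∃ σ ψ, σ ≠ ψ ∧ pos σ t = pos ψ t := by
  by_contra! hcon
  refine ht.2 ⟨T t, (hT.eventually_eq ht.1 fun σ ψ h => ?_).filter_mono nhdsWithin_le_nhds⟩
  by_contra hne
  exact hcon σ ψ hne h

end Trajectoid

namespace LineFamily

variable {n : ℕ} {L : LineFamily n} {i j k l m : Fin n} {a b s t u v w x y : ℝ} {T : ℝ → Fin n}

/-! ### Area-minimal trajectoids -/

theorem continuousOn_of_isTrajectoid (hT : IsTrajectoid L.eval 0 a b T) :
    ContinuousOn (fun t => L.eval (T t) t) (Icc a b) :=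
  hT.continuousOn fun σ => (L.continuous_eval σ).continuousOn

theorem isAreaMinimal_neg (hT : IsAreaMinimal L.eval 0 a b T) :
    IsAreaMinimal L.neg.eval 0 a b T := by
  have key : ∀ S, IsTrajectoid L.neg.eval 0 a b S ↔ IsTrajectoid L.eval 0 a b S := by
    intro S
    unfold IsTrajectoid
    simp only [epsConnected_zero_iff, eval_neg, neg_inj]
  refine ⟨(key T).2 hT.1, fun S hS => ?_⟩
  simpa only [eval_neg, abs_neg] using hT.2 S ((key S).1 hS)

/-- An area-minimal trajectoid stays below every path of nonnegative height, made of pieces of the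
lines, that it does not surpass at the ends: otherwise following the lower one of both would give
a smaller area. The end points of the whole time span are free. -/
theorem le_of_isAreaMinimal (hab : a < b) (hT : IsAreaMinimal L.eval 0 a b T) {g : ℝ → ℝ}
    {c d : ℝ} (hac : a ≤ c) (hcd : c ≤ d) (hdb : d ≤ b) (hg : ContinuousOn g (Icc c d))
    (hsel : ∀ t ∈ Icc c d, ∃ i, g t = L.eval i t) (h0 : ∀ t ∈ Icc c d, 0 ≤ g t)
    (hc : c = a ∨ L.eval (T c) c ≤ g c) (hd : d = b ∨ L.eval (T d) d ≤ g d) :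
    ∀ t ∈ Icc c d, L.eval (T t) t ≤ g t := by
  classical
  set f : ℝ → ℝ := fun t => L.eval (T t) t with hf
  have hfc : ContinuousOn f (Icc a b) := continuousOn_of_isTrajectoid hT.1
  set h : ℝ → ℝ := fun t => if t ∈ Icc c d then min (f t) (g t) else f t with hh
  have hin : ∀ t ∈ Icc c d, h t = min (f t) (g t) := fun t ht => if_pos ht
  have hout : ∀ t, t ∉ Icc c d → h t = f t := fun t ht => if_neg ht
  have hS : ∀ t, ∃ i, L.eval i t = h t := by
    intro t
    by_cases ht : t ∈ Icc c d
    · rw [hin t ht]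
      rcases min_choice (f t) (g t) with hm | hm
      · exact ⟨T t, hm.symm⟩
      · obtain ⟨i, hi⟩ := hsel t ht; exact ⟨i, by rw [hm, hi]⟩
    · exact ⟨T t, (hout t ht).symm⟩
  choose S hS using hS
  have hcont1 : ContinuousOn h (Icc a c) := by
    rcases hc with rfl | hc
    · rw [Icc_self]; exact continuousOn_singleton _ _
    · refine (hfc.mono (Icc_subset_Icc le_rfl (hcd.trans hdb))).congr fun t ht => ?_
      rcases ht.2.eq_or_lt with rfl | hlt
      · rw [hin t ⟨le_rfl, hcd⟩]; exact min_eq_left hc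
      · exact hout t fun h => not_le.2 hlt h.1
  have hcont2 : ContinuousOn h (Icc c d) :=
    ((hfc.mono (Icc_subset_Icc hac hdb)).inf hg).congr hin
  have hcont3 : ContinuousOn h (Icc d b) := by
    rcases hd with rfl | hd
    · rw [Icc_self]; exact continuousOn_singleton _ _
    · refine (hfc.mono (Icc_subset_Icc (hac.trans hcd) le_rfl)).congr fun t ht => ?_
      rcases ht.1.eq_or_lt with rfl | hlt
      · rw [hin d ⟨hcd, le_rfl⟩]; exact min_eq_left hd
      · exact hout t fun h => not_le.2 hlt h.2
  have hcont : ContinuousOn h (Icc a b) := by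
    have := (hcont1.union_of_isClosed hcont2 isClosed_Icc isClosed_Icc).union_of_isClosed hcont3
      (isClosed_Icc.union isClosed_Icc) isClosed_Icc
    rwa [Icc_union_Icc_eq_Icc hac hcd, Icc_union_Icc_eq_Icc (hac.trans hcd) hdb] at this
  have hSt : IsTrajectoid L.eval 0 a b S :=
    isTrajectoid_of_continuousOn (fun σ => (L.continuous_eval σ).continuousOn)
      (hcont.congr fun t _ => hS t)
  have hle : ∀ t, |h t| ≤ |f t| := by
    intro t
    by_cases ht : t ∈ Icc c d
    · rw [hin t ht]
      rcases le_total (f t) (g t) with hfg | hfg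
      · rw [min_eq_left hfg]
      · rw [min_eq_right hfg, abs_of_nonneg (h0 t ht), abs_of_nonneg ((h0 t ht).trans hfg)]
        exact hfg
    · rw [hout t ht]
  intro t ht
  by_contra! hlt
  have hlt' : |h t| < |f t| := by
    rw [hin t ht, min_eq_right (show g t ≤ f t from hlt.le), abs_of_nonneg (h0 t ht),
      abs_of_nonneg ((h0 t ht).trans hlt.le)]
    exact hlt
  have := intervalIntegral.integral_lt_integral_of_continuousOn_of_le_of_exists_lt hab hcont.abs
    hfc.abs (fun t _ => hle t) ⟨t, ⟨hac.trans ht.1, ht.2.trans hdb⟩, hlt'⟩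
  have h2 := hT.2 S hSt
  simp only [hS] at h2
  exact absurd this (not_lt.2 h2)

theorem le_eval_of_isAreaMinimal (hab : a < b) (hT : IsAreaMinimal L.eval 0 a b T)
    {c d : ℝ} (hac : a ≤ c) (hcd : c ≤ d) (hdb : d ≤ b) (i : Fin n)
    (h0c : 0 ≤ L.eval i c) (h0d : 0 ≤ L.eval i d)
    (hc : c = a ∨ L.eval (T c) c ≤ L.eval i c) (hd : d = b ∨ L.eval (T d) d ≤ L.eval i d)
    (ht : t ∈ Icc c d) : L.eval (T t) t ≤ L.eval i t := by
  refine le_of_isAreaMinimal hab hT hac hcd hdb (L.continuous_eval i).continuousOn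
    (fun t _ => ⟨i, rfl⟩) (fun t ht => ?_) hc hd t ht
  rcases le_total 0 (L.slope i) with hs | hs
  · have := L.eval_sub i t c
    nlinarith [ht.1]
  · have := L.eval_sub i t d
    nlinarith [ht.2]

/-- An area-minimal trajectoid is nowhere above a wedge. -/
theorem notMem_wedge_of_isAreaMinimal (hab : a < b) (hT : IsAreaMinimal L.eval 0 a b T)
    (ht : t ∈ Icc a b) : (t, L.eval (T t) t) ∉ L.wedge := by
  rintro ⟨i, j, hi, hj, hij, h1, h2⟩
  have := le_of_isAreaMinimal hab hT le_rfl hab.le le_rfl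
    (g := fun t => max (L.eval i t) (L.eval j t))
    ((L.continuous_eval i).max (L.continuous_eval j)).continuousOn
    (fun t _ => by
      rcases max_choice (L.eval i t) (L.eval j t) with h | h
      · exact ⟨i, h⟩
      · exact ⟨j, h⟩)
    (fun t _ => by
      rcases le_total (L.root i) t with h | h
      · exact le_max_of_le_left ((eval_nonneg_iff_of_rising hi).2 h)
      · exact le_max_of_le_right ((eval_nonneg_iff_of_falling hj).2 (h.trans hij)))
    (.inl rfl) (.inl rfl) t ht
  rcases le_max_iff.1 this with h | h
  · exact absurd h1 (not_lt.2 h)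
  · exact absurd h2 (not_lt.2 h)

/-! ### Turns of a trajectoid -/

/-- At time `t`, inside the time span `[a, b]`, the trajectoid comes along line `i` and leaves
along line `k`. -/
def Turn (T : ℝ → Fin n) (a b t : ℝ) (i k : Fin n) : Prop :=
  t ∈ Ioo a b ∧ (∀ᶠ s in 𝓝[<] t, T s = i) ∧ ∀ᶠ s in 𝓝[>] t, T s = k

theorem eventually_ne (hd : L.Distinct) (t : ℝ) :
    ∀ᶠ s in 𝓝[≠] t, ∀ i k, L.eval i s = L.eval k s → i = k := by
  rw [eventually_all]; intro i
  rw [eventually_all]; intro k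
  by_cases hik : i = k
  · simp [hik]
  by_cases he : L.eval i t = L.eval k t
  · filter_upwards [self_mem_nhdsWithin] with s hs h
    exact hd.eq_of_eval_eval hs h he
  · have : ∀ᶠ s in 𝓝 t, L.eval i s ≠ L.eval k s :=
      ((isOpen_ne_fun (L.continuous_eval i) (L.continuous_eval k)).mem_nhds he)
    filter_upwards [this.filter_mono nhdsWithin_le_nhds] with s hs h using (hs h).elim

theorem exists_turn (hd : L.Distinct) (hT : IsTrajectoid L.eval 0 a b T) (ht : t ∈ Ioo a b) :
    ∃ i k, Turn T a b t i k := by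
  have hconst : ∀ c d, (∀ s ∈ Ioo c d, s ∈ Ioo a b ∧ ∀ i k, L.eval i s = L.eval k s → i = k) →
      ∀ s ∈ Ioo c d, ∀ r ∈ Ioo c d, T s = T r := by
    intro c d h s hs r hr
    refine isPreconnected_Ioo.constant (f := T) (fun q hq => ?_) hs hr
    refine ContinuousAt.continuousWithinAt ?_
    exact continuousAt_const.congr (EventuallyEq.symm (hT.eventually_eq (h q hq).1 (h q hq).2))
  have hev := eventually_ne hd t
  have hleft := hev.filter_mono (nhdsWithin_mono t (fun s (hs : s < t) => hs.ne))
  have hright := hev.filter_mono (nhdsWithin_mono t (fun s (hs : t < s) => hs.ne'))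
  obtain ⟨c, hc, hcs⟩ := (mem_nhdsLT_iff_exists_Ioo_subset' ht.1).1
    (inter_mem hleft (Ioo_mem_nhdsLT ht.1))
  obtain ⟨d, hd', hds⟩ := (mem_nhdsGT_iff_exists_Ioo_subset' ht.2).1
    (inter_mem hright (Ioo_mem_nhdsGT ht.2))
  obtain ⟨c', hc'⟩ := exists_between (show c < t from hc)
  obtain ⟨d', hd''⟩ := exists_between (show t < d from hd')
  refine ⟨T c', T d', ht, ?_, ?_⟩
  · filter_upwards [Ioo_mem_nhdsLT (show c < t from hc)] with s hs
    exact hconst c t (fun s hs => ⟨⟨(hcs hs).2.1, (hcs hs).2.2.trans ht.2⟩, (hcs hs).1⟩) s hs c'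
      ⟨hc'.1, hc'.2⟩
  · filter_upwards [Ioo_mem_nhdsGT (show t < d from hd')] with s hs
    exact hconst t d (fun s hs => ⟨⟨ht.1.trans (hds hs).2.1, (hds hs).2.2⟩, (hds hs).1⟩) s hs d'
      ⟨hd''.1, hd''.2⟩

theorem Turn.ne (h : Turn T a b t i k) (ht : t ∈ breakTimes T a b) : i ≠ k := by
  rintro rfl
  refine ht.2 ⟨i, ?_⟩
  rw [← nhdsLT_sup_nhdsGT, eventually_sup]
  exact ⟨h.2.1, h.2.2⟩

theorem Turn.exists_left (h : Turn T a b t i k) (hut : u < t) : ∃ s ∈ Ioo u t, T s = i := by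
  obtain ⟨s, hs, hs'⟩ := (h.2.1.and (Ioo_mem_nhdsLT hut)).exists
  exact ⟨s, hs', hs⟩

theorem Turn.exists_right (h : Turn T a b t i k) (htu : t < u) : ∃ s ∈ Ioo t u, T s = k := by
  obtain ⟨s, hs, hs'⟩ := (h.2.2.and (Ioo_mem_nhdsGT htu)).exists
  exact ⟨s, hs', hs⟩

theorem Turn.eval_left (hT : IsTrajectoid L.eval 0 a b T) (h : Turn T a b t i k) :
    L.eval (T t) t = L.eval i t := by
  have hc : ContinuousAt (fun t => L.eval (T t) t) t :=
    (continuousOn_of_isTrajectoid hT).continuousAt (Icc_mem_nhds h.1.1 h.1.2)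
  refine tendsto_nhds_unique (hc.tendsto.mono_left (nhdsWithin_le_nhds (s := Iio t))) ?_
  refine ((L.continuous_eval i).tendsto t |>.mono_left nhdsWithin_le_nhds).congr' ?_
  filter_upwards [h.2.1] with s hs
  rw [hs]

theorem Turn.eval_right (hT : IsTrajectoid L.eval 0 a b T) (h : Turn T a b t i k) :
    L.eval (T t) t = L.eval k t := by
  have hc : ContinuousAt (fun t => L.eval (T t) t) t :=
    (continuousOn_of_isTrajectoid hT).continuousAt (Icc_mem_nhds h.1.1 h.1.2)
  refine tendsto_nhds_unique (hc.tendsto.mono_left (nhdsWithin_le_nhds (s := Ioi t))) ?_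
  refine ((L.continuous_eval k).tendsto t |>.mono_left nhdsWithin_le_nhds).congr' ?_
  filter_upwards [h.2.2] with s hs
  rw [hs]

/-- The turns above the axis from line `i` to line `k` with `P i k`. -/
def upperTurns (L : LineFamily n) (T : ℝ → Fin n) (a b : ℝ) (P : Fin n → Fin n → Prop) : Set ℝ :=
  {t | 0 < L.eval (T t) t ∧ ∃ i k, i ≠ k ∧ Turn T a b t i k ∧ P i k}

theorem encard_fallRise_le (hab : a < b) (hT : IsAreaMinimal L.eval 0 a b T) :
    (L.upperTurns T a b fun i k => L.slope i < 0 ∧ 0 < L.slope k).encard ≤ L.falling.encard := by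
  -- between two such turns away from line `i`, the trajectoid would be above `i`
  have key : ∀ {i k k' : Fin n} {t t' : ℝ}, 0 < L.eval (T t) t → 0 < L.eval (T t') t' →
      Turn T a b t i k → Turn T a b t' i k' → L.slope i < 0 → 0 < L.slope k → t < t' → False := by
    intro i k k' t t' h0 h0' h h' hi hk htt
    obtain ⟨s, hs, hsk⟩ := h.exists_right htt
    have e1 := h.eval_left hT.1
    have e2 := h.eval_right hT.1
    have e1' := h'.eval_left hT.1
    have := le_eval_of_isAreaMinimal hab hT h.1.1.le htt.le h'.1.2.le i (e1 ▸ h0.le)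
      (e1' ▸ h0'.le) (.inr e1.le) (.inr e1'.le) ⟨hs.1.le, hs.2.le⟩
    rw [hsk] at this
    exact absurd (eval_lt_eval_of_slope_lt (e1.symm.trans e2) (hi.trans hk) hs.1) (not_lt.2 this)
  refine encard_le_of_charge (fun t i => ∃ k, Turn T a b t i k ∧ L.slope i < 0 ∧ 0 < L.slope k)
    ?_ ?_
  · rintro t ⟨_, i, k, _, h, h1, h2⟩; exact ⟨i, h1, k, h, h1, h2⟩
  · rintro t ⟨h0, _⟩ t' ⟨h0', _⟩ i ⟨k, h, h1, h2⟩ ⟨k', h', h1', h2'⟩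
    rcases lt_trichotomy t t' with htt | htt | htt
    · exact (key h0 h0' h h' h1 h2 htt).elim
    · exact htt
    · exact (key h0' h0 h' h h1 h2' htt).elim

theorem encard_riseRise_le (hd : L.Distinct) (hab : a < b) (hT : IsAreaMinimal L.eval 0 a b T) :
    (L.upperTurns T a b fun i k => 0 < L.slope i ∧ 0 < L.slope k).encard ≤ L.rising.encard := by
  -- once on a rising line above the axis, the trajectoid never gets above this line again
  have hstay : ∀ {i : Fin n} {t s : ℝ}, 0 < L.eval (T t) t → t ∈ Ioo a b →
      L.eval (T t) t = L.eval i t → 0 < L.slope i → t ≤ s → s ≤ b →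
      L.eval (T s) s ≤ L.eval i s := by
    intro i t s h0 ht he hi hts hsb
    exact le_eval_of_isAreaMinimal hab hT ht.1.le ht.2.le le_rfl i (he ▸ h0.le)
      ((he ▸ h0.le).trans (eval_lt_eval_of_rising hi ht.2).le) (.inr he.le) (.inl rfl) ⟨hts, hsb⟩
  have key : ∀ {i k k' : Fin n} {t t' : ℝ}, 0 < L.eval (T t) t → i ≠ k →
      Turn T a b t i k → Turn T a b t' i k' → 0 < L.slope i → 0 < L.slope k → t < t' → False := by
    intro i k k' t t' h0 hik h h' hi hk htt
    have e1 := h.eval_left hT.1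
    have e2 := h.eval_right hT.1
    have e1' := h'.eval_left hT.1
    have hs : L.slope k < L.slope i := by
      obtain ⟨s, hs, hsk⟩ := h.exists_right h.1.2
      have := hstay h0 h.1 e1 hi hs.1.le hs.2.le
      rw [hsk] at this
      rcases lt_trichotomy (L.slope k) (L.slope i) with h' | h' | h'
      · exact h'
      · exact (hik (hd.eq_of_eval h'.symm (e1.symm.trans e2))).elim
      · exact absurd (eval_lt_eval_of_slope_lt (e1.symm.trans e2) h' hs.1) (not_lt.2 this)
    have := hstay h0 h.1 e2 hk htt.le h'.1.2.le
    rw [e1'] at this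
    exact absurd (eval_lt_eval_of_slope_lt (e2.symm.trans e1) hs htt) (not_lt.2 this)
  refine encard_le_of_charge (fun t i => ∃ k, i ≠ k ∧ Turn T a b t i k ∧ 0 < L.slope i ∧
    0 < L.slope k) ?_ ?_
  · rintro t ⟨_, i, k, h⟩; exact ⟨i, h.2.2.1, k, h⟩
  · rintro t ⟨h0, _⟩ t' ⟨h0', _⟩ i ⟨k, hik, h, h1, h2⟩ ⟨k', hik', h', h1', h2'⟩
    rcases lt_trichotomy t t' with htt | htt | htt
    · exact (key h0 hik h h' h1 h2 htt).elim
    · exact htt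
    · exact (key h0' hik' h' h h1 h2' htt).elim

theorem encard_fallFall_le (hd : L.Distinct) (hab : a < b) (hT : IsAreaMinimal L.eval 0 a b T) :
    (L.upperTurns T a b fun i k => L.slope i < 0 ∧ L.slope k < 0).encard ≤ L.falling.encard := by
  -- before being on a falling line above the axis, the trajectoid was never above this line
  have hstay : ∀ {i : Fin n} {t s : ℝ}, 0 < L.eval (T t) t → t ∈ Ioo a b →
      L.eval (T t) t = L.eval i t → L.slope i < 0 → s ≤ t → a ≤ s →
      L.eval (T s) s ≤ L.eval i s := by
    intro i t s h0 ht he hi hts hsb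
    exact le_eval_of_isAreaMinimal hab hT le_rfl ht.1.le ht.2.le i
      ((he ▸ h0.le).trans (eval_lt_eval_of_falling hi ht.1).le) (he ▸ h0.le) (.inl rfl)
      (.inr he.le) ⟨hsb, hts⟩
  have key : ∀ {i i' k : Fin n} {t t' : ℝ}, 0 < L.eval (T t') t' → i' ≠ k →
      Turn T a b t i k → Turn T a b t' i' k → L.slope i' < 0 → L.slope k < 0 → t < t' →
      False := by
    intro i i' k t t' h0 hik h h' hi hk htt
    have e2 := h.eval_right hT.1
    have e1' := h'.eval_left hT.1
    have e2' := h'.eval_right hT.1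
    have hs : L.slope k < L.slope i' := by
      obtain ⟨s, hs, hsk⟩ := h'.exists_left h'.1.1
      have := hstay h0 h'.1 e2' hk hs.2.le hs.1.le
      rw [hsk] at this
      rcases lt_trichotomy (L.slope k) (L.slope i') with h'' | h'' | h''
      · exact h''
      · exact (hik (hd.eq_of_eval h''.symm (e1'.symm.trans e2'))).elim
      · exact absurd (eval_lt_eval_of_slope_gt (e2'.symm.trans e1') h'' hs.2) (not_lt.2 this)
    have := hstay h0 h'.1 e1' hi htt.le h.1.1.le
    rw [e2] at this
    exact absurd (eval_lt_eval_of_slope_gt (e1'.symm.trans e2') hs htt) (not_lt.2 this)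
  refine encard_le_of_charge (fun t k => ∃ i, i ≠ k ∧ Turn T a b t i k ∧ L.slope i < 0 ∧
    L.slope k < 0) ?_ ?_
  · rintro t ⟨_, i, k, h⟩; exact ⟨k, h.2.2.2, i, h⟩
  · rintro t ⟨h0, _⟩ t' ⟨h0', _⟩ k ⟨i, hik, h, h1, h2⟩ ⟨i', hik', h', h1', h2'⟩
    rcases lt_trichotomy t t' with htt | htt | htt
    · exact (key h0' hik' h h' h1' h2 htt).elim
    · exact htt
    · exact (key h0 hik h' h h1 h2 htt).elim

/-- The times at which a trajectoid reaches the axis along a falling line. -/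
def fallingHits (L : LineFamily n) (T : ℝ → Fin n) (a b : ℝ) : Set ℝ :=
  {t | L.eval (T t) t = 0 ∧ ∃ i k, Turn T a b t i k ∧ L.slope i < 0}

theorem encard_fallingHits_le (hT : IsTrajectoid L.eval 0 a b T) :
    (L.fallingHits T a b).encard ≤ L.falling.encard := by
  refine encard_le_of_charge (fun t i => ∃ k, Turn T a b t i k ∧ L.slope i < 0) ?_ ?_
  · rintro t ⟨_, i, k, h⟩; exact ⟨i, h.2, k, h⟩
  · rintro t ⟨h0, _⟩ t' ⟨h0', _⟩ i ⟨k, h, h1⟩ ⟨k', h', _⟩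
    rw [h.eval_left hT, eval_eq_zero_iff h1.ne] at h0
    rw [h'.eval_left hT, eval_eq_zero_iff h1.ne] at h0'
    rw [h0, h0']

/-- After a turn from a rising to a falling line, the piece on the falling line ends at another
kind of turn, on the axis, or at the end of the time span. -/
theorem exists_end_of_riseFall (hd : L.Distinct) (hn : L.NoHorizontal)
    (hT : IsTrajectoid L.eval 0 a b T) (h0 : 0 < L.eval (T t) t) (h : Turn T a b t i k)
    (hk : L.slope k < 0) :
    ∃ e, t < e ∧ (∀ s ∈ Icc t e, L.eval (T s) s = L.eval k s) ∧
      (e ∈ (L.upperTurns T a b fun i k => L.slope i < 0 ∧ 0 < L.slope k) ∨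
        e ∈ (L.upperTurns T a b fun i k => L.slope i < 0 ∧ L.slope k < 0) ∨
        e ∈ L.fallingHits T a b ∨ e = b) := by
  have hfc := continuousOn_of_isTrajectoid hT
  have hpos : ∀ {r : ℝ}, t ≤ r → r < b → 0 < L.eval k r → (∀ᶠ s in 𝓝[>] r, T s = k) →
      ∃ q, r < q ∧ q ≤ b ∧ ∀ s ∈ Ioc r q, L.eval (T s) s = L.eval k s ∧ 0 ≤ L.eval k s := by
    intro r htr hrb hr hev
    have h1 : ∀ᶠ s in 𝓝[>] r, 0 < L.eval k s :=
      ((L.continuous_eval k).tendsto r).eventually (lt_mem_nhds hr)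
        |>.filter_mono nhdsWithin_le_nhds
    obtain ⟨d, hd', hds⟩ := (mem_nhdsGT_iff_exists_Ioo_subset' hrb).1
      (inter_mem (hev.and h1) (Ioo_mem_nhdsGT hrb))
    obtain ⟨q, hq⟩ := exists_between (show r < d from hd')
    refine ⟨q, hq.1, (hds hq).2.2.le, fun s hs => ?_⟩
    have := hds ⟨hs.1, hs.2.trans_lt hq.2⟩
    exact ⟨by rw [this.1.1], this.1.2.le⟩
  have et := h.eval_right hT
  -- the longest piece of line `k` above the axis that starts at time `t`
  set A : Set ℝ := {s | s ∈ Icc t b ∧ L.eval (T s) s - L.eval k s = 0 ∧ 0 ≤ L.eval k s} with hA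
  have hAc : IsClosed A := by
    have h1 : IsClosed (Icc t b ∩ (fun s => L.eval (T s) s - L.eval k s) ⁻¹' {0}) :=
      ((hfc.mono (Icc_subset_Icc h.1.1.le le_rfl)).sub
        (L.continuous_eval k).continuousOn).preimage_isClosed_of_isClosed isClosed_Icc
        isClosed_singleton
    have h2 : IsClosed {s | 0 ≤ L.eval k s} := isClosed_le continuous_const (L.continuous_eval k)
    convert h1.inter h2 using 1
    ext s; simp [hA, and_assoc]
  set Z : Set ℝ := {s | s ∈ Icc t b ∧ Icc t s ⊆ A} with hZ
  have htA : t ∈ A := ⟨⟨le_rfl, h.1.2.le⟩, by rw [et, sub_self], et ▸ h0.le⟩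
  have htZ : t ∈ Z := ⟨⟨le_rfl, h.1.2.le⟩, by rw [Icc_self]; simpa using htA⟩
  have hbdd : BddAbove Z := ⟨b, fun s hs => hs.1.2⟩
  set e := sSup Z with he
  have hte : t ≤ e := le_csSup hbdd htZ
  have heb : e ≤ b := csSup_le ⟨t, htZ⟩ fun s hs => hs.1.2
  have hIco : Ico t e ⊆ A := by
    intro s hs
    obtain ⟨z, hz, hsz⟩ := exists_lt_of_lt_csSup ⟨t, htZ⟩ hs.2
    exact hz.2 ⟨hs.1, hsz.le⟩
  have hIcc : Icc t e ⊆ A := by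
    rcases hte.eq_or_lt with hte' | hte'
    · rw [← hte', Icc_self]; simpa using htA
    · rw [← closure_Ico hte'.ne]; exact closure_minimal hIco hAc
  have hext : e < b → 0 < L.eval k e → ¬ ∀ᶠ s in 𝓝[>] e, T s = k := by
    intro heb' h0' hev
    obtain ⟨q, hq, hqb, hqs⟩ := hpos hte heb' h0' hev
    have : q ∈ Z := by
      refine ⟨⟨hte.trans hq.le, hqb⟩, fun s hs => ?_⟩
      rcases le_or_gt s e with hse | hse
      · exact hIcc ⟨hs.1, hse⟩
      · have := hqs s ⟨hse, hs.2⟩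
        exact ⟨⟨hs.1, hs.2.trans hqb⟩, by rw [this.1, sub_self], this.2⟩
    exact absurd (le_csSup hbdd this) (not_le.2 hq)
  have hte' : t < e := by
    refine hte.lt_of_ne fun hne => hext ?_ ?_ ?_
    · rw [← hne]; exact h.1.2
    · rw [← hne, ← et]; exact h0
    · rw [← hne]; exact h.2.2
  have hfe : ∀ s ∈ Icc t e, L.eval (T s) s = L.eval k s := fun s hs => sub_eq_zero.1 (hIcc hs).2.1
  refine ⟨e, hte', hfe, ?_⟩
  rcases heb.eq_or_lt with heb' | heb'
  · exact .inr (.inr (.inr heb'))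
  obtain ⟨l, r, hlr⟩ := exists_turn hd hT ⟨h.1.1.trans hte', heb'⟩
  have hlk : l = k := by
    obtain ⟨s, hs, hsl⟩ := hlr.exists_left hte'
    have h1 := hfe s ⟨hs.1.le, hs.2.le⟩
    have h2 := hfe e ⟨hte, le_rfl⟩
    rw [hsl] at h1
    rw [hlr.eval_left hT] at h2
    exact hd.eq_of_eval_eval hs.2.ne h1 h2
  subst hlk
  have hee := hfe e ⟨hte, le_rfl⟩
  have h0e : 0 ≤ L.eval l e := (hIcc ⟨hte, le_rfl⟩).2.2
  rcases h0e.eq_or_lt with h0e' | h0e'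
  · exact .inr (.inr (.inl ⟨by rw [hee, ← h0e'], l, r, hlr, hk⟩))
  · have hne : l ≠ r := fun hlr' => hext heb' h0e' (hlr' ▸ hlr.2.2)
    rcases (hn r).lt_or_gt with hr | hr
    · exact .inr (.inl ⟨hee ▸ h0e', l, r, hne, hlr, hk, hr⟩)
    · exact .inl ⟨hee ▸ h0e', l, r, hne, hlr, hk, hr⟩

/-- A turn from a rising to a falling line is charged to the end of the piece on the falling line,
which is one of the events counted before or the time `b`. -/
theorem encard_riseFall_le (hd : L.Distinct) (hn : L.NoHorizontal) (hab : a < b)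
    (hT : IsAreaMinimal L.eval 0 a b T) :
    (L.upperTurns T a b fun i k => 0 < L.slope i ∧ L.slope k < 0).encard ≤
      3 * L.falling.encard + 1 := by
  have key : ∀ {i k i' k' : Fin n} {t t' e : ℝ}, Turn T a b t' i' k' → L.slope k < 0 →
      0 < L.slope i' →
      (∀ s ∈ Icc t e, L.eval (T s) s = L.eval k s) → t < t' → t' < e → False := by
    intro i k i' k' t t' e h' hk hi' hs htt hte
    -- just before `t'`, the trajectoid would be on the rising line `i'` and on the falling line `k`
    obtain ⟨s, hs1, hs2⟩ := h'.exists_left htt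
    have h1 := hs s ⟨hs1.1.le, (hs1.2.trans hte).le⟩
    have h2 := hs t' ⟨htt.le, hte.le⟩
    rw [hs2] at h1
    rw [h'.eval_left hT.1] at h2
    have := hd.eq_of_eval_eval hs1.2.ne h1 h2
    subst this
    exact lt_asymm hk hi'
  refine (encard_le_of_charge (P := (L.upperTurns T a b fun i k => L.slope i < 0 ∧ 0 < L.slope k) ∪
      ((L.upperTurns T a b fun i k => L.slope i < 0 ∧ L.slope k < 0) ∪
        (L.fallingHits T a b ∪ {b})))
      (fun t e => ∃ i k, Turn T a b t i k ∧ 0 < L.slope i ∧ L.slope k < 0 ∧ t < e ∧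
        ∀ s ∈ Icc t e, L.eval (T s) s = L.eval k s) ?_ ?_).trans ?_
  · rintro t ⟨h0, i, k, _, h, h1, h2⟩
    obtain ⟨e, hte, he, hmem⟩ := exists_end_of_riseFall hd hn hT.1 h0 h h2
    exact ⟨e, hmem, i, k, h, h1, h2, hte, he⟩
  · rintro t _ t' _ e ⟨i, k, h, h1, h2, hte, he⟩ ⟨i', k', h', h1', h2', hte', he'⟩
    rcases lt_trichotomy t t' with htt | htt | htt
    · exact (key (i := i) h' h2 h1' he htt hte').elim
    · exact htt
    · exact (key (i := i) h h2' h1 he' htt hte).elim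
  · refine (encard_union_le _ _).trans <| (add_le_add (encard_fallRise_le hab hT) <|
      (encard_union_le _ _).trans <| add_le_add (encard_fallFall_le hd hab hT) <|
      (encard_union_le _ _).trans <| add_le_add (encard_fallingHits_le hT.1)
        (encard_singleton b).le).trans (le_of_eq (by ring))

theorem encard_upper_breakTimes_le (hd : L.Distinct) (hn : L.NoHorizontal) (hab : a < b)
    (hT : IsAreaMinimal L.eval 0 a b T) :
    {t ∈ breakTimes T a b | 0 < L.eval (T t) t}.encard ≤
      L.rising.encard + 5 * L.falling.encard + 1 := by
  refine le_trans (encard_le_encard fun t ht => ?_) <| (encard_union_le _ _).trans <|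
    (add_le_add ((encard_union_le _ _).trans <| add_le_add (encard_riseRise_le hd hab hT)
      (encard_riseFall_le hd hn hab hT)) ((encard_union_le _ _).trans <|
      add_le_add (encard_fallRise_le hab hT) (encard_fallFall_le hd hab hT))).trans
      (le_of_eq (by ring))
  obtain ⟨i, k, h⟩ := exists_turn hd hT.1 ht.1.1
  have hik := h.ne ht.1
  rcases (hn i).lt_or_gt with hi | hi <;> rcases (hn k).lt_or_gt with hk | hk
  · exact .inr (.inr ⟨ht.2, i, k, hik, h, hi, hk⟩)
  · exact .inr (.inl ⟨ht.2, i, k, hik, h, hi, hk⟩)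
  · exact .inl (.inr ⟨ht.2, i, k, hik, h, hi, hk⟩)
  · exact .inl (.inl ⟨ht.2, i, k, hik, h, hi, hk⟩)

theorem encard_breakTimes_le_sq (hd : L.Distinct) (hT : IsTrajectoid L.eval 0 a b T) :
    (breakTimes T a b).encard ≤ (n ^ 2 : ℕ) := by
  refine (encard_le_of_charge (P := (univ : Set (Fin n × Fin n)))
    (fun t q => q.1 ≠ q.2 ∧ L.eval q.1 t = L.eval q.2 t) ?_ ?_).trans ?_
  · intro t ht
    obtain ⟨σ, ψ, h⟩ := hT.exists_meet ht
    exact ⟨(σ, ψ), mem_univ _, h⟩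
  · rintro t _ t' _ q ⟨hne, h⟩ ⟨_, h'⟩
    by_contra htt
    exact hne (hd.eq_of_eval_eval htt h h')
  · rw [encard_univ]; simp [sq]

/-- Breaks above and below the axis are counted by their turns, breaks on the axis by the lines that
cross it there. -/
theorem encard_breakTimes_le (hd : L.Distinct) (hn : L.NoHorizontal) (hab : a < b)
    (hT : IsAreaMinimal L.eval 0 a b T) : (breakTimes T a b).encard ≤ (7 * n + 2 : ℕ) := by
  have hzero : {t ∈ breakTimes T a b | L.eval (T t) t = 0}.encard ≤ n := by
    refine (encard_le_of_charge (P := (univ : Set (Fin n))) (fun t i => t = L.root i) ?_ ?_).trans ?_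
    · rintro t ⟨_, h⟩
      exact ⟨T t, mem_univ _, (eval_eq_zero_iff (hn _)).1 h⟩
    · rintro t _ t' _ i h h'
      rw [h, h']
    · rw [encard_univ]; simp
  have hup := encard_upper_breakTimes_le hd hn hab hT
  have hlo := encard_upper_breakTimes_le hd.neg hn.neg hab (isAreaMinimal_neg hT)
  simp only [eval_neg, Left.neg_pos_iff] at hlo
  rw [rising_neg, falling_neg] at hlo
  refine le_trans (encard_le_encard fun t ht => ?_) <| (encard_union_le _ _).trans <|
    (add_le_add ((encard_union_le _ _).trans <| add_le_add hup hlo) hzero).trans ?_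
  · rcases lt_trichotomy (L.eval (T t) t) 0 with h | h | h
    · exact .inl (.inr ⟨ht, h⟩)
    · exact .inr ⟨ht, h⟩
    · exact .inl (.inl ⟨ht, h⟩)
  · calc _ = 6 * (L.rising.encard + L.falling.encard) + 2 + (n : ℕ∞) := by ring
      _ ≤ 6 * (n : ℕ∞) + 2 + n := by
        gcongr; exact encard_rising_add_falling_le L
      _ = (7 * n + 2 : ℕ) := by push_cast; ring

/-- An area-minimal trajectoid has at most `8 n` vertices. For few lines this is due to the small
number of crossings. -/
theorem encard_vertices_isAreaMinimal_le (hd : L.Distinct) (hn : L.NoHorizontal) (hab : a < b)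
    (hT : IsAreaMinimal L.eval 0 a b T) :
    ({a, b} ∪ breakTimes T a b).encard ≤ (8 * n : ℕ) := by
  have h1 := encard_breakTimes_le hd hn hab hT
  have h2 := encard_breakTimes_le_sq hd hT.1
  have h3 : ({a, b} : Set ℝ).encard ≤ (2 : ℕ) := by simpa using (encard_pair hab.ne).le
  have hn0 : 0 < n := (T 0).pos
  refine (encard_union_le _ _).trans ?_
  rcases le_or_gt 4 n with h4 | h4
  · refine (add_le_add h3 h1).trans ?_
    rw [← Nat.cast_add, Nat.cast_le]; lia
  · refine (add_le_add h3 h2).trans ?_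
    rw [← Nat.cast_add, Nat.cast_le]
    interval_cases n <;> norm_num

end LineFamily

end CentralTrajectory

namespace CentralTrajectory

namespace LineFamily

variable {n : ℕ} {L : LineFamily n} {i j k m : Fin n} {a b c d s t u v w x y : ℝ} {T : ℝ → Fin n}

/-! ### Points below all wedges belong to the zone -/

theorem riseAlive_root (hi : 0 < L.slope i) : L.RiseAlive i (L.root i) :=
  ⟨hi, (eval_root hi.ne').ge, fun k hk hki => by
    rw [eval_root hi.ne']; exact (eval_nonneg_iff_of_rising hk).2 hki⟩

theorem fallAlive_root (hi : L.slope i < 0) : L.FallAlive i (L.root i) :=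
  ⟨hi, (eval_root hi.ne).ge, fun k hk hki => by
    rw [eval_root hi.ne]; exact (eval_nonneg_iff_of_falling hk).2 hki⟩

/-- Sufficient conditions on `x` for the segment from `(x, 0)` to a point `(t, y)` to avoid the
clipped half-lines that rise: the chains of these half-lines that pass below the point start to the
right of `x`, those that pass above it start to the left. -/
theorem eval_ne_of_riseAlive_segment (hp : (t, y) ∉ L.support) (hy : 0 < y)
    (hx1 : ∀ k, 0 < L.slope k → L.eval k t < y → x < L.root k)
    (hx2 : ∀ i, 0 < L.slope i → y < L.eval i t →
      (∀ k, 0 < L.slope k → L.root k ≤ L.root i → y ≤ L.eval k t) → L.root i < x)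
    {c : ℝ} (hc0 : 0 ≤ c) (hc1 : c ≤ 1) (hi : L.RiseAlive i ((1 - c) * x + c * t)) :
    L.eval i ((1 - c) * x + c * t) ≠ c * y := by
  intro he
  have haff : ∀ k, L.eval k ((1 - c) * x + c * t) = (1 - c) * L.eval k x + c * L.eval k t := by
    intro k; unfold eval; ring
  by_cases hex : ∃ k, 0 < L.slope k ∧ L.root k ≤ L.root i ∧ L.eval k t < y
  · obtain ⟨k, hk, hki, hkt⟩ := hex
    have h1 := hi.2.2 k hk hki
    have h2 : L.eval k x < 0 := by
      by_contra! h
      exact absurd (hx1 k hk hkt) (not_lt.2 ((eval_nonneg_iff_of_rising hk).1 h))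
    rw [he, haff] at h1
    rcases hc0.eq_or_lt with rfl | hc0
    · linarith
    · nlinarith
  · push Not at hex
    have hiy := hex i hi.1 le_rfl
    rcases hiy.eq_or_lt with hiy | hiy
    · have : L.RiseAlive i t := ⟨hi.1, hiy ▸ hy.le, fun k hk hki => hiy ▸ hex k hk hki⟩
      exact hp (hiy ▸ this.mem_support)
    · have h2 : 0 < L.eval i x := (eval_pos_iff_of_rising hi.1).2 (hx2 i hi.1 hiy hex)
      rw [haff] at he
      rcases hc0.eq_or_lt with rfl | hc0
      · linarith
      · nlinarith

/-- A point above the axis that is on no clipped half-line and above no wedge sees the axis. -/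
theorem exists_segment (hn : L.NoHorizontal) (hp : (t, y) ∉ L.support) (hy : 0 < y)
    (hw : (t, y) ∉ L.wedge) :
    ∃ x, ∀ c ∈ Icc (0 : ℝ) 1, ((1 - c) * x + c * t, c * y) ∉ L.support := by
  classical
  -- `x` separates the starting points of the lines that pass left of the point from the starting
  -- points of those that pass right of it; their order is right because no wedge is below the point
  obtain ⟨x, hlo, hhi⟩ := Order.exists_between_finsets
    ((Finset.univ.filter fun i => (L.slope i < 0 ∧ L.eval i t < y) ∨ (0 < L.slope i ∧
      y < L.eval i t ∧ ∀ k, 0 < L.slope k → L.root k ≤ L.root i → y ≤ L.eval k t)).image L.root)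
    ((Finset.univ.filter fun i => (0 < L.slope i ∧ L.eval i t < y) ∨ (L.slope i < 0 ∧
      y < L.eval i t ∧ ∀ k, L.slope k < 0 → L.root i ≤ L.root k → y ≤ L.eval k t)).image L.root)
    (by
      simp only [Finset.mem_image, Finset.mem_filter, Finset.mem_univ, true_and]
      rintro _ ⟨i, hi, rfl⟩ _ ⟨k, hk, rfl⟩
      rcases hi with ⟨hi, hit⟩ | ⟨hi, hit, hmin⟩ <;> rcases hk with ⟨hk, hkt⟩ | ⟨hk, hkt, hmin'⟩
      · by_contra! hle
        exact hw ⟨k, i, hk, hi, hle, hkt, hit⟩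
      · by_contra! hle
        exact absurd (hmin' i hi hle) (not_le.2 hit)
      · by_contra! hle
        exact absurd (hmin k hk hle) (not_le.2 hkt)
      · exact ((eval_pos_iff_of_rising hi).1 (hy.trans hit)).trans
          ((eval_pos_iff_of_falling hk).1 (hy.trans hkt)))
  simp only [Finset.mem_image, Finset.mem_filter, Finset.mem_univ, true_and,
    forall_exists_index, and_imp, forall_apply_eq_imp_iff₂] at hlo hhi
  refine ⟨x, fun c hc hmem => ?_⟩
  have hrise : ∀ i, L.RiseAlive i ((1 - c) * x + c * t) →
      L.eval i ((1 - c) * x + c * t) ≠ c * y := fun i hi =>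
    eval_ne_of_riseAlive_segment hp hy (fun k hk hkt => hhi k (.inl ⟨hk, hkt⟩))
      (fun i hi hit hmin => hlo i (.inr ⟨hi, hit, hmin⟩)) hc.1 hc.2 hi
  have hfall : ∀ i, L.FallAlive i ((1 - c) * x + c * t) →
      L.eval i ((1 - c) * x + c * t) ≠ c * y := by
    intro i hi
    have hneg : (1 - c) * -x + c * -t = -((1 - c) * x + c * t) := by ring
    have := eval_ne_of_riseAlive_segment (L := L.rev) (t := -t) (y := y) (x := -x) (i := i)
      (c := c) (by rw [support_rev, image_flipTime]; simpa using hp) hy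
      (fun k hk hkt => by
        have := hlo k (.inl ⟨by simpa using hk, by simpa using hkt⟩); simpa using this)
      (fun i hi hit hmin => by
        have := hhi i (.inr ⟨by simpa using hi, by simpa using hit, fun k hk hki => by
          simpa using hmin k (by simpa using hk) (by simpa using hki)⟩)
        simpa using this) hc.1 hc.2 (by rw [riseAlive_rev, hneg]; simpa using hi)
    rwa [hneg, eval_rev, _root_.neg_neg] at this
  rcases (mul_nonneg hc.1 hy.le).eq_or_lt with h0 | h0
  · rw [← h0] at hmem
    obtain ⟨s, i, hi⟩ := mem_iUnion₂.1 hmem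
    have h1 := (mem_halfLine_of_mem_clipped hi).1
    simp only at h1
    have h2 := (eval_eq_zero_iff (hn i)).1 h1.symm
    rcases (hn i).lt_or_gt with hs | hs
    · exact hfall i (by rw [h2]; exact fallAlive_root hs) (h1.symm.trans h0)
    · exact hrise i (by rw [h2]; exact riseAlive_root hs) (h1.symm.trans h0)
  · obtain ⟨i, h1, h2 | h2⟩ := mem_support_of_pos hn hmem h0
    · exact hrise i h2 h1.symm
    · exact hfall i h2 h1.symm

theorem exists_zoneFace (hn : L.NoHorizontal) (hp : (t, y) ∉ L.support) (hy : 0 < y)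
    (hw : (t, y) ∉ L.wedge) : ∃ F ∈ zoneFaces univ L.support, (t, y) ∈ F := by
  obtain ⟨x, hx⟩ := exists_segment hn hp hy hw
  have hmem : (t, y) ∈ univ \ L.support := ⟨mem_univ _, hp⟩
  refine ⟨_, ⟨⟨(t, y), hmem, rfl⟩, (x, 0), ?_, rfl⟩, mem_connectedComponentIn hmem⟩
  have hpre : IsPreconnected ((fun c : ℝ => ((1 - c) * x + c * t, c * y)) '' Icc 0 1) :=
    isPreconnected_Icc.image _ (by fun_prop)
  refine hpre.subset_connectedComponentIn (F := univ \ L.support) ⟨1, by simp, by simp⟩ ?_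
    ⟨0, by simp, by simp⟩
  rintro _ ⟨c, hc, rfl⟩
  exact ⟨mem_univ _, hx c hc⟩

/-- A piece of a clipped half-line that contains no vertex and is above no wedge bounds the zone. -/
theorem mem_clippedZone_of_Ioo (hd : L.Distinct) (hn : L.NoHorizontal) (hcd : c < d)
    (h : ∀ u ∈ Ioo c d, L.RiseAlive i u ∧ 0 < L.eval i u ∧ (u, L.eval i u) ∉ L.vertices ∧
      (u, L.eval i u) ∉ L.wedge) (ht : t ∈ Icc c d) : (t, L.eval i t) ∈ L.clippedZone := by
  obtain ⟨u, hu⟩ := exists_between hcd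
  obtain ⟨h1, h2, h3, h4⟩ := h u hu
  set p : ℝ × ℝ := (u, L.eval i u) with hp
  have hpm : p ∈ L.support \ L.vertices := ⟨h1.mem_support, h3⟩
  set e := connectedComponentIn (L.support \ L.vertices) p
  have hpre : IsPreconnected ((fun w => (w, L.eval i w)) '' Ioo c d) :=
    isPreconnected_Ioo.image _ (by fun_prop)
  have hsub : (fun w => (w, L.eval i w)) '' Ioo c d ⊆ e :=
    hpre.subset_connectedComponentIn (mem_image_of_mem _ hu) (by
      rintro _ ⟨w, hw, rfl⟩
      exact ⟨(h w hw).1.mem_support, (h w hw).2.2.1⟩)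
  have htcl : (t, L.eval i t) ∈ closure e := by
    refine closure_mono hsub (image_closure_subset_closure_image (by fun_prop) ?_)
    rw [closure_Ioo hcd.ne]
    exact mem_image_of_mem _ ht
  refine .inr (mem_biUnion ⟨⟨p, hpm, rfl⟩, ?_⟩ htcl)
  -- the face just below the point `p` belongs to the zone
  obtain ⟨ε, hε, hball⟩ := Metric.eventually_nhds_iff_ball.1
    (h1.eventually_mem_support_iff hd hn h2 h3)
  obtain ⟨δ, hδ0, hδ⟩ := exists_between (lt_min hε h2)
  have hq : ((u, L.eval i u - δ) : ℝ × ℝ) ∈ Metric.ball p ε ∩ {q | q.2 < L.eval i q.1} := by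
    refine ⟨?_, by simpa using hδ0⟩
    rw [Metric.mem_ball, hp, Prod.dist_eq]
    simp only [dist_self, Real.dist_eq, sub_sub_cancel_left, abs_neg, abs_of_pos hδ0]
    rw [max_eq_right hδ0.le]
    exact hδ.trans_le (min_le_left _ _)
  have hA : ∀ q ∈ Metric.ball p ε ∩ {q | q.2 < L.eval i q.1}, q ∉ L.support := fun q hq hqS =>
    (show q.2 < L.eval i q.1 from hq.2).ne ((hball q hq.1).1 hqS)
  obtain ⟨F, hF, hqF⟩ := exists_zoneFace hn (hA _ hq)
    (by have := hδ.trans_le (min_le_right _ _); linarith)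
    (by
      rintro ⟨k, m, hk, hm, hkm, e1, e2⟩
      exact h4 ⟨k, m, hk, hm, hkm, by simp only [hp] at e1 ⊢; linarith,
        by simp only [hp] at e2 ⊢; linarith⟩)
  refine ⟨F, hF, edge_subset_closure_face hd hn ⟨p, hpm, rfl⟩ hF.1
    ⟨p, mem_connectedComponentIn hpm, ?_⟩⟩
  have hsubF : Metric.ball p ε ∩ {q | q.2 < L.eval i q.1} ⊆ F := by
    obtain ⟨⟨r, hr, rfl⟩, -⟩ := hF
    have := ((convex_ball p ε).inter (L.convex_below i)).isPreconnected.subset_connectedComponentIn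
      (F := univ \ L.support) hq fun q hq => ⟨mem_univ _, hA q hq⟩
    rwa [← connectedComponentIn_eq hqF] at this
  exact closure_mono hsubF
    (mem_closure_above_and_below Metric.isOpen_ball (Metric.mem_ball_self hε) rfl).2

theorem eventually_notMem_vertices (hd : L.Distinct) (hn : L.NoHorizontal) (i : Fin n) (t : ℝ) :
    ∀ᶠ u in 𝓝[≠] t, (u, L.eval i u) ∉ L.vertices := by
  have hfin := (finite_vertexTimes hd hn i).sdiff (t := {t})
  have : ∀ᶠ u in 𝓝 t, u ∉ {u | (u, L.eval i u) ∈ L.vertices} \ {t} :=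
    hfin.isClosed.isOpen_compl.mem_nhds (by simp)
  filter_upwards [this.filter_mono nhdsWithin_le_nhds, self_mem_nhdsWithin] with u hu hut hv
  exact hu ⟨hv, hut⟩

/-- Left of a point that is above no wedge, the steepest rising half-line through the point is
above no wedge either. -/
theorem mem_clippedZone_of_riseAlive (hd : L.Distinct) (hn : L.NoHorizontal)
    (hi : L.RiseAlive i t) (h0 : 0 < L.eval i t) (hw : (t, L.eval i t) ∉ L.wedge)
    (hmax : ∀ k, L.RiseAlive k t → L.eval k t = L.eval i t → L.slope k ≤ L.slope i) :
    (t, L.eval i t) ∈ L.clippedZone := by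
  have hev1 : ∀ᶠ u in 𝓝[<] t, 0 < L.eval i u :=
    (((L.continuous_eval i).tendsto t).eventually (lt_mem_nhds h0)).filter_mono nhdsWithin_le_nhds
  have hev2 := (eventually_notMem_vertices hd hn i t).filter_mono
    (nhdsWithin_mono t fun u (hu : u < t) => hu.ne)
  have hev3 : ∀ᶠ u in 𝓝[<] t, ∀ k m, 0 < L.slope k → L.slope m < 0 → L.root k ≤ L.root m →
      ¬ (L.eval k u < L.eval i u ∧ L.eval m u < L.eval i u) := by
    rw [eventually_all]; intro k
    rw [eventually_all]; intro m
    by_cases hkm : 0 < L.slope k ∧ L.slope m < 0 ∧ L.root k ≤ L.root m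
    swap
    · exact Eventually.of_forall fun u h1 h2 h3 => (hkm ⟨h1, h2, h3⟩).elim
    obtain ⟨hk, hm, hkm⟩ := hkm
    rcases le_or_gt (L.eval i t) (L.eval m t) with hmt | hmt
    · filter_upwards [self_mem_nhdsWithin] with u hu _ _ _ hcon
      have h1 := eval_lt_eval_of_falling hm (show u < t from hu)
      have h2 := eval_lt_eval_of_rising hi.1 (show u < t from hu)
      linarith [hcon.2]
    · have hkt : L.eval i t ≤ L.eval k t := by
        by_contra! hlt
        exact hw ⟨k, m, hk, hm, hkm, hlt, hmt⟩
      rcases hkt.eq_or_lt with hkt | hkt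
      · -- a rising line through the point that is steeper has been clipped before
        have hs : L.slope k ≤ L.slope i := by
          refine hmax k ⟨hk, hkt ▸ h0.le, fun l hl hlk => ?_⟩ hkt.symm
          by_contra! hlt
          rw [← hkt] at hlt
          exact hw ⟨l, m, hl, hm, hlk.trans hkm, hlt, hmt⟩
        filter_upwards [self_mem_nhdsWithin] with u hu _ _ _ hcon
        have h1 := L.eval_sub i t u
        have h2 := L.eval_sub k t u
        have hut : u < t := hu
        nlinarith [hcon.1]
      · have : ∀ᶠ u in 𝓝 t, L.eval i u < L.eval k u :=
          (isOpen_lt (L.continuous_eval i) (L.continuous_eval k)).mem_nhds hkt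
        filter_upwards [this.filter_mono nhdsWithin_le_nhds] with u hu _ _ _ hcon
        exact lt_asymm hu hcon.1
  obtain ⟨c, hc, hcs⟩ := (mem_nhdsLT_iff_exists_Ioo_subset' (sub_one_lt t)).1
    (hev1.and (hev2.and hev3))
  refine mem_clippedZone_of_Ioo hd hn (show c < t from hc) (fun u hu => ?_)
    ⟨(show c < t from hc).le, le_rfl⟩
  obtain ⟨h1, h2, h3⟩ := hcs hu
  refine ⟨hi.of_pos_of_le h1 hu.2.le, h1, h2, ?_⟩
  rintro ⟨k, m, hk, hm, hkm, e1, e2⟩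
  exact h3 k m hk hm hkm ⟨e1, e2⟩

/-- Right of its crossing with the axis, the least steep line through the crossing bounds the
zone. -/
theorem mem_clippedZone_of_axis (hd : L.Distinct) (hn : L.NoHorizontal)
    (hi : 0 < L.slope i) (h0 : L.eval i t = 0)
    (hmin : ∀ k, L.eval k t = 0 → |L.slope i| ≤ |L.slope k|) :
    (t, (0 : ℝ)) ∈ L.clippedZone := by
  have hti := (eval_eq_zero_iff hi.ne').1 h0
  have hev1 : ∀ᶠ u in 𝓝[>] t, ∀ k, 0 < L.slope k → L.root k ≤ L.root i →
      L.eval i u ≤ L.eval k u := by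
    rw [eventually_all]; intro k
    by_cases hk : 0 < L.slope k ∧ L.root k ≤ L.root i
    swap
    · exact Eventually.of_forall fun u h1 h2 => (hk ⟨h1, h2⟩).elim
    rcases hk.2.eq_or_lt with hki | hki
    · have hk0 : L.eval k t = 0 := by rw [hti, ← hki, eval_root hk.1.ne']
      have hs := hmin k hk0
      rw [abs_of_pos hi, abs_of_pos hk.1] at hs
      filter_upwards [self_mem_nhdsWithin] with u hu _ _
      have h1 := L.eval_sub i u t
      have h2 := L.eval_sub k u t
      have hut : t < u := hu
      nlinarith
    · have : ∀ᶠ u in 𝓝 t, L.eval i u < L.eval k u :=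
        (isOpen_lt (L.continuous_eval i) (L.continuous_eval k)).mem_nhds (by
          rw [mem_ofPred_eq, h0]; exact (eval_pos_iff_of_rising hk.1).2 (hti ▸ hki))
      filter_upwards [this.filter_mono nhdsWithin_le_nhds] with u hu _ _ using hu.le
  have hev2 := (eventually_notMem_vertices hd hn i t).filter_mono
    (nhdsWithin_mono t fun u (hu : t < u) => hu.ne')
  have hev3 : ∀ᶠ u in 𝓝[>] t, ∀ m, L.slope m < 0 → L.root i < L.root m →
      L.eval i u < L.eval m u := by
    rw [eventually_all]; intro m
    by_cases hm : L.slope m < 0 ∧ L.root i < L.root m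
    swap
    · exact Eventually.of_forall fun u h1 h2 => (hm ⟨h1, h2⟩).elim
    have : ∀ᶠ u in 𝓝 t, L.eval i u < L.eval m u :=
      (isOpen_lt (L.continuous_eval i) (L.continuous_eval m)).mem_nhds (by
        rw [mem_ofPred_eq, h0]; exact (eval_pos_iff_of_falling hm.1).2 (hti ▸ hm.2))
    filter_upwards [this.filter_mono nhdsWithin_le_nhds] with u hu _ _ using hu
  obtain ⟨d, hd', hds⟩ := (mem_nhdsGT_iff_exists_Ioo_subset' (lt_add_one t)).1
    (hev1.and (hev2.and hev3))
  rw [← h0]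
  refine mem_clippedZone_of_Ioo hd hn (show t < d from hd') (fun u hu => ?_)
    ⟨le_rfl, (show t < d from hd').le⟩
  obtain ⟨h1, h2, h3⟩ := hds hu
  have hu0 : 0 < L.eval i u := (eval_pos_iff_of_rising hi).2 (hti ▸ hu.1)
  refine ⟨⟨hi, hu0.le, h1⟩, hu0, h2, ?_⟩
  rintro ⟨k, m, hk, hm, hkm, e1, e2⟩
  rcases le_or_gt (L.root k) (L.root i) with hki | hki
  · exact absurd (h1 k hk hki) (not_le.2 e1)
  · exact lt_asymm (h3 m hm (hki.trans_le hkm)) e2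

/-! ### The zone under reflections -/

theorem mem_clippedZone_image (φ : (ℝ × ℝ) ≃ₜ (ℝ × ℝ)) (hφ : φ '' xAxis ⊆ xAxis)
    {L' : LineFamily n} (hS : L'.support = φ '' L.support) (hV : L'.vertices = φ '' L.vertices)
    {p : ℝ × ℝ} (h : p ∈ L.clippedZone) : φ p ∈ L'.clippedZone := by
  have hface : ∀ F ∈ zoneFaces univ L.support, φ '' F ∈ zoneFaces univ L'.support := by
    rintro _ ⟨⟨q, hq, rfl⟩, z, hz, hz0⟩
    have himg : φ '' (univ \ L.support) = univ \ L'.support := by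
      rw [hS, image_sdiff φ.injective, image_univ, φ.surjective.range_eq]
    exact ⟨⟨φ q, himg ▸ mem_image_of_mem φ hq, by rw [φ.image_connectedComponentIn hq, himg]⟩,
      φ z, mem_image_of_mem φ hz, hφ (mem_image_of_mem φ hz0)⟩
  rcases h with ⟨F, hF, hpF⟩ | h
  · exact .inl ⟨_, hface F hF, mem_image_of_mem φ hpF⟩
  · obtain ⟨e, ⟨⟨q, hq, rfl⟩, F, hF, heF⟩, hpe⟩ := mem_iUnion₂.1 h
    have himg : φ '' (L.support \ L.vertices) = L'.support \ L'.vertices := by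
      rw [hS, hV, image_sdiff φ.injective]
    refine .inr (mem_biUnion (x := φ '' connectedComponentIn (L.support \ L.vertices) q)
      ⟨⟨φ q, himg ▸ mem_image_of_mem φ hq, by rw [φ.image_connectedComponentIn hq, himg]⟩,
        φ '' F, hface F hF, ?_⟩ ?_)
    · rw [← φ.image_closure]; exact image_mono heF
    · rw [← φ.image_closure]; exact mem_image_of_mem φ hpe

theorem mem_clippedZone_of_neg (h : (t, -y) ∈ L.neg.clippedZone) : (t, y) ∈ L.clippedZone := by
  have := mem_clippedZone_image (L := L.neg) (L' := L) flipPos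
    (by rintro _ ⟨p, hp, rfl⟩; have : p.2 = 0 := hp; simp [xAxis, this])
    (by rw [← support_neg, neg_neg]) (by rw [← vertices_neg, neg_neg]) h
  simpa using this

theorem mem_clippedZone_of_rev (h : (-t, y) ∈ L.rev.clippedZone) : (t, y) ∈ L.clippedZone := by
  have := mem_clippedZone_image (L := L.rev) (L' := L) flipTime
    (by rintro _ ⟨p, hp, rfl⟩; have : p.2 = 0 := hp; simp [xAxis, this])
    (by rw [← support_rev, rev_rev]) (by rw [← vertices_rev, rev_rev]) h
  simpa using this

theorem mem_clippedZone_of_notMem_wedge (hd : L.Distinct) (hn : L.NoHorizontal) (hy : 0 < y)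
    (hw : (t, y) ∉ L.wedge) : (t, y) ∈ L.clippedZone := by
  classical
  have rise : ∀ {L : LineFamily n} {t : ℝ}, L.Distinct → L.NoHorizontal → (t, y) ∉ L.wedge →
      ∀ i, y = L.eval i t → L.RiseAlive i t → (t, y) ∈ L.clippedZone := by
    intro L t hd hn hw i hi hri
    obtain ⟨k, hk, hmax⟩ := (Finset.univ.filter fun k => L.RiseAlive k t ∧
      L.eval k t = y).exists_max_image L.slope ⟨i, by simp [hri, hi]⟩
    simp only [Finset.mem_filter, Finset.mem_univ, true_and] at hk hmax
    obtain ⟨hk1, rfl⟩ := hk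
    exact mem_clippedZone_of_riseAlive hd hn hk1 hy hw fun l h1 h2 => hmax l ⟨h1, h2⟩
  by_cases hp : (t, y) ∈ L.support
  · obtain ⟨i, hi, hri | hfi⟩ := mem_support_of_pos hn hp hy
    · exact rise hd hn hw i hi hri
    · refine mem_clippedZone_of_rev (rise hd.rev hn.rev ?_ i (by simpa using hi) ?_)
      · rw [wedge_rev, image_flipTime]; simpa using hw
      · rw [riseAlive_rev]; simpa using hfi
  · obtain ⟨F, hF, hm⟩ := exists_zoneFace hn hp hy hw
    exact .inl ⟨F, hF, hm⟩

/-- The graph of an area-minimal trajectoid lies in the zone. -/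
theorem mem_clippedZone_of_isAreaMinimal (hd : L.Distinct) (hn : L.NoHorizontal) (hab : a < b)
    (hT : IsAreaMinimal L.eval 0 a b T) (ht : t ∈ Icc a b) :
    (t, L.eval (T t) t) ∈ L.clippedZone := by
  classical
  rcases lt_trichotomy (L.eval (T t) t) 0 with h | h | h
  · refine mem_clippedZone_of_neg (mem_clippedZone_of_notMem_wedge hd.neg hn.neg (by linarith) ?_)
    have := notMem_wedge_of_isAreaMinimal hab (isAreaMinimal_neg hT) ht
    rwa [eval_neg] at this
  · rw [h]
    obtain ⟨k, hk, hmin⟩ := (Finset.univ.filter fun k => L.eval k t = 0).exists_min_image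
      (fun k => |L.slope k|) ⟨T t, by simp [h]⟩
    simp only [Finset.mem_filter, Finset.mem_univ, true_and] at hk hmin
    rcases (hn k).lt_or_gt with hs | hs
    · refine mem_clippedZone_of_neg ?_
      rw [neg_zero]
      exact mem_clippedZone_of_axis hd.neg hn.neg (i := k) (by simpa using hs) (by simp [hk])
        fun l hl => by simpa using hmin l (by simpa using hl)
    · exact mem_clippedZone_of_axis hd hn hs hk hmin
  · exact mem_clippedZone_of_notMem_wedge hd hn h (notMem_wedge_of_isAreaMinimal hab hT ht)

end LineFamily

end CentralTrajectory

namespace CentralTrajectory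

/-! ### Entities on straight pieces -/

theorem encard_biUnion_le {α β : Type*} {I : Set α} (hI : I.Finite) {A : α → Set β} {c : ℕ∞}
    (h : ∀ i ∈ I, (A i).encard ≤ c) : (⋃ i ∈ I, A i).encard ≤ I.encard * c := by
  induction I, hI using Set.Finite.induction_on with
  | empty => simp
  | @insert a s ha _ ih =>
    rw [biUnion_insert, encard_insert_of_notMem ha, add_mul, one_mul, add_comm]
    exact (encard_union_le _ _).trans (add_le_add (h a (mem_insert _ _))
      (ih fun i hi => h i (mem_insert_of_mem _ hi)))

/-- The distance to the farthest of finitely many points of the line is the distance to the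
midpoint of the extreme ones plus half of their distance. -/
theorem iSup_abs_sub_eq {n : ℕ} (x : Fin n → ℝ) (σ : Fin n) :
    ⨆ ψ, |x σ - x ψ| = |x σ - ((⨆ ψ, x ψ) + ⨅ ψ, x ψ) / 2| + ((⨆ ψ, x ψ) - ⨅ ψ, x ψ) / 2 := by
  have : Nonempty (Fin n) := ⟨σ⟩
  have hb1 : BddAbove (range x) := (finite_range x).bddAbove
  have hb2 : BddBelow (range x) := (finite_range x).bddBelow
  have hb3 : BddAbove (range fun ψ => |x σ - x ψ|) := (finite_range _).bddAbove
  obtain ⟨k, hk⟩ := exists_eq_ciSup_of_finite (f := x)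
  obtain ⟨l, hl⟩ := exists_eq_ciInf_of_finite (f := x)
  apply le_antisymm
  · refine ciSup_le fun ψ => ?_
    have h1 := le_ciSup hb1 ψ
    have h2 := ciInf_le hb2 ψ
    rw [abs_le]
    constructor
    · linarith [neg_abs_le (x σ - ((⨆ ψ, x ψ) + ⨅ ψ, x ψ) / 2)]
    · linarith [le_abs_self (x σ - ((⨆ ψ, x ψ) + ⨅ ψ, x ψ) / 2)]
  · have h1 := (neg_abs_le (x σ - x k)).trans' (neg_le_neg (le_ciSup hb3 k))
    have h2 := (le_abs_self (x σ - x l)).trans (le_ciSup hb3 l)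
    rw [hk] at h1
    rw [hl] at h2
    rcases abs_cases (x σ - ((⨆ ψ, x ψ) + ⨅ ψ, x ψ) / 2) with ⟨h, _⟩ | ⟨h, _⟩ <;> rw [h] <;>
      linarith

namespace Entities

variable {n τ : ℕ} {X : Entities n τ} {i : Fin τ} {a b a' b' t : ℝ} {σ : Fin n}

/-- The lines along which the entities move during `[t_i, t_{i+1}]`. -/
noncomputable def lines (X : Entities n τ) (i : Fin τ) : LineFamily n where
  slope σ := (X.linear σ i).choose
  offset σ := (X.linear σ i).choose_spec.choose

theorem pos_eq_eval (X : Entities n τ) (i : Fin τ) (σ : Fin n)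
    (ht : t ∈ Icc (X.time i.castSucc) (X.time i.succ)) : X.pos σ t = (X.lines i).eval σ t :=
  (X.linear σ i).choose_spec.choose_spec t ht

theorem Icc_time_subset (X : Entities n τ) (i : Fin τ) :
    Icc (X.time i.castSucc) (X.time i.succ) ⊆ Icc X.first X.last :=
  Icc_subset_Icc (X.time_strictMono.monotone (Fin.zero_le _))
    (X.time_strictMono.monotone (Fin.le_last _))

theorem Generic.eq_of_eqOn (hX : X.Generic) (hab : a < b) (hsub : Icc a b ⊆ Icc X.first X.last)
    {ψ : Fin n} (h : ∀ t ∈ Icc a b, X.pos σ t = X.pos ψ t) : σ = ψ := by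
  by_contra hne
  exact (Icc_infinite hab) ((hX σ ψ hne).subset fun t ht => ⟨hsub ht, h t ht⟩)

theorem Generic.distinct_lines (hX : X.Generic) (i : Fin τ) : (X.lines i).Distinct := by
  intro σ ψ hs ho
  refine hX.eq_of_eqOn (X.time_strictMono i.castSucc_lt_succ) (X.Icc_time_subset i) fun t ht => ?_
  rw [X.pos_eq_eval i σ ht, X.pos_eq_eval i ψ ht, LineFamily.eval, LineFamily.eval, hs, ho]

theorem IdealStraight.Icc_subset (h : X.IdealStraight i a b) :
    Icc a b ⊆ Icc (X.time i.castSucc) (X.time i.succ) := Icc_subset_Icc h.2.1 h.2.2.1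

theorem IdealStraight.eval_relLines (h : X.IdealStraight i a b) (σ : Fin n) (ht : t ∈ Icc a b) :
    (X.relLines a b).eval σ t = X.pos σ t - X.ideal t := by
  obtain ⟨hab, -, -, α, β, hI⟩ := id h
  have hpos : ∀ s ∈ Icc a b, X.pos σ s = (X.lines i).eval σ s := fun s hs =>
    X.pos_eq_eval i σ (h.Icc_subset hs)
  have hba : b - a ≠ 0 := by linarith
  simp only [LineFamily.eval, relLines]
  rw [hI t ht, hI a ⟨le_rfl, hab.le⟩, hI b ⟨hab.le, le_rfl⟩, hpos t ht, hpos a ⟨le_rfl, hab.le⟩,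
    hpos b ⟨hab.le, le_rfl⟩]
  simp only [LineFamily.eval]
  field_simp
  ring

theorem IdealStraight.distinct_relLines (h : X.IdealStraight i a b) (hX : X.Generic) :
    (X.relLines a b).Distinct := by
  intro σ ψ hs ho
  refine hX.eq_of_eqOn h.1 (h.Icc_subset.trans (X.Icc_time_subset i)) fun t ht => ?_
  have h1 := h.eval_relLines σ ht
  have h2 := h.eval_relLines ψ ht
  rw [LineFamily.eval, hs, ho] at h1
  rw [LineFamily.eval] at h2
  linarith

theorem continuousOn_pos (X : Entities n τ) (i : Fin τ) (σ : Fin n) :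
    ContinuousOn (X.pos σ) (Icc (X.time i.castSucc) (X.time i.succ)) :=
  ((X.lines i).continuous_eval σ).continuousOn.congr fun _ ht => X.pos_eq_eval i σ ht

theorem continuousOn_iSup_pos (X : Entities n τ) (i : Fin τ) [Nonempty (Fin n)] :
    ContinuousOn (fun t => ⨆ σ, X.pos σ t) (Icc (X.time i.castSucc) (X.time i.succ)) := by
  have h : ContinuousOn (fun t => Finset.univ.sup' Finset.univ_nonempty fun σ => X.pos σ t)
      (Icc (X.time i.castSucc) (X.time i.succ)) :=
    ContinuousOn.finset_sup'_apply _ fun σ _ => X.continuousOn_pos i σ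
  simpa only [Finset.sup'_univ_eq_ciSup] using h

theorem continuousOn_iInf_pos (X : Entities n τ) (i : Fin τ) [Nonempty (Fin n)] :
    ContinuousOn (fun t => ⨅ σ, X.pos σ t) (Icc (X.time i.castSucc) (X.time i.succ)) := by
  have h : ContinuousOn (fun t => Finset.univ.inf' Finset.univ_nonempty fun σ => X.pos σ t)
      (Icc (X.time i.castSucc) (X.time i.succ)) :=
    ContinuousOn.finset_inf'_apply _ fun σ _ => X.continuousOn_pos i σ
  simpa only [Finset.inf'_univ_eq_ciInf] using h

/-- Relative to a straight piece of the ideal trajectory, a central trajectory minimizes the area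
between itself and the axis: the farthest distance is the distance to the ideal trajectory plus
half of the extent of the entities. -/
theorem IdealStraight.isAreaMinimal (h : X.IdealStraight i a b) {T : ℝ → Fin n}
    (hT : IsCentral X.pos 0 a b T) : IsAreaMinimal (X.relLines a b).eval 0 a b T := by
  have : Nonempty (Fin n) := ⟨T 0⟩
  have htraj : ∀ S, IsTrajectoid (X.relLines a b).eval 0 a b S ↔ IsTrajectoid X.pos 0 a b S := by
    intro S
    refine forall₂_congr fun t ht => forall_congr' fun σ => imp_congr_right fun _ => ?_
    rw [epsConnected_zero_iff, epsConnected_zero_iff, h.eval_relLines _ ht, h.eval_relLines _ ht,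
      sub_left_inj]
  set R : ℝ → ℝ := fun t => ((⨆ ψ, X.pos ψ t) - ⨅ ψ, X.pos ψ t) / 2 with hR
  have hRc : ContinuousOn R (Icc a b) :=
    (((X.continuousOn_iSup_pos i).sub (X.continuousOn_iInf_pos i)).div_const 2).mono h.Icc_subset
  have hint : ∀ S, IsTrajectoid X.pos 0 a b S → ∫ t in a..b, farthest X.pos S t =
      (∫ t in a..b, |(X.relLines a b).eval (S t) t|) + ∫ t in a..b, R t := by
    intro S hS
    rw [← intervalIntegral.integral_add]
    · refine intervalIntegral.integral_congr fun t ht => ?_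
      rw [uIcc_of_le h.1.le] at ht
      simp only [farthest]
      rw [iSup_abs_sub_eq (fun ψ => X.pos ψ t), h.eval_relLines _ ht]
      rfl
    · refine ContinuousOn.intervalIntegrable ?_
      rw [uIcc_of_le h.1.le]
      exact (LineFamily.continuousOn_of_isTrajectoid ((htraj S).2 hS)).abs
    · refine ContinuousOn.intervalIntegrable ?_
      rwa [uIcc_of_le h.1.le]
  refine ⟨(htraj T).2 hT.1, fun S hS => ?_⟩
  have h1 := hT.2 S ((htraj S).1 hS)
  rw [hint T hT.1, hint S ((htraj S).1 hS)] at h1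
  linarith

/-! ### Counting elementary intervals -/

/-- Two overlapping straight pieces of the ideal trajectory form one. -/
theorem IdealStraight.union (h : X.IdealStraight i a b) (h' : X.IdealStraight i a' b')
    (h1 : a < b') (h2 : a' < b) : X.IdealStraight i (min a a') (max b b') := by
  obtain ⟨hab, ha, hb, α, β, hI⟩ := h
  obtain ⟨hab', ha', hb', α', β', hI'⟩ := h'
  refine ⟨(min_le_left _ _).trans_lt (hab.trans_le (le_max_left _ _)), le_min ha ha', max_le hb hb',
    α, β, ?_⟩
  have hlt : max a a' < min b b' := max_lt (lt_min hab h1) (lt_min h2 hab')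
  have e1 := hI (max a a') ⟨le_max_left _ _, hlt.le.trans (min_le_left _ _)⟩
  have e2 := hI (min b b') ⟨(le_max_left _ _).trans hlt.le, min_le_left _ _⟩
  rw [hI' (max a a') ⟨le_max_right _ _, hlt.le.trans (min_le_right _ _)⟩] at e1
  rw [hI' (min b b') ⟨(le_max_right _ _).trans hlt.le, min_le_right _ _⟩] at e2
  have hα : α' = α := by
    have : (α' - α) * (min b b' - max a a') = 0 := by linear_combination e2 - e1
    rcases mul_eq_zero.1 this with h | h
    · linarith
    · linarith
  subst hα
  have hβ : β' = β := by linarith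
  subst hβ
  intro t ht
  by_cases htab : t ∈ Icc a b
  · exact hI t htab
  · apply hI'
    rw [mem_Icc, not_and_or, not_le, not_le] at htab
    rcases htab with hta | htb
    · exact ⟨(min_le_iff.1 ht.1).resolve_left (not_le.2 hta), (hta.trans h1).le⟩
    · exact ⟨(h2.trans htb).le, (le_max_iff.1 ht.2).resolve_left (not_le.2 htb)⟩

theorem IsElementary.eq_of_overlap (h : X.IsElementary a b) (h' : X.IsElementary a' b')
    (h1 : a < b') (h2 : a' < b) : a = a' ∧ b = b' := by
  obtain ⟨i, hs, hmax⟩ := h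
  obtain ⟨i', hs', hmax'⟩ := h'
  obtain rfl : i = i' := by
    apply le_antisymm
    · have := X.time_strictMono.lt_iff_lt.1 ((hs.2.1.trans_lt h1).trans_le hs'.2.2.1)
      exact Fin.castSucc_lt_succ_iff.1 this
    · have := X.time_strictMono.lt_iff_lt.1 ((hs'.2.1.trans_lt h2).trans_le hs.2.2.1)
      exact Fin.castSucc_lt_succ_iff.1 this
  have hu := hs.union hs' h1 h2
  have e := hmax _ _ (min_le_left _ _) (le_max_left _ _) hu
  have e' := hmax' _ _ (min_le_right _ _) (le_max_right _ _) hu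
  exact ⟨e.1.symm.trans e'.1, e.2.symm.trans e'.2⟩

/-- At time `t`, line `k` is a highest line and steeper than another highest line, or a lowest line
and less steep than another lowest line: it appears on the upper or the lower envelope. -/
def EntersEnvelope (M : LineFamily n) (k : Fin n) (t : ℝ) : Prop :=
  ((∀ σ, M.eval σ t ≤ M.eval k t) ∧ ∃ m, M.eval m t = M.eval k t ∧ M.slope m < M.slope k) ∨
  ((∀ σ, M.eval k t ≤ M.eval σ t) ∧ ∃ m, M.eval m t = M.eval k t ∧ M.slope k < M.slope m)

/-- A line enters the two envelopes at most once altogether. -/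
theorem EntersEnvelope.eq {M : LineFamily n} {k : Fin n} {t' : ℝ} (h : EntersEnvelope M k t)
    (h' : EntersEnvelope M k t') : t = t' := by
  have key : ∀ {t t'}, EntersEnvelope M k t → EntersEnvelope M k t' → ¬ t < t' := by
    rintro t t' (⟨h1, m, hm, hs⟩ | ⟨h1, m, hm, hs⟩) (⟨h2, m', hm', hs'⟩ | ⟨h2, m', hm', hs'⟩) hlt
    · exact absurd (LineFamily.eval_lt_eval_of_slope_gt hm'.symm hs' hlt) (not_lt.2 (h1 m'))
    · exact absurd (LineFamily.eval_lt_eval_of_slope_lt hm hs hlt) (not_lt.2 (h2 m))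
    · exact absurd (LineFamily.eval_lt_eval_of_slope_lt hm.symm hs hlt) (not_lt.2 (h2 m))
    · exact absurd (LineFamily.eval_lt_eval_of_slope_gt hm' hs' hlt) (not_lt.2 (h1 m'))
  exact le_antisymm (not_lt.1 (key h' h)) (not_lt.1 (key h h'))

theorem eval_eq_of_slope_eq {M : LineFamily n} {k l : Fin n} (hs : M.slope k = M.slope l)
    (h : M.eval k t = M.eval l t) (s : ℝ) : M.eval k s = M.eval l s := by
  have h1 := M.eval_sub k s t
  have h2 := M.eval_sub l s t
  rw [hs] at h1
  linarith

/-- Where a straight piece of the ideal trajectory ends inside `[t_i, t_{i+1}]`, a line enters an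
envelope. -/
theorem exists_entersEnvelope [Nonempty (Fin n)] (h : X.IdealStraight i a b)
    (hmax : ∀ a' b', a' ≤ a → b ≤ b' → X.IdealStraight i a' b' → a' = a ∧ b' = b)
    (hb : b < X.time i.succ) : ∃ k, EntersEnvelope (X.lines i) k b := by
  by_contra! hcon
  set M := X.lines i with hM
  obtain ⟨k, hk⟩ := Finite.exists_max fun σ => M.eval σ b
  obtain ⟨l, hl⟩ := Finite.exists_min fun σ => M.eval σ b
  have hup : ∀ᶠ t in 𝓝 b, ∀ σ, M.eval σ t ≤ M.eval k t := by
    rw [eventually_all]; intro σ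
    rcases (hk σ).eq_or_lt with he | hlt
    · have h1 : ¬ M.slope σ < M.slope k := fun hs => hcon k (.inl ⟨hk, σ, he, hs⟩)
      have h2 : ¬ M.slope k < M.slope σ := fun hs =>
        hcon σ (.inl ⟨fun ρ => (hk ρ).trans he.ge, k, he.symm, hs⟩)
      have hs : M.slope σ = M.slope k := le_antisymm (not_lt.1 h2) (not_lt.1 h1)
      exact Eventually.of_forall fun t => (eval_eq_of_slope_eq hs he t).le
    · have h1 : ∀ᶠ t in 𝓝 b, M.eval σ t < M.eval k t :=
        (isOpen_lt (M.continuous_eval σ) (M.continuous_eval k)).mem_nhds hlt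
      exact h1.mono fun t ht => ht.le
  have hlo : ∀ᶠ t in 𝓝 b, ∀ σ, M.eval l t ≤ M.eval σ t := by
    rw [eventually_all]; intro σ
    rcases (hl σ).eq_or_lt with he | hlt
    · have h1 : ¬ M.slope l < M.slope σ := fun hs => hcon l (.inr ⟨hl, σ, he.symm, hs⟩)
      have h2 : ¬ M.slope σ < M.slope l := fun hs =>
        hcon σ (.inr ⟨fun ρ => he.ge.trans (hl ρ), l, he, hs⟩)
      have hs : M.slope l = M.slope σ := le_antisymm (not_lt.1 h2) (not_lt.1 h1)
      exact Eventually.of_forall fun t => (eval_eq_of_slope_eq hs he t).le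
    · have h1 : ∀ᶠ t in 𝓝 b, M.eval l t < M.eval σ t :=
        (isOpen_lt (M.continuous_eval l) (M.continuous_eval σ)).mem_nhds hlt
      exact h1.mono fun t ht => ht.le
  obtain ⟨ε, hε, hball⟩ := Metric.eventually_nhds_iff_ball.1 (hup.and hlo)
  -- around `b`, the ideal trajectory is the average of the lines `k` and `l`
  have hideal : ∀ t ∈ Metric.ball b ε, t ∈ Icc (X.time i.castSucc) (X.time i.succ) →
      X.ideal t = (M.eval k t + M.eval l t) / 2 := by
    intro t ht hti
    obtain ⟨h1, h2⟩ := hball t ht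
    have hp : ∀ σ, X.pos σ t = M.eval σ t := fun σ => X.pos_eq_eval i σ hti
    have e1 : ⨆ σ, X.pos σ t = M.eval k t := by
      simp only [hp]
      exact le_antisymm (ciSup_le h1)
        (le_ciSup (f := fun σ => M.eval σ t) (finite_range _).bddAbove k)
    have e2 : ⨅ σ, X.pos σ t = M.eval l t := by
      simp only [hp]
      exact le_antisymm (ciInf_le (f := fun σ => M.eval σ t) (finite_range _).bddBelow l)
        (le_ciInf h2)
    rw [ideal, e1, e2]
  set c := max a (b - ε / 2) with hc
  set d := min (b + ε / 2) (X.time i.succ) with hd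
  have hcb : c < b := max_lt h.1 (by linarith)
  have hbd : b < d := lt_min (by linarith) hb
  have hstr : X.IdealStraight i c d := by
    refine ⟨hcb.trans hbd, h.2.1.trans (le_max_left _ _), min_le_right _ _,
      (M.slope k + M.slope l) / 2, (M.offset k + M.offset l) / 2, fun t ht => ?_⟩
    rw [hideal t ?_ ⟨(h.2.1.trans (le_max_left _ _)).trans ht.1, ht.2.trans (min_le_right _ _)⟩]
    · unfold LineFamily.eval; ring
    · rw [Real.ball_eq_Ioo]
      constructor
      · have := (le_max_right a (b - ε / 2)).trans ht.1; linarith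
      · have := ht.2.trans (min_le_left (b + ε / 2) _); linarith
  have hu := h.union hstr (h.1.trans hbd) hcb
  have := (hmax _ _ (min_le_left _ _) (le_max_left _ _) hu).2
  rw [max_eq_right hbd.le] at this
  linarith

/-- In each `[t_i, t_{i+1}]` there are at most `n + 1` elementary intervals: the right end of an
interval is `t_{i+1}`, or it is charged to a line that enters an envelope there. -/
theorem encard_isElementary_le [Nonempty (Fin n)] (X : Entities n τ) :
    {q : ℝ × ℝ | X.IsElementary q.1 q.2}.encard ≤ (τ * (n + 1) : ℕ) := by
  refine (encard_le_of_charge (P := (univ : Set (Fin τ × Option (Fin n))))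
    (fun q c => (c.2 = none ∧ q.2 = X.time c.1.succ) ∨
      ∃ k, c.2 = some k ∧ EntersEnvelope (X.lines c.1) k q.2) ?_ ?_).trans ?_
  · rintro ⟨a, b⟩ ⟨i, hs, hmax⟩
    rcases hs.2.2.1.eq_or_lt with hb | hb
    · exact ⟨(i, none), mem_univ _, .inl ⟨rfl, hb⟩⟩
    · obtain ⟨k, hk⟩ := exists_entersEnvelope hs hmax hb
      exact ⟨(i, some k), mem_univ _, .inr ⟨k, rfl, hk⟩⟩
  · rintro ⟨a, b⟩ h ⟨a', b'⟩ h' ⟨i, o⟩ hR hR'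
    have hab : a < b := by obtain ⟨_, hs, -⟩ := h; exact hs.1
    have hab' : a' < b' := by obtain ⟨_, hs, -⟩ := h'; exact hs.1
    have hbb : b = b' := by
      rcases hR with ⟨ho, hb⟩ | ⟨k, ho, hk⟩ <;> rcases hR' with ⟨ho', hb'⟩ | ⟨k', ho', hk'⟩
      · exact hb.trans hb'.symm
      · simp only at ho ho'; rw [ho] at ho'; exact absurd ho' (by simp)
      · simp only at ho ho'; rw [ho] at ho'; exact absurd ho' (by simp)
      · simp only at ho ho'
        rw [ho, Option.some_inj] at ho'
        subst ho'
        exact hk.eq hk'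
    subst hbb
    rw [(IsElementary.eq_of_overlap (a := a) (b := b) (a' := a') (b' := b) h h' hab hab').1]
  · rw [encard_univ]; simp

/-! ### The global zone -/

/-- As the sides of the slabs consist of vertices, an edge of the global zone lies over the interior
of one elementary interval. -/
theorem isZoneEdge_of_mem_globalZoneEdges {e : Set (ℝ × ℝ)} (he : e ∈ X.globalZoneEdges) :
    ∃ a b, X.IsElementary a b ∧ (X.relLines a b).IsZoneEdge (Icc a b) (Ioo a b) e := by
  obtain ⟨⟨p, ⟨hpS, hpV⟩, rfl⟩, F, ⟨⟨r, hr, rfl⟩, hax⟩, heF⟩ := he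
  obtain ⟨a, b, hab, hpab, hpL⟩ := id hpS
  refine ⟨a, b, hab, ?_⟩
  set e := connectedComponentIn (X.globalSupport \ X.globalVertices) p
  have hsame : ∀ {q : ℝ × ℝ} {a' b' : ℝ}, q.1 ∈ Ioo a b → X.IsElementary a' b' →
      q.1 ∈ Icc a' b' → a' = a ∧ b' = b := by
    intro q a' b' hq h' hq'
    obtain ⟨h1, h2⟩ := hab.eq_of_overlap h' (hq.1.trans_le hq'.2) (hq'.1.trans_lt hq.2)
    exact ⟨h1.symm, h2.symm⟩
  have hend : ∀ q ∈ e, q.1 ≠ a ∧ q.1 ≠ b := by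
    intro q hq
    have := connectedComponentIn_subset _ _ hq
    exact ⟨fun h => this.2 (.inr ⟨this.1, a, b, hab, .inl h⟩),
      fun h => this.2 (.inr ⟨this.1, a, b, hab, .inr h⟩)⟩
  have hpe : p ∈ e := mem_connectedComponentIn ⟨hpS, hpV⟩
  have hpI : p.1 ∈ Ioo a b :=
    ⟨hpab.1.lt_of_ne (hend p hpe).1.symm, hpab.2.lt_of_ne (hend p hpe).2⟩
  -- an edge does not cross the sides of the slab, where all points are vertices
  have heI : ∀ q ∈ e, q.1 ∈ Ioo a b := by
    intro q hq
    have hord : (Prod.fst '' e).OrdConnected :=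
      (isPreconnected_connectedComponentIn.image _ continuous_fst.continuousOn).ordConnected
    by_contra hqI
    rw [mem_Ioo, not_and_or, not_lt, not_lt] at hqI
    rcases hqI with h | h
    · obtain ⟨z, hz, hza⟩ := hord.out (mem_image_of_mem _ hq) (mem_image_of_mem _ hpe)
        ⟨h, hpI.1.le⟩
      exact (hend z hz).1 hza
    · obtain ⟨z, hz, hza⟩ := hord.out (mem_image_of_mem _ hpe) (mem_image_of_mem _ hq)
        ⟨hpI.2.le, h⟩
      exact (hend z hz).2 hza
  have hsub1 : X.globalSupport \ X.globalVertices ∩ {q | q.1 ∈ Ioo a b} ⊆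
      ((X.relLines a b).support \ (X.relLines a b).vertices) ∩ {q | q.1 ∈ Ioo a b} := by
    rintro q ⟨⟨⟨a', b', h', hq', hqL⟩, hqV⟩, hq⟩
    obtain ⟨rfl, rfl⟩ := hsame hq h' hq'
    exact ⟨⟨hqL, fun hv => hqV (.inl ⟨a', b', h', hq', hv⟩)⟩, hq⟩
  have hsub2 : ((X.relLines a b).support \ (X.relLines a b).vertices) ∩ {q | q.1 ∈ Ioo a b} ⊆
      X.globalSupport \ X.globalVertices := by
    rintro q ⟨⟨hqS, hqV⟩, hq⟩
    refine ⟨⟨a, b, hab, ⟨hq.1.le, hq.2.le⟩, hqS⟩, ?_⟩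
    rintro (⟨a', b', h', hq', hv⟩ | ⟨_, a', b', h', hq'⟩)
    · obtain ⟨rfl, rfl⟩ := hsame hq h' hq'
      exact hqV hv
    · have hab' : a' < b' := by obtain ⟨_, hs, -⟩ := h'; exact hs.1
      have : q.1 ∈ Icc a' b' := by
        rcases hq' with h | h <;> rw [h]
        · exact ⟨le_rfl, hab'.le⟩
        · exact ⟨hab'.le, le_rfl⟩
      obtain ⟨rfl, rfl⟩ := hsame hq h' this
      rcases hq' with h | h
      · exact hq.1.ne' h
      · exact hq.2.ne h
  have hpmem := hsub1 ⟨⟨hpS, hpV⟩, hpI⟩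
  refine ⟨⟨p, hpmem, ?_⟩, _, isPreconnected_connectedComponentIn, ?_, hax, heF⟩
  · apply Subset.antisymm
    · exact isPreconnected_connectedComponentIn.subset_connectedComponentIn hpe
        fun q hq => hsub1 ⟨connectedComponentIn_subset _ _ hq, heI q hq⟩
    · exact connectedComponentIn_mono _ hsub2
  · intro q hq hqI hqS
    exact (connectedComponentIn_subset _ _ hq).2 ⟨a, b, hab, hqI, hqS⟩

theorem encard_globalZoneEdges_le (hX : X.Generic) (hp : X.NeverParallel) :
    X.globalZoneEdges.encard ≤ (24 * τ * n ^ 2 + 48 * τ * n : ℕ) := by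
  have hsub : X.globalZoneEdges ⊆ ⋃ q ∈ {q : ℝ × ℝ | X.IsElementary q.1 q.2},
      {e | (X.relLines q.1 q.2).IsZoneEdge (Icc q.1 q.2) (Ioo q.1 q.2) e} := by
    intro e he
    obtain ⟨a, b, hab, h⟩ := isZoneEdge_of_mem_globalZoneEdges he
    exact mem_biUnion (x := (a, b)) hab h
  have hslab : ∀ q ∈ {q : ℝ × ℝ | X.IsElementary q.1 q.2},
      {e | (X.relLines q.1 q.2).IsZoneEdge (Icc q.1 q.2) (Ioo q.1 q.2) e}.encard ≤
        (20 * n : ℕ) := by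
    rintro ⟨a, b⟩ hab
    obtain ⟨i, hs, -⟩ := id hab
    exact (LineFamily.encard_isZoneEdge_slab_le (hs.distinct_relLines hX) (hp a b hab) a b).trans
      (by push_cast; rfl)
  rcases n.eq_zero_or_pos with rfl | hn
  · refine (encard_le_encard hsub).trans (le_of_eq_of_le ?_ zero_le)
    simp only [encard_eq_zero, iUnion_eq_empty]
    exact fun q hq => encard_eq_zero.1 (nonpos_iff_eq_zero.1 (hslab q hq))
  · have : Nonempty (Fin n) := ⟨⟨0, hn⟩⟩
    have hcard := encard_isElementary_le X
    have hfin : {q : ℝ × ℝ | X.IsElementary q.1 q.2}.Finite :=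
      finite_of_encard_le_coe hcard
    refine (encard_le_encard hsub).trans ((encard_biUnion_le hfin hslab).trans ?_)
    refine (mul_le_mul_left hcard _).trans ?_
    rw [← Nat.cast_mul, Nat.cast_le]
    nlinarith [Nat.zero_le (τ * n ^ 2), Nat.zero_le (τ * n)]

/-! ### Central trajectories over the whole time span -/

theorem exists_mem_Icc_time (X : Entities n τ) (ht : t ∈ Ioo X.first X.last) :
    ∃ i : Fin τ, t ∈ Icc (X.time i.castSucc) (X.time i.succ) := by
  by_contra! hcon
  have : ∀ j : Fin (τ + 1), X.time j ≤ t := by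
    intro j
    induction j using Fin.induction with
    | zero => exact ht.1.le
    | succ i ih =>
      by_contra! hlt
      exact hcon i ⟨ih, hlt.le⟩
  exact absurd ht.2 (not_lt.2 (this (Fin.last τ)))

/-- A trajectoid has a break only where two entities meet, which happens to two given entities at
most once in each `[t_i, t_{i+1}]`. -/
theorem encard_breakTimes_le (hX : X.Generic) {T : ℝ → Fin n}
    (hT : IsTrajectoid X.pos 0 X.first X.last T) :
    (range X.time ∪ breakTimes T X.first X.last).encard ≤ (τ + 1 + τ * n ^ 2 : ℕ) := by
  have h1 : (range X.time).encard ≤ (τ + 1 : ℕ) := by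
    rw [← image_univ]
    refine (encard_image_le _ _).trans ?_
    rw [encard_univ]; simp
  have h2 : (breakTimes T X.first X.last).encard ≤ (τ * n ^ 2 : ℕ) := by
    refine (encard_le_of_charge (P := (univ : Set (Fin τ × Fin n × Fin n)))
      (fun t q => t ∈ Icc (X.time q.1.castSucc) (X.time q.1.succ) ∧ q.2.1 ≠ q.2.2 ∧
        X.pos q.2.1 t = X.pos q.2.2 t) ?_ ?_).trans ?_
    · intro t ht
      obtain ⟨σ, ψ, hne, h⟩ := hT.exists_meet ht
      obtain ⟨i, hi⟩ := X.exists_mem_Icc_time ht.1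
      exact ⟨(i, σ, ψ), mem_univ _, hi, hne, h⟩
    · rintro t _ t' _ ⟨i, σ, ψ⟩ ⟨hi, hne, h⟩ ⟨hi', _, h'⟩
      by_contra htt
      simp only at hi hi' h h' hne
      rw [X.pos_eq_eval i _ hi, X.pos_eq_eval i _ hi] at h
      rw [X.pos_eq_eval i _ hi', X.pos_eq_eval i _ hi'] at h'
      exact hne ((hX.distinct_lines i).eq_of_eval_eval htt h h')
    · rw [encard_univ]; simp [sq]
  refine (encard_union_le _ _).trans ((add_le_add h1 h2).trans ?_)
  rw [← Nat.cast_add]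

end Entities

theorem finite_and_ncard_le_of_encard_le {α : Type*} {s : Set α} {m : ℕ} (h : s.encard ≤ m) :
    s.Finite ∧ s.ncard ≤ m := by
  have hfin : s.Finite := finite_of_encard_le_coe h
  exact ⟨hfin, by rwa [← hfin.cast_ncard_eq, Nat.cast_le] at h⟩

end CentralTrajectory

theorem mainTheorem8 :
    -- `n` lines over an interval `[a, b]`, with the ideal trajectory on the `x`-axis
    (∀ (n : ℕ) (L : CentralTrajectory.LineFamily n), L.Distinct → L.NoHorizontal →
      (L.clippedZoneEdges.Finite ∧ L.clippedZoneEdges.ncard ≤ 8 * n) ∧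
      ∀ (a b : ℝ), a < b → ∀ T : ℝ → Fin n,
        CentralTrajectory.IsAreaMinimal L.eval 0 a b T →
          (∀ t ∈ Set.Icc a b, (t, L.eval (T t) t) ∈ L.clippedZone) ∧
          ({a, b} ∪ CentralTrajectory.breakTimes T a b).Finite ∧
          ({a, b} ∪ CentralTrajectory.breakTimes T a b).ncard ≤ 8 * n) ∧
    -- a single elementary interval `[a, b]` of piecewise linear trajectories
    (∀ (n τ : ℕ) (X : CentralTrajectory.Entities n τ), X.Generic →
      ∀ a b : ℝ, X.IsElementary a b → (X.relLines a b).NoHorizontal →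
        ((X.relLines a b).clippedZoneEdges.Finite ∧
          (X.relLines a b).clippedZoneEdges.ncard ≤ 8 * n) ∧
        ∀ T : ℝ → Fin n, CentralTrajectory.IsCentral X.pos 0 a b T →
          (∀ t ∈ Set.Icc a b, (t, X.pos (T t) t - X.ideal t) ∈ (X.relLines a b).clippedZone) ∧
          ({a, b} ∪ CentralTrajectory.breakTimes T a b).Finite ∧
          ({a, b} ∪ CentralTrajectory.breakTimes T a b).ncard ≤ 8 * n) ∧
    -- the global zone
    (∀ (n τ : ℕ) (X : CentralTrajectory.Entities n τ), X.Generic → X.NeverParallel →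
      X.globalZoneEdges.Finite ∧
      X.globalZoneEdges.ncard ≤ 24 * τ * n ^ 2 + 48 * τ * n) ∧
    -- the central trajectory during the whole time span
    (∃ C : ℕ, ∀ (n τ : ℕ) (X : CentralTrajectory.Entities n τ), 0 < τ → X.Generic →
      ∀ T : ℝ → Fin n, CentralTrajectory.IsCentral X.pos 0 X.first X.last T →
        (Set.range X.time ∪ CentralTrajectory.breakTimes T X.first X.last).Finite ∧
        (Set.range X.time ∪ CentralTrajectory.breakTimes T X.first X.last).ncard
          ≤ C * τ * n ^ 2) := by
  have hlines : ∀ (n : ℕ) (L : CentralTrajectory.LineFamily n), L.Distinct → L.NoHorizontal →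
      (L.clippedZoneEdges.Finite ∧ L.clippedZoneEdges.ncard ≤ 8 * n) ∧
      ∀ (a b : ℝ), a < b → ∀ T : ℝ → Fin n,
        CentralTrajectory.IsAreaMinimal L.eval 0 a b T →
          (∀ t ∈ Set.Icc a b, (t, L.eval (T t) t) ∈ L.clippedZone) ∧
          ({a, b} ∪ CentralTrajectory.breakTimes T a b).Finite ∧
          ({a, b} ∪ CentralTrajectory.breakTimes T a b).ncard ≤ 8 * n := by
    intro n L hd hn
    refine ⟨?_, fun a b hab T hT => ⟨fun t ht => ?_, ?_⟩⟩
    · have h := CentralTrajectory.LineFamily.encard_clippedZoneEdges_le hd hn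
      refine CentralTrajectory.finite_and_ncard_le_of_encard_le (h.trans ?_)
      have : (6 * n : ℕ) ≤ 8 * n := by lia
      exact_mod_cast this
    · exact CentralTrajectory.LineFamily.mem_clippedZone_of_isAreaMinimal hd hn hab hT ht
    · exact CentralTrajectory.finite_and_ncard_le_of_encard_le
        (CentralTrajectory.LineFamily.encard_vertices_isAreaMinimal_le hd hn hab hT)
  refine ⟨hlines, fun n τ X hX a b hab hn => ?_, fun n τ X hX hp => ?_, 3,
    fun n τ X hτ hX T hT => ?_⟩
  · obtain ⟨i, hs, -⟩ := hab
    obtain ⟨h1, h2⟩ := hlines n _ (hs.distinct_relLines hX) hn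
    refine ⟨h1, fun T hT => ?_⟩
    obtain ⟨h3, h4⟩ := h2 a b hs.1 T (hs.isAreaMinimal hT)
    refine ⟨fun t ht => ?_, h4⟩
    rw [← hs.eval_relLines _ ht]
    exact h3 t ht
  · exact CentralTrajectory.finite_and_ncard_le_of_encard_le
      (CentralTrajectory.Entities.encard_globalZoneEdges_le hX hp)
  · obtain ⟨h1, h2⟩ := CentralTrajectory.finite_and_ncard_le_of_encard_le
      (CentralTrajectory.Entities.encard_breakTimes_le hX hT.1)
    refine ⟨h1, h2.trans ?_⟩
    have hn : 0 < n := (T 0).pos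
    have h3 : τ ≤ τ * n ^ 2 := Nat.le_mul_of_pos_right _ (pow_pos hn 2)
    calc τ + 1 + τ * n ^ 2 ≤ τ * n ^ 2 + τ * n ^ 2 + τ * n ^ 2 := by lia
      _ = 3 * τ * n ^ 2 := by ring
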